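/- **Setting.** Players $A$ and $C$ first bargain over a surplus $\pi_{AC}>0$; once that dispute has ended, $B$ and $C$ bargain over a surplus $1$. Each stage is a continuous-time war of attrition with common discount rate $r>0$: the first player to concede receives the share $1-\alpha$ of the surplus and the other one the share $\alpha$, where $\tfrac12<\alpha<1$; simultaneous concessions split the surplus equally; a dispute that is never resolved yields $0$. Payoffs are additive across stages and discounted in calendar time. Player $i\in\{A,B,C\}$ is behavioral (never concedes, in either stage) with probability $z_i(0)\in(0,1)$ and rational otherwise, independently; $C$ has the same type in both stages. All concessions and their times are public. Strategies of rational types are (randomized) concession times in $[0,\infty]$, in stage 2 as a function of when and by whom stage 1 was ended. Let $F_i(t)$ be the probability, unconditional over types, that $i\in\{A,C\}$ concedes in stage 1 by time $t$ if the opponent has not conceded, let $z_i(t)=z_i(0)/(1-F_i(t))$, $z_i(0+)=z_i(0)/(1-F_i(0))$, and $\lambda_i=F_i'/(1-F_i)$. A PBE is a profile of strategies and beliefs such that the strategies are sequentially rational (at every history that neither rules out the rational type of the player or contradicts the player's own plan, nor has probability zero under the opponent's continuation plan and the beliefs), beliefs follow Bayes' rule, stage 2 after a concession of $A$ at $\tau$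 starts with reputations $(z_B(0),z_C(\tau))$, and $C$ is known to be rational after she has conceded. As usual in this model we consider PBE in which $F_A$ and $F_C$ are absolutely continuous on $(0,\infty)$ with piecewise continuous density (an atom at $0$ is allowed); deviations are unrestricted. Put $\lambda^{AG}=\frac{r(1-\alpha)}{2\alpha-1}$ and $g(x;y)=\max\{1-y/x,0\}$. In the *bilateral AG equilibrium* with reputations $(z_i,z_j)$, player $i$ concedes by time $t\ge 0$ with probability $1-(1-g(z_j;z_i))e^{-\lambda^{AG}\min\{t,T_{ij}\}}$, where $T_{ij}=\min\{-\frac{1}{\lambda^{AG}}\log z_i,-\frac1{\lambda^{AG}}\log z_j\}$, and symmetrically for $j$. **Proposition.** There exists a PBE, and it is unique up to the plan of $B$ (and the beliefs about $B$) in a stage 2 that follows a concession by $C$, and the stage-2 plan of a rational $C$ after times by which she would have conceded in stage 1 with probability one; neither affects the play that is reached with positive probability. In this PBE: 1. **(Stage 2)** If stage 1 ends at $\tau$ because only $A$ concedes, stage 2 is the bilateral AG equilibrium between $B$ and $C$ with initial posteriors $(z_B(0),z_C(\tau))$. If $C$ concedes at $\tau$, she is revealed rational and concedes to $B$ with probability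 one at the start of stage 2, and $B$ does not concede at that instant. 2. **(Stage-1 hazards)** There is $T\in(0,\infty)$ with $z_A(T)=z_C(T)=1$, and for a.e. $t\in(0,T)$ both players concede with positive density and $$\lambda_C(t)=\lambda^{AG},\qquad \lambda_A(t)=\lambda^{AG}\,\frac{\pi_{AC}+1}{\pi_{AC}+g(z_C(t);z_B(0))}.$$ Equivalently, $\lambda_A(t)=\lambda^{AG}\frac{\pi_{AC}+1}{\pi_{AC}}$ if $z_C(t)\le z_B(0)$, and $\lambda_A(t)=\lambda^{AG}\frac{\pi_{AC}+1}{\pi_{AC}+1-z_B(0)/z_C(t)}$ if $z_C(t)>z_B(0)$. 3. **(Time-0 atom and terminal time)** At most one of $A$, $C$ concedes with positive probability at time $0$ in stage 1, and $T=-\frac{1}{\lambda^{AG}}\log z_C(0+)$. Let $$\bar z_A=\begin{cases}\dfrac{(\pi_{AC}+1)z_C(0)-z_B(0)}{\pi_{AC}+1-z_B(0)}, & z_C(0)\ge z_B(0),\\[1em] \dfrac{\pi_{AC}z_B(0)}{\pi_{AC}+1-z_B(0)}\Bigl(\dfrac{z_C(0)}{z_B(0)}\Bigr)^{\frac{\pi_{AC}+1}{\pi_{AC}}},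 & z_C(0)<z_B(0),\end{cases}\qquad \tilde z_A=\frac{\pi_{AC}z_B(0)}{\pi_{AC}+1-z_B(0)}.$$ (i) If $z_A(0)<\bar z_A$, then $F_A(0)=1-z_A(0)/\bar z_A>0$, $F_C(0)=0$, $z_C(0+)=z_C(0)$ and $z_A(0+)=\bar z_A$. (ii) If $z_A(0)=\bar z_A$, then $F_A(0)=F_C(0)=0$, $z_A(0+)=z_A(0)$ and $z_C(0+)=z_C(0)$. (iii) If $z_A(0)>\bar z_A$, then $F_A(0)=0$, $F_C(0)=1-z_C(0)/z_C(0+)>0$, $z_A(0+)=z_A(0)$, where: if $z_A(0)\ge\tilde z_A$, then $z_C(0+)\ge z_B(0)$ and $z_C(0+)=\frac{z_B(0)+z_A(0)(\pi_{AC}+1-z_B(0))}{\pi_{AC}+1}$; if $z_A(0)<\tilde z_A$, then $z_C(0+)<z_B(0)$ and $z_C(0+)=z_B(0)\Bigl(\frac{z_A(0)(\pi_{AC}+1-z_B(0))}{\pi_{AC}z_B(0)}\Bigr)^{\frac{\pi_{AC}}{\pi_{AC}+1}}$. -/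

import Mathlib

open Set Filter Topology MeasureTheory ProbabilityTheory
open scoped ENNReal NNReal

noncomputable section

/-- Primitives of the sequential bargaining game: discount rate `r`, the winner's share `α`, the
surplus `πAC` of the `A`–`C` dispute (the surplus of the `B`–`C` dispute is normalized to `1`),
and the prior probabilities `zA`, `zB`, `zC` that the players are behavioral. -/
structure SeqGame where
  r : ℝ
  α : ℝ
  πAC : ℝ
  zA : ℝ
  zB : ℝ
  zC : ℝ
  r_pos : 0 < r
  half_lt_α : 1 / 2 < α
  α_lt_one : α < 1
  πAC_pos : 0 < πAC
  zA_mem : zA ∈ Ioo (0 : ℝ) 1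
  zB_mem : zB ∈ Ioo (0 : ℝ) 1
  zC_mem : zC ∈ Ioo (0 : ℝ) 1

/-- The ways in which stage 1 can end: `A` concedes, `C` concedes, or both concede at the same
instant. -/
inductive Ending where
  | byA : Ending
  | byC : Ending
  | both : Ending

/-- The public record of who ended stage 1, when `C`'s planned concession time is `c` and that of
`A` is `a`. -/
def endingOf (c a : ℝ≥0∞) : Ending :=
  if c < a then Ending.byC else if a < c then Ending.byA else Ending.both

/-- Discount factor at a time in `[0, ∞]`; it vanishes at `∞`. -/
def disc (r : ℝ) (t : ℝ≥0∞) : ℝ :=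
  if t = ⊤ then 0 else Real.exp (-r * t.toReal)

/-- Realized payoff, in a war of attrition over the surplus `p`, of a player who plans to concede
at time `x` against an opponent who plans to concede at time `y` (`∞` means never). -/
def warPayoff (r α p : ℝ) (x y : ℝ≥0∞) : ℝ :=
  disc r (min x y) * p * (if x < y then 1 - α else if y < x then α else 1 / 2)

/-- Expected value of `u x y` when the own concession time `x` has law `μ` and, independently, the
opponent's concession time `y` has law `ν`. -/
def expPayoff (u : ℝ≥0∞ → ℝ≥0∞ → ℝ) (μ ν : Measure ℝ≥0∞) : ℝ :=
  ∫ x, ∫ y, u x y ∂ν ∂μ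

/-- Law of the concession time of a player who is behavioral (never concedes) with probability
`z`, and who otherwise concedes at a time with law `μ`. -/
def typeMix (z : ℝ) (μ : Measure ℝ≥0∞) : Measure ℝ≥0∞ :=
  ENNReal.ofReal z • Measure.dirac ⊤ + ENNReal.ofReal (1 - z) • μ

/-- Law of the concession time of an opponent who has not conceded before `t`, who is believed to
be behavioral with probability `z`, and whose rational type uses the plan `ν`. It is the zero
measure exactly when the opponent is believed to be rational for sure and the plan `ν` does not
allow her to be still waiting at `t`. -/
def contLaw (z : ℝ) (ν : Measure ℝ≥0∞) (t : ℝ≥0) : Measure ℝ≥0∞ :=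
  typeMix z (ProbabilityTheory.cond ν (Ici (t : ℝ≥0∞)))

/-- At the history "nobody has conceded before `t`", continuing with the plan `μ` is at least as
good as any other (randomized) concession time in `[t, ∞]`, given the belief `z` about the
opponent's type and the plan `ν` of the opponent's rational type. -/
def IsOptimalFrom (u : ℝ≥0∞ → ℝ≥0∞ → ℝ) (μ ν : Measure ℝ≥0∞) (z : ℝ) (t : ℝ≥0) : Prop :=
  ∀ μ' : Measure ℝ≥0∞, IsProbabilityMeasure μ' → μ' (Iio (t : ℝ≥0∞)) = 0 →
    expPayoff u μ' (contLaw z ν t) ≤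
      expPayoff u (ProbabilityTheory.cond μ (Ici (t : ℝ≥0∞))) (contLaw z ν t)

/-- Bayes' rule: posterior probability of the behavioral type, from the prior `p`, after an
observation that has probability one under the behavioral type and `q` under the rational one. -/
def bayes (p q : ℝ) : ℝ := p / (p + (1 - p) * q)

/-- A strategy profile of the rational types together with a belief system.

A plan is the law of a (random) concession time in `[0, ∞]`. `planA` and `planC` are the stage-1
plans. `planB₂ e τ` and `planC₂ e τ` are the stage-2 plans, in time elapsed since the start of
stage 2, after stage 1 has ended at calendar time `τ` in the way `e`.

`beliefA t` and `beliefC t` are the posterior probabilities that `A` and `C` are behavioral when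
nobody has conceded before `t` in stage 1; `beliefB₂ e τ t` and `beliefC₂ e τ t` are those for `B`
and `C` when stage 1 has ended at `τ` in the way `e` and nobody has conceded in stage 2 before the
elapsed time `t`. (`B` does not act in stage 1 and keeps the reputation `zB` there.) -/
structure Assessment where
  planA : Measure ℝ≥0∞
  planC : Measure ℝ≥0∞
  planB₂ : Ending → Kernel ℝ≥0 ℝ≥0∞
  planC₂ : Ending → Kernel ℝ≥0 ℝ≥0∞
  prob_planA : IsProbabilityMeasure planA
  prob_planC : IsProbabilityMeasure planC
  markov_planB₂ : ∀ e, IsMarkovKernel (planB₂ e)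
  markov_planC₂ : ∀ e, IsMarkovKernel (planC₂ e)
  beliefA : ℝ≥0 → ℝ
  beliefC : ℝ≥0 → ℝ
  beliefB₂ : Ending → ℝ≥0 → ℝ≥0 → ℝ
  beliefC₂ : Ending → ℝ≥0 → ℝ≥0 → ℝ

/-- Cumulative distribution function of the concession time, unconditional over types, of a player
who is behavioral with probability `z` and whose rational type uses the plan `μ`. -/
def concessionCdf (z : ℝ) (μ : Measure ℝ≥0∞) (t : ℝ) : ℝ :=
  (1 - z) * μ.real {s | s ≠ ⊤ ∧ s.toReal ≤ t}

/-- Hazard rate of a distribution function. -/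
def hazard (F : ℝ → ℝ) (t : ℝ) : ℝ := deriv F t / (1 - F t)

/-- Posterior probability of the behavioral type after no concession up to and including `t`, from
the prior `z`, when concessions have distribution function `F`. -/
def reputation (z : ℝ) (F : ℝ → ℝ) (t : ℝ) : ℝ := z / (1 - F t)

/-- Regularity of a concession distribution function: absolute continuity on `(0, ∞)` (so that only
time `0` can carry an atom) with a density `F'` that is piecewise continuous on `(0, ∞)`. -/
structure IsRegularCdf (F : ℝ → ℝ) : Prop where
  absCont : ∀ a b : ℝ, 0 < a → a ≤ b → AbsolutelyContinuousOnInterval F a b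
  piecewiseCont : ∃ D : Set ℝ, (∀ a b : ℝ, 0 < a → (D ∩ Icc a b).Finite) ∧
    (∀ t : ℝ, 0 < t → t ∉ D → DifferentiableAt ℝ F t ∧ ContinuousAt (deriv F) t) ∧
    (∀ t ∈ D, 0 < t →
      (∃ l, Tendsto (deriv F) (𝓝[<] t) (𝓝 l)) ∧ (∃ l, Tendsto (deriv F) (𝓝[>] t) (𝓝 l)))

/-- Equilibrium probability `max {1 - z_j / z_i, 0}` of an immediate concession to a player of
reputation `zi` by an opponent of reputation `zj`. -/
def gAG (zi zj : ℝ) : ℝ := max (1 - zj / zi) 0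

/-- Equilibrium distribution function of the concession time (unconditional over types) of a player
of reputation `zi` in the bilateral reputational war of attrition against an opponent of
reputation `zj`: an atom `gAG zj zi` at `0`, then the constant hazard rate `l` up to the terminal
time `min (-log zi / l) (-log zj / l)`, and no concession afterwards. -/
def agCdf (l zi zj t : ℝ) : ℝ :=
  if t < 0 then 0
  else 1 - (1 - gAG zj zi) *
    Real.exp (-l * min t (min (-(1 / l) * Real.log zi) (-(1 / l) * Real.log zj)))

namespace SeqGame

/-- The hazard rate `r (1 - α) / (2 α - 1)` of the bilateral benchmark. -/
def lam (m : SeqGame) : ℝ := m.r * (1 - m.α) / (2 * m.α - 1)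

/-- Realized total payoff of a rational `C` who plans to concede to `A` at `c` and then to use the
stage-2 plans `κ`, when `A` plans to concede at `a`: the stage-1 payoff plus the expected stage-2
payoff against `B`, who is behavioral with probability `zB` and otherwise uses the plans `β`, all
discounted to calendar time `0`. -/
def payoffC (m : SeqGame) (β κ : Ending → Kernel ℝ≥0 ℝ≥0∞) (c a : ℝ≥0∞) : ℝ :=
  warPayoff m.r m.α m.πAC c a +
    disc m.r (min c a) *
      expPayoff (warPayoff m.r m.α 1) (κ (endingOf c a) (min c a).toNNReal)
        (typeMix m.zB (β (endingOf c a) (min c a).toNNReal))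

/-- Sequential rationality of `A`, whose payoff accrues in stage 1 only. -/
def RationalA (m : SeqGame) (σ : Assessment) : Prop :=
  ∀ t : ℝ≥0, σ.planA (Ici (t : ℝ≥0∞)) ≠ 0 →
    IsOptimalFrom (warPayoff m.r m.α m.πAC) σ.planA σ.planC (σ.beliefC t) t

/-- Sequential rationality of `C` at the stage-1 histories: no joint change of the stage-1
concession time and of the stage-2 plans is profitable. -/
def RationalC₁ (m : SeqGame) (σ : Assessment) : Prop :=
  ∀ t : ℝ≥0, σ.planC (Ici (t : ℝ≥0∞)) ≠ 0 →
    ∀ μ' : Measure ℝ≥0∞, IsProbabilityMeasure μ' → μ' (Iio (t : ℝ≥0∞)) = 0 →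
    ∀ κ' : Ending → Kernel ℝ≥0 ℝ≥0∞, (∀ e, IsMarkovKernel (κ' e)) →
      expPayoff (m.payoffC σ.planB₂ κ') μ' (contLaw (σ.beliefA t) σ.planA t) ≤
        expPayoff (m.payoffC σ.planB₂ σ.planC₂)
          (ProbabilityTheory.cond σ.planC (Ici (t : ℝ≥0∞)))
          (contLaw (σ.beliefA t) σ.planA t)

/-- Sequential rationality of `B` at the stage-2 histories at which the rational type of `B` is not
ruled out and which the believed continuation of `C` does not exclude. -/
def RationalB₂ (m : SeqGame) (σ : Assessment) : Prop :=
  ∀ (e : Ending) (τ t : ℝ≥0), σ.beliefB₂ e τ t < 1 →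
    σ.planB₂ e τ (Ici (t : ℝ≥0∞)) ≠ 0 →
    contLaw (σ.beliefC₂ e τ t) (σ.planC₂ e τ) t ≠ 0 →
    IsOptimalFrom (warPayoff m.r m.α 1) (σ.planB₂ e τ) (σ.planC₂ e τ) (σ.beliefC₂ e τ t) t

/-- Sequential rationality of `C` at the stage-2 histories at which the rational type of `C` is not
ruled out and which the believed continuation of `B` does not exclude. -/
def RationalC₂ (m : SeqGame) (σ : Assessment) : Prop :=
  ∀ (e : Ending) (τ t : ℝ≥0), σ.beliefC₂ e τ t < 1 →
    σ.planC₂ e τ (Ici (t : ℝ≥0∞)) ≠ 0 →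
    contLaw (σ.beliefB₂ e τ t) (σ.planB₂ e τ) t ≠ 0 →
    IsOptimalFrom (warPayoff m.r m.α 1) (σ.planC₂ e τ) (σ.planB₂ e τ) (σ.beliefB₂ e τ t) t

/-- The beliefs follow from the plans by Bayes' rule. If `A` alone ends stage 1 at `τ`, stage 2
starts with the posterior of `C` after no concession up to and including `τ`; once `C` has
conceded, she is known to be rational, because behavioral types never concede. -/
structure BayesConsistent (m : SeqGame) (σ : Assessment) : Prop where
  stage1A : ∀ t : ℝ≥0, σ.beliefA t = bayes m.zA (σ.planA.real (Ici (t : ℝ≥0∞)))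
  stage1C : ∀ t : ℝ≥0, σ.beliefC t = bayes m.zC (σ.planC.real (Ici (t : ℝ≥0∞)))
  stage2B : ∀ (e : Ending) (τ t : ℝ≥0),
    σ.beliefB₂ e τ t = bayes m.zB ((σ.planB₂ e τ).real (Ici (t : ℝ≥0∞)))
  stage2C_byA : ∀ τ t : ℝ≥0, σ.beliefC₂ Ending.byA τ t =
    bayes (bayes m.zC (σ.planC.real (Ioi (τ : ℝ≥0∞))))
      ((σ.planC₂ Ending.byA τ).real (Ici (t : ℝ≥0∞)))
  stage2C_byC : ∀ τ t : ℝ≥0, σ.beliefC₂ Ending.byC τ t = 0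
  stage2C_both : ∀ τ t : ℝ≥0, σ.beliefC₂ Ending.both τ t = 0

/-- Stage-1 concession distribution function of `A`. -/
def FA (m : SeqGame) (σ : Assessment) : ℝ → ℝ := concessionCdf m.zA σ.planA

/-- Stage-1 concession distribution function of `C`. -/
def FC (m : SeqGame) (σ : Assessment) : ℝ → ℝ := concessionCdf m.zC σ.planC

/-- Perfect Bayesian equilibrium of the sequential game, with regular stage-1 distributions.
Deviations are not required to be regular. -/
structure IsPBE (m : SeqGame) (σ : Assessment) : Prop where
  rationalA : m.RationalA σ
  rationalC₁ : m.RationalC₁ σ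
  rationalB₂ : m.RationalB₂ σ
  rationalC₂ : m.RationalC₂ σ
  bayesConsistent : m.BayesConsistent σ
  regularA : IsRegularCdf (m.FA σ)
  regularC : IsRegularCdf (m.FC σ)

/-- The threshold `z̄_A`. -/
def zBarA (m : SeqGame) : ℝ :=
  if m.zB ≤ m.zC then ((m.πAC + 1) * m.zC - m.zB) / (m.πAC + 1 - m.zB)
  else m.πAC * m.zB / (m.πAC + 1 - m.zB) * (m.zC / m.zB) ^ ((m.πAC + 1) / m.πAC)

/-- The threshold `z̃_A`. -/
def zTildeA (m : SeqGame) : ℝ := m.πAC * m.zB / (m.πAC + 1 - m.zB)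

end SeqGame

/-- Two assessments coincide, except possibly for

* the plan of `B` (and the beliefs about `B`) in a stage 2 that follows a concession by `C`; and
* the stage-2 plan of a rational `C` after a concession of `A` at a time by which the rational
  type of `C` would already have conceded with probability one. -/
structure SamePlay (σ ρ : Assessment) : Prop where
  planA : σ.planA = ρ.planA
  planC : σ.planC = ρ.planC
  planB₂_byA : σ.planB₂ Ending.byA = ρ.planB₂ Ending.byA
  planC₂_byA : ∀ τ : ℝ≥0, σ.planC (Ioi (τ : ℝ≥0∞)) ≠ 0 →
    σ.planC₂ Ending.byA τ = ρ.planC₂ Ending.byA τ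
  planC₂_byC : σ.planC₂ Ending.byC = ρ.planC₂ Ending.byC
  planC₂_both : σ.planC₂ Ending.both = ρ.planC₂ Ending.both
  beliefA : σ.beliefA = ρ.beliefA
  beliefC : σ.beliefC = ρ.beliefC
  beliefB₂_byA : σ.beliefB₂ Ending.byA = ρ.beliefB₂ Ending.byA
  beliefC₂ : σ.beliefC₂ = ρ.beliefC₂

end

/-! Every war of attrition here is an instance of `Contest`: conceding first pays `L`, a tie pays
`M`, being conceded to at time y pays `W y`, with L < M < W. Comparing two concession times x < x'
bounds the gain from waiting by the opponent's mass on [x, x'] and the loss by discounting of `L`.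
This gives the structure of equilibrium: a best reply avoids the opponent's atoms, before each best
reply the opponent has best replies, best replies are bounded when the opponent may be behavioral,
and so the positive best replies of both players form one common interval (0, T]
(`RepliesTo.exists_terminal`). On it the value is constant, which forces the opponent's hazard rate
to be r L / (W - L) (`hasDerivAt_surv`). Conversely, this hazard rate makes the value constant
(`hasDerivAt_valueRight`).

In stage 2 both hazard rates are the constant `lam`. At T only behavioral types are left and at most
one player has an atom at 0, so the two terminal conditions determine T and the atom
(`bilateral_unique`). A player known to be rational concedes at once (`RepliesTo.measure_Ioi_zero`).
Hence a rational C expects 1 - α in stage 2 if she conceded in stage 1, and 1 - α + (2α - 1) g(z_C;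
z_B) if A did. Adding these values to the stage-1 shares turns stage 1 into a contest for C
(`contestC`), while A plays an ordinary war over π.

A's indifference gives C the hazard rate `lam`; C's indifference gives A the rate `hazardA` as a
function of z_C. Dividing the two reputation equations, d log z_A / d log z_C = (π + 1) / (π +
g(z_C; z_B)), whose solution through (1, 1) is z_A = `zeta` z_C. Reputations therefore move along
this increasing curve to (1, 1), and the time-0 atom of a single player must bring the priors onto
it (`IsStart`). Monotonicity of `zeta` makes the starting point exist and be unique; the thresholds
are its values at `zC` and `zB`.

Existence follows by building plans with the resulting survival functions. Constant values make them
optimal at the outset, and conditioning carries optimality over to later histories (`value_cond`).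
Joint deviations of C are covered because stage 2 never gives her more than the values built into
`contestC` (`payoffC_le`). -/

noncomputable section

/-! ### Discount factors on [0, ∞]. -/

section Discount

variable {r : ℝ}

@[simp] lemma disc_top (r : ℝ) : disc r ⊤ = 0 := if_pos rfl

@[simp] lemma disc_zero (r : ℝ) : disc r 0 = 1 := by simp [disc]

lemma disc_of_ne_top {t : ℝ≥0∞} (ht : t ≠ ⊤) : disc r t = Real.exp (-r * t.toReal) := if_neg ht

lemma disc_ofReal {t : ℝ} (ht : 0 ≤ t) : disc r (ENNReal.ofReal t) = Real.exp (-r * t) := by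
  rw [disc_of_ne_top ENNReal.ofReal_ne_top, ENNReal.toReal_ofReal ht]

lemma disc_nonneg (r : ℝ) (t : ℝ≥0∞) : 0 ≤ disc r t := by
  unfold disc; split_ifs <;> positivity

lemma disc_pos (r : ℝ) {t : ℝ≥0∞} (ht : t ≠ ⊤) : 0 < disc r t := by
  rw [disc_of_ne_top ht]; positivity

lemma disc_lt_disc (hr : 0 < r) {s t : ℝ≥0∞} (h : s < t) : disc r t < disc r s := by
  by_cases ht : t = ⊤
  · subst ht; simpa using disc_pos r h.ne
  · rw [disc_of_ne_top ht, disc_of_ne_top h.ne_top, Real.exp_lt_exp]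
    have := (ENNReal.toReal_lt_toReal h.ne_top ht).2 h
    nlinarith

lemma disc_le_disc (hr : 0 < r) {s t : ℝ≥0∞} (h : s ≤ t) : disc r t ≤ disc r s := by
  rcases h.eq_or_lt with rfl | h
  · exact le_rfl
  · exact (disc_lt_disc hr h).le

lemma disc_le_one (hr : 0 < r) (t : ℝ≥0∞) : disc r t ≤ 1 := by
  simpa using disc_le_disc hr (zero_le (a := t))

@[fun_prop] lemma measurable_disc (r : ℝ) : Measurable (disc r) := by
  unfold disc
  exact Measurable.ite (measurableSet_singleton _) measurable_const (by fun_prop)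

lemma continuousAt_disc {t : ℝ≥0∞} (ht : t ≠ ⊤) : ContinuousAt (disc r) t := by
  have h : disc r =ᶠ[𝓝 t] fun s => Real.exp (-r * s.toReal) := by
    filter_upwards [isOpen_ne.mem_nhds ht] with s hs using disc_of_ne_top hs
  refine ContinuousAt.congr ?_ h.symm
  exact (((ENNReal.continuousAt_toReal ht).const_mul (-r))).rexp

end Discount

/-! ### One player's problem: the gains and losses from delaying a concession. -/

/-- A player's side of a war of attrition: she receives `L` when she concedes first, `M` at a
simultaneous concession and `W y` when the opponent concedes first at time `y`, all discounted at
the rate `r`. -/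
structure Contest where
  r : ℝ
  L : ℝ
  M : ℝ
  δ : ℝ
  K : ℝ
  W : ℝ≥0∞ → ℝ
  r_pos : 0 < r
  L_pos : 0 < L
  δ_pos : 0 < δ
  L_add_le : L + δ ≤ M
  M_add_le : ∀ y, M + δ ≤ W y
  W_le : ∀ y, W y ≤ K
  measurable_W : Measurable W

namespace Contest

variable (w : Contest)

lemma M_pos : 0 < w.M := by linarith [w.L_pos, w.δ_pos, w.L_add_le]
lemma W_pos (y : ℝ≥0∞) : 0 < w.W y := by linarith [w.M_pos, w.δ_pos, w.M_add_le y]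
lemma K_pos : 0 < w.K := (w.W_pos 0).trans_le (w.W_le 0)
lemma L_lt_W (y : ℝ≥0∞) : w.L < w.W y := by linarith [w.δ_pos, w.L_add_le, w.M_add_le y]

/-- Realized payoff of conceding at `x` against an opponent who concedes at `y`. -/
def pay (x y : ℝ≥0∞) : ℝ :=
  if x < y then disc w.r x * w.L else if y < x then disc w.r y * w.W y else disc w.r x * w.M

lemma pay_of_lt {x y : ℝ≥0∞} (h : x < y) : w.pay x y = disc w.r x * w.L := if_pos h

lemma pay_of_gt {x y : ℝ≥0∞} (h : y < x) : w.pay x y = disc w.r y * w.W y := by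
  rw [pay, if_neg h.not_gt, if_pos h]

@[simp] lemma pay_self (x : ℝ≥0∞) : w.pay x x = disc w.r x * w.M := by simp [pay]

lemma pay_nonneg (x y : ℝ≥0∞) : 0 ≤ w.pay x y := by
  unfold pay
  have := w.L_pos; have := w.M_pos; have := w.W_pos y
  have := disc_nonneg w.r x; have := disc_nonneg w.r y
  split_ifs <;> positivity

lemma pay_le (x y : ℝ≥0∞) : w.pay x y ≤ w.K := by
  have h1 := w.M_pos; have h2 := w.W_pos y; have h3 := w.L_lt_W y; have h4 := w.M_add_le y
  have h5 := w.W_le y; have h6 := w.δ_pos; have h7 := w.L_pos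
  have hx := disc_le_one w.r_pos x; have hy := disc_le_one w.r_pos y
  have hx' := disc_nonneg w.r x; have hy' := disc_nonneg w.r y
  unfold pay
  split_ifs <;> nlinarith

lemma measurable_pay : Measurable (Function.uncurry w.pay) := by
  unfold pay Function.uncurry
  have := w.measurable_W
  exact Measurable.ite (measurableSet_lt measurable_fst measurable_snd) (by fun_prop)
    (Measurable.ite (measurableSet_lt measurable_snd measurable_fst) (by fun_prop) (by fun_prop))

lemma measurable_pay_right (x : ℝ≥0∞) : Measurable (w.pay x) :=
  w.measurable_pay.of_uncurry_left

lemma integrable_pay (ν : Measure ℝ≥0∞) [IsFiniteMeasure ν] (x : ℝ≥0∞) :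
    Integrable (w.pay x) ν :=
  Integrable.of_bound (w.measurable_pay_right x).aestronglyMeasurable w.K
    (Eventually.of_forall fun y => by
      rw [Real.norm_of_nonneg (w.pay_nonneg x y)]; exact w.pay_le x y)

/-- Expected payoff of conceding at `x` against an opponent whose concession time has law `ν`. -/
def value (ν : Measure ℝ≥0∞) (x : ℝ≥0∞) : ℝ := ∫ y, w.pay x y ∂ν

lemma measurable_value (ν : Measure ℝ≥0∞) [IsFiniteMeasure ν] : Measurable (w.value ν) :=
  (StronglyMeasurable.integral_prod_right w.measurable_pay.stronglyMeasurable).measurable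

lemma value_nonneg (ν : Measure ℝ≥0∞) (x : ℝ≥0∞) : 0 ≤ w.value ν x :=
  integral_nonneg (w.pay_nonneg x)

lemma value_le (ν : Measure ℝ≥0∞) [IsProbabilityMeasure ν] (x : ℝ≥0∞) : w.value ν x ≤ w.K := by
  refine (integral_mono (w.integrable_pay ν x) (integrable_const w.K) (w.pay_le x)).trans ?_
  simp

lemma integrable_value (ν μ : Measure ℝ≥0∞) [IsProbabilityMeasure ν] [IsFiniteMeasure μ] :
    Integrable (w.value ν) μ :=
  Integrable.of_bound (w.measurable_value ν).aestronglyMeasurable w.K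
    (Eventually.of_forall fun x => by
      rw [Real.norm_of_nonneg (w.value_nonneg ν x)]; exact w.value_le ν x)

/-- Concession times that are best replies to the law `ν` of the opponent's concession time. -/
def best (ν : Measure ℝ≥0∞) : Set ℝ≥0∞ := {x | ∀ y, w.value ν y ≤ w.value ν x}

/-- Delay can help only if the opponent concedes meanwhile, and then by at most `disc x * K`;
against a later concession, or none, it costs the discounting of `L`. The point ⊤ is counted on the
losing side so that x' = ⊤ is covered: never conceding forfeits `L`, in line with `disc ⊤ = 0`. -/
lemma pay_sub_pay_le {x x' : ℝ≥0∞} (h : x < x') (y : ℝ≥0∞) :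
    w.pay x' y - w.pay x y ≤ (Icc x x' \ {⊤}).indicator (fun _ => disc w.r x * w.K) y
      - (Ioi x' ∪ {⊤}).indicator (fun _ => (disc w.r x - disc w.r x') * w.L) y := by
  have hd := disc_lt_disc w.r_pos h
  have hL := w.L_pos
  have hx' := disc_nonneg w.r x'
  have hx := disc_nonneg w.r x
  by_cases hy : y ∈ Ioi x' ∪ {⊤}
  · have hn : y ∉ Icc x x' \ {⊤} := by
      rintro ⟨⟨_, h2⟩, h3⟩
      rcases hy with hy | hy
      · exact absurd h2 (not_le.2 hy)
      · exact h3 hy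
    rw [indicator_of_mem hy, indicator_of_notMem hn]
    rcases hy with hy | rfl
    · rw [w.pay_of_lt hy, w.pay_of_lt (h.trans hy)]; linarith
    · rw [w.pay_of_lt h.lt_top]
      rcases (le_top : x' ≤ ⊤).eq_or_lt with rfl | h'
      · simp
      · rw [w.pay_of_lt h']; linarith
  · rw [indicator_of_notMem hy]
    have hyt : y ≠ ⊤ := fun e => hy (Or.inr e)
    have hyx : y ≤ x' := not_lt.1 fun e => hy (Or.inl e)
    rcases lt_or_ge y x with hxy | hxy
    · rw [indicator_of_notMem (fun hm => absurd hm.1.1 (not_le.2 hxy)),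
        w.pay_of_gt hxy, w.pay_of_gt (hxy.trans h)]; simp
    · rw [indicator_of_mem (show y ∈ Icc x x' \ {⊤} from ⟨⟨hxy, hyx⟩, hyt⟩), sub_zero]
      have h1 := w.pay_nonneg x y
      have hdy := disc_le_disc w.r_pos hxy
      have hdy0 := disc_nonneg w.r y
      have hK := w.W_le y
      have hM := w.M_add_le y
      have hδ := w.δ_pos
      have hM0 := w.M_pos
      have : w.pay x' y ≤ disc w.r x * w.K := by
        rcases hyx.eq_or_lt with rfl | hyx
        · rw [pay_self]; nlinarith
        · rw [w.pay_of_gt hyx]; nlinarith [w.W_pos y]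
      linarith

/-- Outlasting the opponent is worth at least `δ` more than a tie or a concession, whichever is
being replaced. All other losses are bounded by the discounting of `L` between the two times. -/
lemma le_pay_sub_pay {x x' : ℝ≥0∞} (h : x < x') (y : ℝ≥0∞) :
    (Ico x x').indicator (fun _ => w.δ * disc w.r x') y
      - (Ici x).indicator (fun _ => (disc w.r x - disc w.r x') * w.L) y ≤
    w.pay x' y - w.pay x y := by
  have hd := disc_lt_disc w.r_pos h
  have hL := w.L_pos
  have hx' := disc_nonneg w.r x'
  have hx := disc_nonneg w.r x
  have hδ := w.δ_pos
  have hM := w.M_add_le y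
  have hLM := w.L_add_le
  rcases lt_or_ge y x with hxy | hxy
  · rw [indicator_of_notMem (fun hm => absurd hm.1 (not_le.2 hxy)),
      indicator_of_notMem (show y ∉ Ici x from not_le.2 hxy), w.pay_of_gt hxy, w.pay_of_gt (hxy.trans h)]; simp
  · rw [indicator_of_mem (mem_Ici.2 hxy)]
    rcases lt_or_ge y x' with hyx | hyx
    · rw [indicator_of_mem (show y ∈ Ico x x' from ⟨hxy, hyx⟩), w.pay_of_gt hyx]
      have hdy := disc_lt_disc w.r_pos hyx
      rcases hxy.eq_or_lt with rfl | hxy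
      · rw [pay_self]; nlinarith
      · rw [w.pay_of_lt hxy]; have := disc_lt_disc w.r_pos hxy; nlinarith
    · rw [indicator_of_notMem (fun hm => absurd hm.2 (not_lt.2 hyx)),
        w.pay_of_lt (h.trans_le hyx)]
      rcases hyx.eq_or_lt with rfl | hyx
      · rw [pay_self]; nlinarith
      · rw [w.pay_of_lt hyx]; linarith

variable (ν : Measure ℝ≥0∞) [IsFiniteMeasure ν]

lemma value_sub_value_le {x x' : ℝ≥0∞} (h : x < x') :
    w.value ν x' - w.value ν x ≤ disc w.r x * w.K * ν.real (Icc x x' \ {⊤})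
      - (disc w.r x - disc w.r x') * w.L * ν.real (Ioi x' ∪ {⊤}) := by
  have h1 : MeasurableSet (Icc x x' \ {⊤}) := measurableSet_Icc.diff (measurableSet_singleton _)
  have h2 : MeasurableSet (Ioi x' ∪ {⊤}) := measurableSet_Ioi.union (measurableSet_singleton _)
  rw [value, value, ← integral_sub (w.integrable_pay ν x') (w.integrable_pay ν x)]
  refine (integral_mono ((w.integrable_pay ν x').sub (w.integrable_pay ν x))
    (((integrable_const _).indicator h1).sub ((integrable_const _).indicator h2))
    (w.pay_sub_pay_le h)).trans ?_
  simp only [Pi.sub_apply]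
  rw [integral_sub ((integrable_const _).indicator h1) ((integrable_const _).indicator h2),
    integral_indicator_const _ h1, integral_indicator_const _ h2]
  simp only [smul_eq_mul]
  apply le_of_eq; ring

lemma le_value_sub_value {x x' : ℝ≥0∞} (h : x < x') :
    w.δ * disc w.r x' * ν.real (Ico x x') - (disc w.r x - disc w.r x') * w.L * ν.real (Ici x) ≤
      w.value ν x' - w.value ν x := by
  rw [value, value, ← integral_sub (w.integrable_pay ν x') (w.integrable_pay ν x)]
  refine le_trans ?_ (integral_mono
    (((integrable_const _).indicator measurableSet_Ico).sub
      ((integrable_const _).indicator measurableSet_Ici))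
    ((w.integrable_pay ν x').sub (w.integrable_pay ν x)) (w.le_pay_sub_pay h))
  simp only [Pi.sub_apply]
  rw [integral_sub ((integrable_const _).indicator measurableSet_Ico)
      ((integrable_const _).indicator measurableSet_Ici),
    integral_indicator_const _ measurableSet_Ico, integral_indicator_const _ measurableSet_Ici]
  simp only [smul_eq_mul]
  apply le_of_eq; ring

variable {ν} {w}

/-- Waiting beyond a best reply does not pay, so the opponent concedes little just after it: at most
in proportion to the cost of delay. -/
lemma real_Ico_le_of_mem_best {x x' : ℝ≥0∞} (hx : x ∈ w.best ν) (h : x < x') :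
    w.δ * disc w.r x' * ν.real (Ico x x') ≤ (disc w.r x - disc w.r x') * w.L * ν.real (Ici x) := by
  have := w.le_value_sub_value ν h
  have := hx x'
  linarith

/-- Having waited until a best reply must have been worth its cost, so the opponent concedes enough
beforehand. -/
lemma le_real_Icc_of_mem_best {x x' : ℝ≥0∞} (hx : x' ∈ w.best ν) (h : x < x') :
    (disc w.r x - disc w.r x') * w.L * ν.real (Ioi x' ∪ {⊤}) ≤
      disc w.r x * w.K * ν.real (Icc x x' \ {⊤}) := by
  have := w.value_sub_value_le ν h
  have := hx x
  linarith

/-- A best reply is never a time at which the opponent concedes with positive probability. -/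
lemma measure_singleton_of_mem_best {x : ℝ≥0∞} (hx : x ∈ w.best ν) (ht : x ≠ ⊤) : ν {x} = 0 := by
  have hne : (𝓝[>] x).NeBot := nhdsGT_neBot_of_exists_gt ⟨⊤, ht.lt_top⟩
  have hd : Tendsto (disc w.r) (𝓝[>] x) (𝓝 (disc w.r x)) :=
    (continuousAt_disc ht).tendsto.mono_left nhdsWithin_le_nhds
  have h1 : Tendsto (fun x' => w.δ * disc w.r x' * ν.real {x}) (𝓝[>] x)
      (𝓝 (w.δ * disc w.r x * ν.real {x})) := (hd.const_mul _).mul_const _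
  have h2 : Tendsto (fun x' => (disc w.r x - disc w.r x') * w.L * ν.real (Ici x)) (𝓝[>] x)
      (𝓝 ((disc w.r x - disc w.r x) * w.L * ν.real (Ici x))) :=
    ((tendsto_const_nhds.sub hd).mul_const _).mul_const _
  -- As x' decreases to x the cost of delay vanishes, whereas the gain from outlasting an atom at x
  -- would not.
  have h3 := le_of_tendsto_of_tendsto h1 h2 (by
    filter_upwards [self_mem_nhdsWithin] with x' hx'
    refine le_trans ?_ (real_Ico_le_of_mem_best hx hx')
    have := disc_nonneg w.r x'; have := w.δ_pos
    gcongr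
    · exact measure_ne_top _ _
    · exact singleton_subset_iff.2 ⟨le_rfl, hx'⟩)
  have hp : 0 < w.δ * disc w.r x := mul_pos w.δ_pos (disc_pos _ ht)
  simp only [sub_self, zero_mul] at h3
  have h4 : ν.real {x} = 0 := le_antisymm (nonpos_of_mul_nonpos_right h3 hp) measureReal_nonneg
  exact (measureReal_eq_zero_iff).1 h4

end Contest

lemma real_pos_of_ne_zero {ν : Measure ℝ≥0∞} [IsFiniteMeasure ν] {s : Set ℝ≥0∞} (h : ν s ≠ 0) :
    0 < ν.real s := ENNReal.toReal_pos h (measure_ne_top _ _)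

/-- The upper end of the support carries no mass above it. -/
lemma measure_Ioi_sInf_eq_zero (ν : Measure ℝ≥0∞) : ν (Ioi (sInf {t | ν (Ioi t) = 0})) = 0 := by
  set S := {t : ℝ≥0∞ | ν (Ioi t) = 0} with hS
  rcases eq_or_ne (sInf S) ⊤ with ht | ht
  · rw [ht]; simp
  · obtain ⟨u, -, hu, hlim⟩ := exists_seq_strictAnti_tendsto' (lt_top_iff_ne_top.2 ht)
    have : Ioi (sInf S) ⊆ ⋃ n, Ioi (u n) := by
      intro x hx
      obtain ⟨n, hn⟩ := (hlim.eventually_lt_const hx).exists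
      exact mem_iUnion.2 ⟨n, hn⟩
    refine measure_mono_null this (measure_iUnion_null fun n => ?_)
    obtain ⟨s, hs, hsu⟩ := sInf_lt_iff.1 (hu n).1
    exact measure_mono_null (Ioi_subset_Ioi hsu.le) hs

/-! ### Mutual best replies: no atoms, no gaps, a common terminal time. -/

namespace Contest

variable {w w₁ w₂ : Contest} {ν ν₁ ν₂ : Measure ℝ≥0∞}

/-- Every finite time at which the law `ν₁` concedes is a best reply to `ν₂`. -/
def RepliesTo (w₁ : Contest) (ν₁ ν₂ : Measure ℝ≥0∞) : Prop :=
  ∀ᵐ x ∂ν₁, x ≠ ⊤ → x ∈ w₁.best ν₂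

lemma RepliesTo.exists_mem (h : w₁.RepliesTo ν₁ ν₂) {s : Set ℝ≥0∞} (hs : ν₁ s ≠ 0)
    (ht : ⊤ ∉ s) : ∃ x ∈ s, x ∈ w₁.best ν₂ := by
  by_contra! hc
  refine hs (measure_mono_null ?_ (ae_iff.1 (show ∀ᵐ x ∂ν₁, x ≠ ⊤ → x ∈ w₁.best ν₂ from h)))
  exact fun x hx h' => hc x hx (h' fun e => ht (e ▸ hx))

variable [IsFiniteMeasure ν] [IsFiniteMeasure ν₁] [IsFiniteMeasure ν₂]

omit [IsFiniteMeasure ν₁] in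
/-- Before each best reply there are best replies of the opponent. -/
lemma RepliesTo.exists_mem_Ico (h : w₂.RepliesTo ν₂ ν₁) (hz : ν₂ {⊤} ≠ 0) {x x' : ℝ≥0∞}
    (hx' : x' ∈ w₁.best ν₂) (hx : x < x') : ∃ b ∈ Ico x x', b ∈ w₂.best ν₁ := by
  apply h.exists_mem
  · intro h0
    -- If the opponent never conceded on [x, x'), and hence not on [x, x'] since a best reply avoids
    -- atoms, conceding at x would beat x'. The mass at ⊤ makes the saving strict.
    have h1 := le_real_Icc_of_mem_best hx' hx
    have h2 : ν₂ (Icc x x' \ {⊤}) = 0 := by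
      rcases eq_or_ne x' ⊤ with rfl | ht
      · refine measure_mono_null ?_ h0
        exact fun y hy => ⟨hy.1.1, lt_top_iff_ne_top.2 hy.2⟩
      · refine measure_mono_null (t := Ico x x' ∪ {x'}) ?_
          (measure_union_null h0 (measure_singleton_of_mem_best hx' ht))
        rintro y ⟨⟨h3, h4⟩, -⟩
        rcases h4.eq_or_lt with rfl | h4
        · exact Or.inr rfl
        · exact Or.inl ⟨h3, h4⟩
    have h3 : ν₂.real (Icc x x' \ {⊤}) = 0 := by rw [measureReal_def, h2]; rfl
    rw [h3, mul_zero] at h1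
    have h4 : 0 < ν₂.real (Ioi x' ∪ {⊤}) := real_pos_of_ne_zero
      ((pos_iff_ne_zero.2 hz).trans_le (measure_mono subset_union_right)).ne'
    have h5 : 0 < (disc w₁.r x - disc w₁.r x') * w₁.L * ν₂.real (Ioi x' ∪ {⊤}) :=
      mul_pos (mul_pos (sub_pos.2 (disc_lt_disc w₁.r_pos hx)) w₁.L_pos) h4
    linarith
  · exact fun hm => absurd hm.2 (not_lt.2 le_top)

/-- A limit from the left of best replies is a best reply. -/
lemma mem_best_of_left {b : ℝ≥0∞} (h0 : b ≠ 0) (ht : b ≠ ⊤)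
    (h : ∀ x < b, ∃ x' ∈ Ico x b, x' ∈ w.best ν) : b ∈ w.best ν := by
  intro y
  have hne : (𝓝[<] b).NeBot := nhdsLT_neBot_of_exists_lt ⟨0, pos_iff_ne_zero.2 h0⟩
  have hd : Tendsto (disc w.r) (𝓝[<] b) (𝓝 (disc w.r b)) :=
    (continuousAt_disc ht).tendsto.mono_left nhdsWithin_le_nhds
  have h1 : Tendsto (fun x => w.value ν y - (disc w.r x - disc w.r b) * w.L * ν.real univ)
      (𝓝[<] b) (𝓝 (w.value ν y - (disc w.r b - disc w.r b) * w.L * ν.real univ)) :=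
    tendsto_const_nhds.sub (((hd.sub tendsto_const_nhds).mul_const _).mul_const _)
  rw [sub_self, zero_mul, zero_mul, sub_zero] at h1
  refine le_of_tendsto h1 ?_
  filter_upwards [self_mem_nhdsWithin] with x hx
  obtain ⟨x', hx', hb⟩ := h x hx
  -- Moving right from x' to b loses only discounting, while opponent's concessions passed on the
  -- way help; so no condition on atoms at b is needed, unlike for limits from the right.
  have h2 := w.le_value_sub_value ν hx'.2
  have h3 := hb y
  have h4 : (disc w.r x' - disc w.r b) * w.L * ν.real (Ici x') ≤
      (disc w.r x - disc w.r b) * w.L * ν.real univ := by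
    have := w.L_pos
    have h5 := disc_le_disc w.r_pos hx'.1
    have h6 := disc_le_disc w.r_pos hx'.2.le
    have h7 : 0 ≤ disc w.r x - disc w.r b := by linarith
    have h8 : ν.real (Ici x') ≤ ν.real univ := measureReal_mono (subset_univ _)
    gcongr
  have h5 : 0 ≤ w.δ * disc w.r b * ν.real (Ico x' b) :=
    mul_nonneg (mul_nonneg w.δ_pos.le (disc_nonneg _ _)) measureReal_nonneg
  linarith

lemma tendsto_real_Icc_right (ν : Measure ℝ≥0∞) [IsFiniteMeasure ν] {d : ℝ≥0∞} (ht : d ≠ ⊤) :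
    Tendsto (fun x => ν.real (Icc d x)) (𝓝[>] d) (𝓝 (ν.real {d})) := by
  have h : Tendsto (ν ∘ fun x => Icc d x) (𝓝[>] d) (𝓝 (ν (⋂ x > d, Icc d x))) :=
    tendsto_measure_biInter_gt (fun _ _ => measurableSet_Icc.nullMeasurableSet)
      (fun i j _ hij => Icc_subset_Icc_right hij) ⟨⊤, ht.lt_top, measure_ne_top _ _⟩
  have h2 : ⋂ x > d, Icc d x = {d} := by
    ext y
    simp only [mem_iInter, mem_Icc, mem_singleton_iff]
    constructor
    · intro hy
      exact le_antisymm (le_of_forall_gt_imp_ge_of_dense fun x hx => (hy x hx).2)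
        (hy ⊤ ht.lt_top).1
    · rintro rfl x hx; exact ⟨le_rfl, hx.le⟩
  rw [h2] at h
  exact (ENNReal.tendsto_toReal (measure_ne_top _ _)).comp h

/-- A limit from the right of best replies is a best reply unless the opponent has an atom there. -/
lemma mem_best_of_right {d : ℝ≥0∞} (ht : d ≠ ⊤) (h0 : ν {d} = 0)
    (h : ∀ x > d, ∃ x' ∈ Ioc d x, x' ∈ w.best ν) : d ∈ w.best ν := by
  intro y
  have hne : (𝓝[>] d).NeBot := nhdsGT_neBot_of_exists_gt ⟨⊤, ht.lt_top⟩
  have h1 := ((tendsto_real_Icc_right ν ht).const_mul (disc w.r d * w.K)).const_add (w.value ν d)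
  have h0' : ν.real {d} = 0 := by rw [measureReal_def, h0]; rfl
  rw [h0', mul_zero, add_zero] at h1
  refine ge_of_tendsto h1 ?_
  filter_upwards [self_mem_nhdsWithin] with x hx
  obtain ⟨x', hx', hb⟩ := h x hx
  have h2 := w.value_sub_value_le ν hx'.1
  have h3 := hb y
  have h4 : disc w.r d * w.K * ν.real (Icc d x' \ {⊤}) ≤ disc w.r d * w.K * ν.real (Icc d x) := by
    have := disc_nonneg w.r d
    have := w.K_pos
    have h8 : ν.real (Icc d x' \ {⊤}) ≤ ν.real (Icc d x) :=
      measureReal_mono (sdiff_subset.trans (Icc_subset_Icc_right hx'.2))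
    gcongr
  have h5 : 0 ≤ (disc w.r d - disc w.r x') * w.L * ν.real (Ioi x' ∪ {⊤}) :=
    mul_nonneg (mul_nonneg (sub_nonneg.2 (disc_le_disc w.r_pos hx'.1.le)) w.L_pos.le)
      measureReal_nonneg
  linarith

/-- Best replies to an opponent who may never concede are bounded. -/
lemma exists_bound_best (hz : ν {⊤} ≠ 0) : ∃ N : ℝ, 0 ≤ N ∧
    ∀ b ∈ w.best ν, b ≤ ENNReal.ofReal N := by
  have hν : 0 < ν.real {⊤} := real_pos_of_ne_zero hz
  -- The cost, in current value, of waiting one unit of time against an opponent who never concedes.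
  set c := (1 - Real.exp (-w.r)) * w.L * ν.real {⊤} with hc
  have he : Real.exp (-w.r) < 1 := by rw [Real.exp_lt_one_iff]; linarith [w.r_pos]
  have hcpos : 0 < c := mul_pos (mul_pos (by linarith) w.L_pos) hν
  have hlim : Tendsto (fun n : ℕ => w.K * ν.real (Ico (n : ℝ≥0∞) ⊤)) atTop (𝓝 (w.K * 0)) := by
    refine Tendsto.const_mul _ ?_
    have h : Tendsto (ν ∘ fun n : ℕ => Ico (n : ℝ≥0∞) ⊤) atTop (𝓝 (ν (⋂ n : ℕ, Ico (n : ℝ≥0∞) ⊤))) :=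
      tendsto_measure_iInter_atTop (fun _ => measurableSet_Ico.nullMeasurableSet)
        (fun i j hij => Ico_subset_Ico_left (by exact_mod_cast hij)) ⟨0, measure_ne_top _ _⟩
    have h2 : ⋂ n : ℕ, Ico (n : ℝ≥0∞) ⊤ = ∅ := by
      ext y
      simp only [mem_iInter, mem_Ico, mem_empty_iff_false, iff_false]
      intro hy
      obtain ⟨n, hn⟩ := ENNReal.exists_nat_gt (hy 0).2.ne
      exact absurd (hy n).1 (not_le.2 hn)
    rw [h2, measure_empty] at h
    exact (ENNReal.tendsto_toReal ENNReal.zero_ne_top).comp h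
  rw [mul_zero] at hlim
  obtain ⟨n, hn⟩ := (hlim.eventually_lt_const hcpos).exists
  -- After n the opponent's remaining concessions are worth less than `c`. A best reply beyond n + 1
  -- would incur at least the cost `c` of one further unit of waiting, so conceding at n would be
  -- better.
  refine ⟨n + 1, by positivity, fun b hb => ?_⟩
  by_contra! hlt
  have hcast : ENNReal.ofReal ((n : ℝ) + 1) = (n : ℝ≥0∞) + 1 := by
    rw [ENNReal.ofReal_add (by positivity) zero_le_one]; simp
  have hnb : (n : ℝ≥0∞) < b := by
    refine lt_of_le_of_lt ?_ hlt
    rw [hcast]; exact le_self_add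
  have h1 := le_real_Icc_of_mem_best hb hnb
  have hdn : 0 < disc w.r (n : ℝ≥0∞) := disc_pos _ (ENNReal.natCast_ne_top n)
  have h2 : disc w.r b ≤ disc w.r (n : ℝ≥0∞) * Real.exp (-w.r) := by
    refine (disc_le_disc w.r_pos hlt.le).trans (le_of_eq ?_)
    rw [disc_ofReal (by positivity), disc_of_ne_top (ENNReal.natCast_ne_top n), ← Real.exp_add]
    congr 1
    simp; ring
  have h3 : disc w.r (n : ℝ≥0∞) * c ≤
      (disc w.r (n : ℝ≥0∞) - disc w.r b) * w.L * ν.real (Ioi b ∪ {⊤}) := by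
    have h4 : disc w.r (n : ℝ≥0∞) * (1 - Real.exp (-w.r)) ≤ disc w.r (n : ℝ≥0∞) - disc w.r b := by
      linarith
    have h5 : ν.real {⊤} ≤ ν.real (Ioi b ∪ {⊤}) := measureReal_mono subset_union_right
    have h6 := w.L_pos
    calc _ = disc w.r (n : ℝ≥0∞) * (1 - Real.exp (-w.r)) * w.L * ν.real {⊤} := by rw [hc]; ring
      _ ≤ _ := by
        have : 0 ≤ disc w.r (n : ℝ≥0∞) - disc w.r b :=
          le_trans (mul_nonneg hdn.le (by linarith)) h4
        gcongr
  have h4 : disc w.r (n : ℝ≥0∞) * w.K * ν.real (Icc (n : ℝ≥0∞) b \ {⊤}) ≤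
      disc w.r (n : ℝ≥0∞) * (w.K * ν.real (Ico (n : ℝ≥0∞) ⊤)) := by
    rw [mul_assoc]
    have := w.K_pos
    gcongr
    · exact measure_ne_top _ _
    · exact fun y hy => ⟨hy.1.1, lt_top_iff_ne_top.2 hy.2⟩
  have h5 := lt_of_mul_lt_mul_left (lt_of_le_of_lt (h3.trans (h1.trans h4))
    (mul_lt_mul_of_pos_left hn hdn)) hdn.le
  exact lt_irrefl _ h5

lemma top_notMem_best (hz : ν {⊤} ≠ 0) : ⊤ ∉ w.best ν := by
  obtain ⟨N, -, hN⟩ := exists_bound_best (w := w) hz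
  exact fun h => absurd (hN _ h) (not_le.2 ENNReal.ofReal_lt_top)

/-- Both players' positive best replies coincide. -/
lemma RepliesTo.mem_best_of_mem_best (h : w₂.RepliesTo ν₂ ν₁) (hz : ν₂ {⊤} ≠ 0) {b : ℝ≥0∞}
    (hb : b ∈ w₁.best ν₂) (h0 : b ≠ 0) (ht : b ≠ ⊤) : b ∈ w₂.best ν₁ :=
  mem_best_of_left h0 ht fun _ hx => h.exists_mem_Ico hz hb hx

/-- An atom at b > 0 makes b a best reply of its owner, hence also of the opponent, whose best
replies avoid atoms. -/
lemma RepliesTo.measure_singleton (h₁ : w₁.RepliesTo ν₁ ν₂) (h₂ : w₂.RepliesTo ν₂ ν₁)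
    (hz₂ : ν₂ {⊤} ≠ 0) {b : ℝ≥0∞} (h0 : b ≠ 0) (ht : b ≠ ⊤) : ν₁ {b} = 0 := by
  by_contra hne
  obtain ⟨x, hx, hb⟩ := h₁.exists_mem hne (fun e => ht (mem_singleton_iff.1 e).symm)
  rw [mem_singleton_iff] at hx
  subst hx
  exact hne (measure_singleton_of_mem_best (h₂.mem_best_of_mem_best hz₂ hb h0 ht) ht)

/-- There are no gaps: the infimum d of the best replies in [c, b] is itself one, and if c < d the
opponent has a best reply in [c, d), which is shared by both players and contradicts the choice of
d. -/
lemma RepliesTo.mem_best_of_le (h₁ : w₁.RepliesTo ν₁ ν₂) (h₂ : w₂.RepliesTo ν₂ ν₁)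
    (hz₁ : ν₁ {⊤} ≠ 0) (hz₂ : ν₂ {⊤} ≠ 0) {b c : ℝ≥0∞} (hb : b ∈ w₁.best ν₂) (hc0 : c ≠ 0)
    (hcb : c ≤ b) (ht : b ≠ ⊤) : c ∈ w₁.best ν₂ := by
  set S := w₁.best ν₂ ∩ Icc c b with hS
  have hbS : b ∈ S := ⟨hb, hcb, le_rfl⟩
  have hdb : sInf S ≤ b := sInf_le hbS
  have hcd : c ≤ sInf S := le_sInf fun y hy => hy.2.1
  have hdt : sInf S ≠ ⊤ := ne_top_of_le_ne_top ht hdb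
  have hd0 : sInf S ≠ 0 := (pos_iff_ne_zero.2 hc0 |>.trans_le hcd).ne'
  have hd : sInf S ∈ w₁.best ν₂ := by
    by_contra hn
    refine hn (mem_best_of_right hdt (h₂.measure_singleton h₁ hz₁ hd0 hdt) fun x hx => ?_)
    obtain ⟨y, hy, hyx⟩ := sInf_lt_iff.1 hx
    refine ⟨y, ⟨lt_of_le_of_ne (sInf_le hy) ?_, hyx.le⟩, hy.1⟩
    rintro e
    exact hn (e ▸ hy.1)
  rcases hcd.eq_or_lt with e | hlt
  · rwa [e]
  · exfalso
    obtain ⟨y, hy, hyb⟩ := h₂.exists_mem_Ico hz₂ hd hlt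
    have hy1 : y ∈ w₁.best ν₂ := h₁.mem_best_of_mem_best hz₁ hyb
      (pos_iff_ne_zero.2 hc0 |>.trans_le hy.1).ne' (ne_top_of_lt hy.2)
    have hyS : y ∈ S := ⟨hy1, hy.1, hy.2.le.trans hdb⟩
    exact absurd (sInf_le hyS) (not_le.2 hy.2)

/-- In an equilibrium of the reputational war of attrition there is a common finite terminal time,
up to which all positive times are best replies of both players. -/
theorem RepliesTo.exists_terminal (h₁ : w₁.RepliesTo ν₁ ν₂) (h₂ : w₂.RepliesTo ν₂ ν₁)
    (hz₁ : ν₁ {⊤} ≠ 0) (hz₂ : ν₂ {⊤} ≠ 0) (hf₁ : ν₁ {⊤}ᶜ ≠ 0) (hf₂ : ν₂ {⊤}ᶜ ≠ 0) :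
    ∃ T : ℝ, 0 < T ∧
      (∀ x, x ≠ 0 → (x ∈ w₁.best ν₂ ↔ x ≤ ENNReal.ofReal T)) ∧
      (∀ x, x ≠ 0 → (x ∈ w₂.best ν₁ ↔ x ≤ ENNReal.ofReal T)) := by
  obtain ⟨N, hN0, hN⟩ := exists_bound_best (w := w₁) hz₂
  -- If 0 were the only candidate for one player it would be so for both, as positive best replies
  -- are shared. Both laws would then have an atom at 0, and neither player could find 0 optimal.
  have hne : ∃ b ∈ w₁.best ν₂, b ≠ 0 := by
    by_contra! hc
    have hc' : ∀ b ∈ w₂.best ν₁, b = 0 := by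
      intro b hb
      by_contra hb0
      exact hb0 (hc b (h₁.mem_best_of_mem_best hz₁ hb hb0
        (fun e => top_notMem_best hz₁ (e ▸ hb))))
    have key : ∀ {ν ν' : Measure ℝ≥0∞} [IsFiniteMeasure ν] [IsFiniteMeasure ν'] {w : Contest},
        w.RepliesTo ν ν' →
        (∀ b ∈ w.best ν', b = 0) → ν {⊤}ᶜ ≠ 0 → ν {0} ≠ 0 := by
      intro ν ν' _ _ w h hb hf h0
      have h1 : ν ({⊤}ᶜ \ {0}) ≠ 0 := by
        rwa [measure_sdiff_null h0]
      obtain ⟨x, hx, hx'⟩ := h.exists_mem h1 (by simp)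
      exact hx.2 (hb x hx')
    obtain ⟨x, hx, hxb⟩ := h₁.exists_mem (key h₁ hc hf₁) (by simp)
    rw [mem_singleton_iff] at hx
    subst hx
    exact key h₂ hc' hf₂ (measure_singleton_of_mem_best hxb (by simp))
  obtain ⟨b₀, hb₀, hb₀0⟩ := hne
  set T := sSup (w₁.best ν₂) with hT
  have hTN : T ≤ ENNReal.ofReal N := sSup_le hN
  have hTt : T ≠ ⊤ := ne_top_of_le_ne_top ENNReal.ofReal_ne_top hTN
  have hT0 : T ≠ 0 := (pos_iff_ne_zero.2 hb₀0 |>.trans_le (le_sSup hb₀)).ne'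
  have hTb : T ∈ w₁.best ν₂ := by
    by_contra hn
    refine hn (mem_best_of_left hT0 hTt fun x hx => ?_)
    obtain ⟨y, hy, hxy⟩ := lt_sSup_iff.1 hx
    refine ⟨y, ⟨hxy.le, lt_of_le_of_ne (le_sSup hy) ?_⟩, hy⟩
    rintro e
    exact hn (e ▸ hy)
  have hiff : ∀ x, x ≠ 0 → (x ∈ w₁.best ν₂ ↔ x ≤ T) := fun x hx =>
    ⟨fun h => le_sSup h, fun h => h₁.mem_best_of_le h₂ hz₁ hz₂ hTb hx h hTt⟩
  refine ⟨T.toReal, ENNReal.toReal_pos hT0 hTt, ?_, ?_⟩ <;> rw [ENNReal.ofReal_toReal hTt]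
  · exact hiff
  · intro x hx
    rw [← hiff x hx]
    constructor
    · exact fun h => h₁.mem_best_of_mem_best hz₁ h hx (fun e => top_notMem_best hz₁ (e ▸ h))
    · exact fun h => h₂.mem_best_of_mem_best hz₂ h hx (fun e => top_notMem_best hz₂ (e ▸ h))

/-- A player who is known to be rational concedes at once to an opponent who may be behavioral. -/
theorem RepliesTo.measure_Ioi_zero (h₁ : w₁.RepliesTo ν₁ ν₂) (hz₁ : ν₁ {⊤} ≠ 0)
    (h₂ : ∀ᵐ x ∂ν₂, x ∈ w₂.best ν₁) : ν₂ (Ioi 0) = 0 := by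
  obtain ⟨N, hN0, hN⟩ := exists_bound_best (w := w₂) hz₁
  set S := {t : ℝ≥0∞ | ν₂ (Ioi t) = 0} with hS
  have hNS : ENNReal.ofReal N ∈ S :=
    measure_mono_null (show Ioi (ENNReal.ofReal N) ⊆ {x | ¬ x ∈ w₂.best ν₁} from
      fun x hx h => absurd (hN x h) (not_le.2 hx)) (ae_iff.1 h₂)
  have hτt : sInf S ≠ ⊤ := ne_top_of_le_ne_top ENNReal.ofReal_ne_top (sInf_le hNS)
  have hτS : ν₂ (Ioi (sInf S)) = 0 := measure_Ioi_sInf_eq_zero ν₂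
  rcases eq_or_ne (sInf S) 0 with h0 | h0
  · rwa [h0] at hτS
  exfalso
  set τ := sInf S with hτ
  have hlow : ∀ t < τ, ν₂ (Ioi t) ≠ 0 := fun t ht h =>
    absurd (sInf_le (show t ∈ S from h)) (not_le.2 ht)
  have hδ := w₁.δ_pos
  have hL := w₁.L_pos
  have hdτ : 0 < disc w₁.r τ := disc_pos _ hτt
  have hcont : Tendsto (fun b => (disc w₁.r b - disc w₁.r τ) * w₁.L) (𝓝[<] τ)
      (𝓝 ((disc w₁.r τ - disc w₁.r τ) * w₁.L)) :=
    ((((continuousAt_disc hτt).tendsto.mono_left nhdsWithin_le_nhds).sub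
      tendsto_const_nhds).mul_const _)
  rw [sub_self, zero_mul] at hcont
  -- Here τ > 0 is the last time at which the known-rational player concedes. Shortly before τ,
  -- holding out until just after τ costs less than the premium `δ` for outlasting her.
  have hev := hcont.eventually_lt_const (mul_pos hδ hdτ)
  obtain ⟨x₀, hx₀, hx₀'⟩ := (mem_nhdsLT_iff_exists_Ioo_subset' (pos_iff_ne_zero.2 h0)).1 hev
  have hpos : ν₂ (Ioc x₀ τ) ≠ 0 := by
    intro h
    refine hlow x₀ hx₀ (measure_mono_null (t := Ioc x₀ τ ∪ Ioi τ) ?_ (measure_union_null h hτS))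
    intro x hx
    rcases le_or_gt x τ with h' | h'
    · exact Or.inl ⟨hx, h'⟩
    · exact Or.inr h'
  obtain ⟨b', hb', hb'b⟩ : ∃ x ∈ Ioc x₀ τ, x ∈ w₂.best ν₁ := by
    by_contra! hc
    exact hpos (measure_mono_null (fun x hx h' => hc x hx h') (ae_iff.1 h₂))
  obtain ⟨x, hx₀x, hxb'⟩ := exists_between hb'.1
  obtain ⟨b, hb, hbb⟩ := h₁.exists_mem_Ico hz₁ hb'b hxb'
  have hbτ : b < τ := hb.2.trans_le hb'.2
  have hsmall : (disc w₁.r b - disc w₁.r τ) * w₁.L < w₁.δ * disc w₁.r τ :=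
    hx₀' ⟨hx₀x.trans_le hb.1, hbτ⟩
  have hm : 0 < ν₂.real (Ici b) := real_pos_of_ne_zero
    ((pos_iff_ne_zero.2 (hlow b hbτ)).trans_le (measure_mono Ioi_subset_Ici_self)).ne'
  have hne : (𝓝[>] τ).NeBot := nhdsGT_neBot_of_exists_gt ⟨⊤, hτt.lt_top⟩
  have hd : Tendsto (disc w₁.r) (𝓝[>] τ) (𝓝 (disc w₁.r τ)) :=
    (continuousAt_disc hτt).tendsto.mono_left nhdsWithin_le_nhds
  -- All mass remaining at b lies in [b, x') once x' > τ, so it cancels from the best-reply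
  -- inequality at b; letting x' decrease to τ contradicts `hsmall`.
  have h3 := le_of_tendsto_of_tendsto (hd.const_mul w₁.δ)
    ((tendsto_const_nhds.sub hd).mul_const w₁.L : Tendsto (fun x' =>
      (disc w₁.r b - disc w₁.r x') * w₁.L) _ _) (by
    filter_upwards [self_mem_nhdsWithin] with x' hx'
    have h4 := real_Ico_le_of_mem_best hbb (hbτ.trans hx')
    have h5 : ν₂.real (Ico b x') = ν₂.real (Ici b) := by
      refine le_antisymm (measureReal_mono fun y hy => hy.1) ?_
      rw [measureReal_def, measureReal_def]
      refine ENNReal.toReal_mono (measure_ne_top _ _) ?_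
      calc ν₂ (Ici b) ≤ ν₂ (Ico b x' ∪ Ioi τ) := measure_mono fun y hy => by
            rcases lt_or_ge y x' with h' | h'
            · exact Or.inl ⟨hy, h'⟩
            · exact Or.inr (lt_of_lt_of_le hx' h')
        _ ≤ ν₂ (Ico b x') + ν₂ (Ioi τ) := measure_union_le _ _
        _ = _ := by rw [hτS, add_zero]
    rw [h5] at h4
    exact le_of_mul_le_mul_right h4 hm)
  linarith

end Contest

/-! ### Survival functions. -/

/-- Dominated convergence: jumps could come only from atoms at positive times. An atom at 0 is
included for every t ≥ 0 and causes no jump on [0, ∞). -/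
lemma continuousOn_integral_indicator_Iic {ν : Measure ℝ≥0∞} [IsFiniteMeasure ν]
    (hν : ∀ x, x ≠ 0 → x ≠ ⊤ → ν {x} = 0) {g : ℝ≥0∞ → ℝ} (hg : Measurable g) {K : ℝ}
    (hK : ∀ y, |g y| ≤ K) :
    ContinuousOn (fun t : ℝ => ∫ y, (Iic (ENNReal.ofReal t)).indicator g y ∂ν) (Ici 0) := by
  intro x hx
  refine continuousWithinAt_of_dominated (bound := fun _ => K) ?_ ?_ (integrable_const K) ?_
  · exact Eventually.of_forall fun t => (hg.indicator measurableSet_Iic).aestronglyMeasurable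
  · refine Eventually.of_forall fun t => Eventually.of_forall fun y => ?_
    exact (norm_indicator_le_norm_self g y).trans (hK y)
  · have hae : ∀ᵐ y ∂ν, y ≠ 0 → y ≠ ENNReal.ofReal x := by
      rcases eq_or_ne (ENNReal.ofReal x) 0 with h0 | h0
      · rw [h0]; exact Eventually.of_forall fun y h => h
      · have h1 := hν _ h0 ENNReal.ofReal_ne_top
        rw [← compl_mem_ae_iff] at h1
        filter_upwards [h1] with y hy _ using hy
    filter_upwards [hae] with y hy
    rcases eq_or_ne y 0 with rfl | h0
    · refine (continuousWithinAt_const (b := g 0)).congr_of_eventuallyEq ?_ ?_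
      · exact Eventually.of_forall fun t => indicator_of_mem (by simp) _
      · exact indicator_of_mem (by simp) _
    · have hc : Tendsto ENNReal.ofReal (𝓝[Ici 0] x) (𝓝 (ENNReal.ofReal x)) :=
        ENNReal.continuous_ofReal.continuousAt.tendsto.mono_left nhdsWithin_le_nhds
      rcases lt_or_gt_of_ne (hy h0) with hlt | hlt
      · refine (continuousWithinAt_const (b := g y)).congr_of_eventuallyEq ?_ ?_
        · filter_upwards [hc.eventually_const_lt hlt] with t ht
          exact indicator_of_mem (show y ∈ Iic _ from ht.le) _
        · exact indicator_of_mem (show y ∈ Iic _ from hlt.le) _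
      · refine (continuousWithinAt_const (b := (0 : ℝ))).congr_of_eventuallyEq ?_ ?_
        · filter_upwards [hc.eventually_lt_const hlt] with t ht
          exact indicator_of_notMem (show y ∉ Iic _ from not_le.2 ht) _
        · exact indicator_of_notMem (show y ∉ Iic _ from not_le.2 hlt) _

/-- Probability of no concession up to and including time `t`. -/
def surv (ν : Measure ℝ≥0∞) (t : ℝ) : ℝ := ν.real (Ioi (ENNReal.ofReal t))

lemma surv_sub_surv (ν : Measure ℝ≥0∞) [IsFiniteMeasure ν] {s t : ℝ} (h : s ≤ t) :
    surv ν s - surv ν t = ν.real (Ioc (ENNReal.ofReal s) (ENNReal.ofReal t)) := by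
  have h' := ENNReal.ofReal_le_ofReal h
  rw [surv, surv, ← Ioc_union_Ioi_eq_Ioi h',
    measureReal_union (Ioc_disjoint_Ioi_same) measurableSet_Ioi]
  ring

lemma surv_antitone (ν : Measure ℝ≥0∞) [IsFiniteMeasure ν] : Antitone (surv ν) := fun s t h => by
  have := surv_sub_surv ν h
  have : 0 ≤ ν.real (Ioc (ENNReal.ofReal s) (ENNReal.ofReal t)) := measureReal_nonneg
  linarith

lemma real_singleton_zero_add_surv (ν : Measure ℝ≥0∞) [IsProbabilityMeasure ν] :
    ν.real {0} + surv ν 0 = 1 := by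
  rw [surv, ENNReal.ofReal_zero, ← measureReal_union (by simp) measurableSet_Ioi]
  rw [show ({0} ∪ Ioi 0 : Set ℝ≥0∞) = univ from ?_, probReal_univ]
  ext y
  simp

lemma continuousOn_surv {ν : Measure ℝ≥0∞} [IsFiniteMeasure ν]
    (hν : ∀ x, x ≠ 0 → x ≠ ⊤ → ν {x} = 0) : ContinuousOn (surv ν) (Ici 0) := by
  have h := continuousOn_integral_indicator_Iic hν (g := fun _ => (1 : ℝ)) measurable_const
    (K := 1) (by simp)
  refine ((continuousOn_const (c := ν.real univ)).sub h).congr fun t _ => ?_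
  have h1 : (Ioi (ENNReal.ofReal t)) = (Iic (ENNReal.ofReal t))ᶜ := compl_Iic.symm
  simp only [Pi.sub_apply]
  rw [surv, h1, measureReal_compl measurableSet_Iic, integral_indicator_const _ measurableSet_Iic]
  simp

lemma eq_of_hasDerivAt_zero {f : ℝ → ℝ} {T : ℝ} (hf : ContinuousOn f (Icc 0 T))
    (hd : ∀ t ∈ Ioo 0 T, HasDerivAt f 0 t) {t : ℝ} (ht : t ∈ Icc 0 T) : f t = f 0 := by
  rcases ht.1.eq_or_lt with rfl | h0
  · rfl
  · obtain ⟨c, hc, he⟩ := exists_hasDerivAt_eq_slope f (fun _ => 0) h0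
      (hf.mono (Icc_subset_Icc_right ht.2)) fun x hx => hd x ⟨hx.1, hx.2.trans_le ht.2⟩
    have : t - 0 ≠ 0 := by linarith
    field_simp at he
    linarith

/-! ### Values as functions of time and the indifference hazard rate. -/

namespace Contest

variable (w : Contest) (ν : Measure ℝ≥0∞)

/-- Expected payoff from concessions of the opponent up to time `t`. -/
def gain (t : ℝ) : ℝ := ∫ y, (Iic (ENNReal.ofReal t)).indicator (fun y => disc w.r y * w.W y) y ∂ν

/-- Expected payoff of conceding right after `t`. -/
def valueRight (t : ℝ) : ℝ := w.gain ν t + Real.exp (-w.r * t) * w.L * surv ν t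

lemma disc_mul_W_nonneg (y : ℝ≥0∞) : 0 ≤ disc w.r y * w.W y :=
  mul_nonneg (disc_nonneg _ _) (w.W_pos y).le

lemma disc_mul_W_le (y : ℝ≥0∞) : disc w.r y * w.W y ≤ w.K := by
  have := disc_le_one w.r_pos y
  have := disc_nonneg w.r y
  have := w.W_pos y
  have := w.W_le y
  nlinarith

lemma abs_disc_mul_W_le (y : ℝ≥0∞) : |disc w.r y * w.W y| ≤ w.K := by
  rw [abs_of_nonneg (w.disc_mul_W_nonneg y)]; exact w.disc_mul_W_le y

lemma measurable_disc_mul_W : Measurable fun y => disc w.r y * w.W y :=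
  (measurable_disc _).mul w.measurable_W

variable [IsFiniteMeasure ν]

lemma integrable_disc_mul_W : Integrable (fun y => disc w.r y * w.W y) ν :=
  Integrable.of_bound w.measurable_disc_mul_W.aestronglyMeasurable w.K
    (Eventually.of_forall w.abs_disc_mul_W_le)

variable {ν} in
lemma continuousOn_valueRight (hν : ∀ x, x ≠ 0 → x ≠ ⊤ → ν {x} = 0) :
    ContinuousOn (w.valueRight ν) (Ici 0) :=
  (continuousOn_integral_indicator_Iic hν w.measurable_disc_mul_W w.abs_disc_mul_W_le).add
    ((by fun_prop : Continuous fun t => Real.exp (-w.r * t) * w.L).continuousOn.mul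
      (continuousOn_surv hν))

variable {ν} in
lemma value_ofReal {t : ℝ} (ht : 0 ≤ t) (hν : ν {ENNReal.ofReal t} = 0) :
    w.value ν (ENNReal.ofReal t) = w.valueRight ν t := by
  have h1 : ∀ᵐ y ∂ν, y ≠ ENNReal.ofReal t := by rw [← compl_mem_ae_iff] at hν; exact hν
  have h2 : w.value ν (ENNReal.ofReal t) =
      ∫ y, ((Iic (ENNReal.ofReal t)).indicator (fun y => disc w.r y * w.W y) y
        + (Ioi (ENNReal.ofReal t)).indicator (fun _ => Real.exp (-w.r * t) * w.L) y) ∂ν := by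
    refine integral_congr_ae ?_
    filter_upwards [h1] with y hy
    rcases lt_or_gt_of_ne hy with h | h
    · rw [indicator_of_mem (show y ∈ Iic _ from h.le),
        indicator_of_notMem (show y ∉ Ioi _ from not_lt.2 h.le), w.pay_of_gt h, add_zero]
    · rw [indicator_of_notMem (show y ∉ Iic _ from not_le.2 h),
        indicator_of_mem (show y ∈ Ioi _ from h), w.pay_of_lt h, zero_add, disc_ofReal ht]
  rw [h2, integral_add ((w.integrable_disc_mul_W ν).indicator measurableSet_Iic)
    ((integrable_const _).indicator measurableSet_Ioi),
    integral_indicator_const _ measurableSet_Ioi, valueRight, gain, smul_eq_mul, surv, mul_comm]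

omit [IsFiniteMeasure ν] in
lemma valueRight_zero : w.valueRight ν 0 = w.W 0 * ν.real {0} + w.L * surv ν 0 := by
  rw [valueRight, gain, ENNReal.ofReal_zero]
  have : (Iic (0 : ℝ≥0∞)) = {0} := by ext; simp
  rw [this, integral_indicator (measurableSet_singleton _), integral_singleton]
  simp [mul_comm]

lemma value_zero : w.value ν 0 = w.M * ν.real {0} + w.L * surv ν 0 := by
  have h : w.value ν 0 = ∫ y, (({0} : Set ℝ≥0∞).indicator (fun _ => w.M) y
      + (Ioi (0 : ℝ≥0∞)).indicator (fun _ => w.L) y) ∂ν := by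
    refine integral_congr_ae (Eventually.of_forall fun y => ?_)
    rcases eq_or_ne y 0 with rfl | h
    · simp
    · have h' := pos_iff_ne_zero.2 h
      simp [h, h', w.pay_of_lt h']
  rw [h, integral_add ((integrable_const _).indicator (measurableSet_singleton _))
    ((integrable_const _).indicator measurableSet_Ioi),
    integral_indicator_const _ measurableSet_Ioi,
    integral_indicator_const _ (measurableSet_singleton _), surv]
  simp [mul_comm]

lemma gain_sub_gain {s t : ℝ} (h : s ≤ t) : w.gain ν t - w.gain ν s =
    ∫ y in Ioc (ENNReal.ofReal s) (ENNReal.ofReal t), disc w.r y * w.W y ∂ν := by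
  have h' := ENNReal.ofReal_le_ofReal h
  have hi := w.integrable_disc_mul_W ν
  rw [gain, gain, integral_indicator measurableSet_Iic, integral_indicator measurableSet_Iic,
    ← Iic_union_Ioc_eq_Iic h', setIntegral_union (Iic_disjoint_Ioc le_rfl) measurableSet_Ioc
      hi.integrableOn hi.integrableOn]
  ring

/-- Concessions close to time `x` contribute `exp (-r x) W x` times their probability. -/
lemma gain_isLittleO {x : ℝ} (hx : 0 < x)
    (hW : ContinuousAt (fun t => w.W (ENNReal.ofReal t)) x) :
    (fun t => w.gain ν t - w.gain ν x
      + Real.exp (-w.r * x) * w.W (ENNReal.ofReal x) * (surv ν t - surv ν x)) =o[𝓝 x]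
      fun t => surv ν t - surv ν x := by
  set f : ℝ → ℝ := fun t => Real.exp (-w.r * t) * w.W (ENNReal.ofReal t) with hf
  have hfc : ContinuousAt f x := (by fun_prop : ContinuousAt (fun t => Real.exp (-w.r * t)) x).mul hW
  rw [Asymptotics.isLittleO_iff]
  intro ε hε
  obtain ⟨η, hη, hball⟩ := Metric.continuousAt_iff.1 hfc ε hε
  have key : ∀ s t : ℝ, 0 < s → s ≤ t → |s - x| < η → |t - x| < η →
      |w.gain ν t - w.gain ν s - f x * (surv ν s - surv ν t)| ≤ ε * (surv ν s - surv ν t) := by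
    intro s t hs hst h1 h2
    rw [w.gain_sub_gain ν hst, surv_sub_surv ν hst]
    have hi := (w.integrable_disc_mul_W ν).integrableOn
      (s := Ioc (ENNReal.ofReal s) (ENNReal.ofReal t))
    have he : f x * ν.real (Ioc (ENNReal.ofReal s) (ENNReal.ofReal t)) =
        ∫ y in Ioc (ENNReal.ofReal s) (ENNReal.ofReal t), f x ∂ν := by
      rw [setIntegral_const, smul_eq_mul, mul_comm]
    rw [he, ← integral_sub hi (integrable_const _), ← Real.norm_eq_abs]
    refine norm_setIntegral_le_of_norm_le_const (measure_lt_top _ _) fun y hy => ?_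
    have hyt : y ≠ ⊤ := ne_top_of_le_ne_top ENNReal.ofReal_ne_top hy.2
    have hsy : s < y.toReal := (ENNReal.ofReal_lt_iff_lt_toReal hs.le hyt).1 hy.1
    have hyt' : y.toReal ≤ t := ENNReal.toReal_le_of_le_ofReal (hs.le.trans hst) hy.2
    have hyx : dist y.toReal x < η := by
      rw [abs_lt] at h1 h2
      rw [Real.dist_eq, abs_lt]
      constructor <;> linarith
    have h3 := hball hyx
    rw [Real.dist_eq, hf] at h3
    simp only [ENNReal.ofReal_toReal hyt] at h3
    rw [Real.norm_eq_abs, disc_of_ne_top hyt]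
    exact h3.le
  have hx2 : Ioi (0 : ℝ) ∈ 𝓝 x := Ioi_mem_nhds hx
  filter_upwards [hx2, Metric.ball_mem_nhds x hη] with t ht0 ht
  rw [Metric.mem_ball, Real.dist_eq] at ht
  have hxx : |x - x| < η := by simpa using hη
  rw [Real.norm_eq_abs, Real.norm_eq_abs]
  rcases le_total t x with h | h
  · have h1 := key t x ht0 h ht hxx
    have h2 := surv_antitone ν h
    rw [abs_of_nonneg (sub_nonneg.2 h2)]
    rw [abs_sub_comm] at h1
    refine le_trans (le_of_eq ?_) h1
    congr 1; simp only [hf]; ring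
  · have h1 := key x t hx h hxx ht
    have h2 := surv_antitone ν h
    rw [abs_of_nonpos (sub_nonpos.2 h2)]
    refine le_trans (le_trans (le_of_eq ?_) h1) (le_of_eq ?_)
    · congr 1; simp only [hf]; ring
    · ring

/-- If the opponent concedes at the hazard rate `r L / (W x - L)`, the value is locally constant. -/
lemma hasDerivAt_valueRight {x : ℝ} (hx : 0 < x)
    (hW : ContinuousAt (fun t => w.W (ENNReal.ofReal t)) x)
    (hS : HasDerivAt (surv ν) (-(w.r * w.L / (w.W (ENNReal.ofReal x) - w.L)) * surv ν x) x) :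
    HasDerivAt (w.valueRight ν) 0 x := by
  have hWL : w.W (ENNReal.ofReal x) - w.L ≠ 0 := (sub_pos.2 (w.L_lt_W _)).ne'
  set S' := -(w.r * w.L / (w.W (ENNReal.ofReal x) - w.L)) * surv ν x with hS'
  set c := Real.exp (-w.r * x) * w.W (ENNReal.ofReal x) with hc
  have hg : HasDerivAt (w.gain ν) (-(c * S')) x := by
    rw [hasDerivAt_iff_isLittleO]
    have h1 := (w.gain_isLittleO ν hx hW).trans_isBigO hS.isBigO_sub
    have h2 := (hasDerivAt_iff_isLittleO.1 hS).const_mul_left c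
    refine (h1.sub h2).congr_left fun t => ?_
    simp only [smul_eq_mul]; ring
  have he : HasDerivAt (fun t => Real.exp (-w.r * t) * w.L)
      (-w.r * Real.exp (-w.r * x) * w.L) x := by
    have := ((hasDerivAt_id x).const_mul (-w.r)).exp.mul_const w.L
    simpa [mul_comm] using this
  refine (hg.add (he.mul hS)).congr_deriv ?_
  rw [hS', hc]
  field_simp
  ring

/-- If the value is locally constant, the opponent concedes at the hazard rate
`r L / (W x - L)`. -/
lemma hasDerivAt_surv {x v : ℝ} (hx : 0 < x)
    (hW : ContinuousAt (fun t => w.W (ENNReal.ofReal t)) x)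
    (hv : ∀ᶠ t in 𝓝 x, w.valueRight ν t = v) :
    HasDerivAt (surv ν) (-(w.r * w.L / (w.W (ENNReal.ofReal x) - w.L)) * surv ν x) x := by
  have hWL : w.W (ENNReal.ofReal x) - w.L ≠ 0 := (sub_pos.2 (w.L_lt_W _)).ne'
  set e : ℝ → ℝ := fun t => Real.exp (-w.r * t) with he
  set c := e x * (w.W (ENNReal.ofReal x) - w.L) with hc
  have hc0 : c ≠ 0 := mul_ne_zero (Real.exp_ne_zero _) hWL
  have hed : HasDerivAt e (-w.r * e x) x := by
    have := ((hasDerivAt_id x).const_mul (-w.r)).exp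
    simpa [he, mul_comm] using this
  set Δ : ℝ → ℝ := fun t => surv ν t - surv ν x with hΔ
  set g : ℝ → ℝ := fun t => w.L * surv ν x * (e t - e x) with hg
  have h1 := w.gain_isLittleO ν hx hW
  have h2 : (fun t => w.L * (e t - e x) * Δ t) =o[𝓝 x] Δ := by
    have h3 : Tendsto (fun t => w.L * (e t - e x)) (𝓝 x) (𝓝 0) := by
      have := (hed.continuousAt.tendsto.sub_const (e x)).const_mul w.L
      simpa using this
    have := ((Asymptotics.isLittleO_one_iff ℝ).2 h3).mul_isBigO (Asymptotics.isBigO_refl Δ (𝓝 x))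
    simpa using this
  -- Differentiability of `surv` is not given. Constancy of the value says that c Δ agrees with the
  -- differentiable `g` up to o(Δ). Hence Δ is first O(t - x), and the error then becomes o(t - x),
  -- which yields the derivative.
  have h3 : (fun t => g t - c * Δ t) =o[𝓝 x] Δ := by
    refine (h1.add h2).neg_left.congr' ?_ EventuallyEq.rfl
    filter_upwards [hv] with t ht
    have hx' : w.valueRight ν x = v := hv.self_of_nhds
    rw [valueRight] at ht hx'
    simp only [hg, hc, hΔ, he] at *
    linear_combination hx' - ht
  have h4 : Asymptotics.IsEquivalent (𝓝 x) g fun t => c * Δ t :=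
    (Asymptotics.isLittleO_const_mul_right_iff hc0).2 h3
  have hgO : g =O[𝓝 x] fun t => t - x := (hed.isBigO_sub).const_mul_left _
  have h5 : Δ =O[𝓝 x] fun t => t - x := by
    have := h4.symm.isBigO.trans hgO
    exact (Asymptotics.isBigO_const_mul_left_iff hc0).1 this
  have h6 := h3.trans_isBigO h5
  have h7 := (hasDerivAt_iff_isLittleO.1 hed).const_mul_left (w.L * surv ν x)
  rw [hasDerivAt_iff_isLittleO]
  refine ((h7.sub h6).const_mul_left c⁻¹).congr_left fun t => ?_
  have hex : e x ≠ 0 := Real.exp_ne_zero _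
  simp only [hg, hc, hΔ, smul_eq_mul]
  field_simp
  ring

end Contest

/-! ### Mixtures of the behavioral and the rational type. -/

section TypeMix

variable {z : ℝ} {μ : Measure ℝ≥0∞}

lemma typeMix_apply (z : ℝ) (μ : Measure ℝ≥0∞) (s : Set ℝ≥0∞) : typeMix z μ s =
    ENNReal.ofReal z * Measure.dirac ⊤ s + ENNReal.ofReal (1 - z) * μ s := by
  simp [typeMix]

lemma isProbabilityMeasure_typeMix [IsProbabilityMeasure μ] (h0 : 0 ≤ z) (h1 : z ≤ 1) :
    IsProbabilityMeasure (typeMix z μ) :=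
  ⟨by rw [typeMix_apply, measure_univ, measure_univ, mul_one, mul_one,
    ← ENNReal.ofReal_add h0 (sub_nonneg.2 h1)]; simp⟩

lemma typeMix_real [IsFiniteMeasure μ] (h0 : 0 ≤ z) (h1 : z ≤ 1) (s : Set ℝ≥0∞) :
    (typeMix z μ).real s = z * (Measure.dirac ⊤ : Measure ℝ≥0∞).real s + (1 - z) * μ.real s := by
  rw [measureReal_def, typeMix_apply, ENNReal.toReal_add, ENNReal.toReal_mul, ENNReal.toReal_mul,
    ENNReal.toReal_ofReal h0, ENNReal.toReal_ofReal (sub_nonneg.2 h1)]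
  · rfl
  · exact ENNReal.mul_ne_top ENNReal.ofReal_ne_top (measure_ne_top _ _)
  · exact ENNReal.mul_ne_top ENNReal.ofReal_ne_top (measure_ne_top _ _)

lemma typeMix_real_of_notMem [IsFiniteMeasure μ] (h0 : 0 ≤ z) (h1 : z ≤ 1) {s : Set ℝ≥0∞}
    (hs : ⊤ ∉ s) : (typeMix z μ).real s = (1 - z) * μ.real s := by
  rw [typeMix_real h0 h1, measureReal_def, Measure.dirac_apply, indicator_of_notMem hs]; simp

lemma typeMix_real_of_mem [IsFiniteMeasure μ] (h0 : 0 ≤ z) (h1 : z ≤ 1) {s : Set ℝ≥0∞}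
    (hs : ⊤ ∈ s) : (typeMix z μ).real s = z + (1 - z) * μ.real s := by
  rw [typeMix_real h0 h1, measureReal_def, Measure.dirac_apply, indicator_of_mem hs]; simp

lemma typeMix_of_notMem {s : Set ℝ≥0∞} (hs : ⊤ ∉ s) :
    typeMix z μ s = ENNReal.ofReal (1 - z) * μ s := by
  rw [typeMix_apply, Measure.dirac_apply, indicator_of_notMem hs]; simp

lemma typeMix_top_ne_zero (h0 : 0 < z) : typeMix z μ {⊤} ≠ 0 := by
  rw [typeMix_apply]
  simp [h0]

lemma typeMix_compl_top_ne_zero [IsProbabilityMeasure μ] (h1 : z < 1) (h : μ {⊤} = 0) :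
    typeMix z μ {⊤}ᶜ ≠ 0 := by
  rw [typeMix_of_notMem (by simp), prob_compl_eq_one_sub (measurableSet_singleton _), h]
  simp [h1]

lemma surv_typeMix [IsFiniteMeasure μ] (h0 : 0 ≤ z) (h1 : z ≤ 1) (t : ℝ) :
    surv (typeMix z μ) t = z + (1 - z) * μ.real (Ioi (ENNReal.ofReal t)) :=
  typeMix_real_of_mem h0 h1 ENNReal.ofReal_lt_top

lemma concessionCdf_of_neg {t : ℝ} (ht : t < 0) : concessionCdf z μ t = 0 := by
  have : {s : ℝ≥0∞ | s ≠ ⊤ ∧ s.toReal ≤ t} = ∅ := by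
    ext s
    simp only [mem_ofPred_eq, mem_empty_iff_false, iff_false, not_and, not_le]
    exact fun _ => ht.trans_le ENNReal.toReal_nonneg
  rw [concessionCdf, this]; simp

lemma concessionCdf_eq [IsProbabilityMeasure μ] (h0 : 0 ≤ z) (h1 : z ≤ 1) {t : ℝ} (ht : 0 ≤ t) :
    concessionCdf z μ t = 1 - surv (typeMix z μ) t := by
  have : {s : ℝ≥0∞ | s ≠ ⊤ ∧ s.toReal ≤ t} = (Ioi (ENNReal.ofReal t))ᶜ := by
    ext s
    simp only [mem_ofPred_eq, mem_compl_iff, mem_Ioi, not_lt]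
    constructor
    · rintro ⟨h2, h3⟩
      exact (ENNReal.le_ofReal_iff_toReal_le h2 ht).2 h3
    · intro h2
      have h3 := ne_top_of_le_ne_top ENNReal.ofReal_ne_top h2
      exact ⟨h3, (ENNReal.le_ofReal_iff_toReal_le h3 ht).1 h2⟩
  rw [concessionCdf, this, surv_typeMix h0 h1, probReal_compl_eq_one_sub measurableSet_Ioi]
  ring

/-- A plan is determined by the survival function. -/
lemma plan_ext {μ' : Measure ℝ≥0∞} [IsProbabilityMeasure μ] [IsProbabilityMeasure μ']
    (h0 : 0 ≤ z) (h1 : z < 1)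
    (h : ∀ t : ℝ, 0 ≤ t → surv (typeMix z μ) t = surv (typeMix z μ') t) : μ = μ' := by
  refine Measure.ext_of_Iic μ μ' fun a => ?_
  rcases eq_or_ne a ⊤ with rfl | ha
  · simp
  · have h2 := h a.toReal ENNReal.toReal_nonneg
    rw [surv_typeMix h0 h1.le, surv_typeMix h0 h1.le, ENNReal.ofReal_toReal ha] at h2
    have h3 : μ.real (Ioi a) = μ'.real (Ioi a) :=
      mul_left_cancel₀ (sub_pos.2 h1).ne' (add_left_cancel h2)
    have h4 : μ (Ioi a) = μ' (Ioi a) :=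
      (ENNReal.toReal_eq_toReal_iff' (measure_ne_top _ _) (measure_ne_top _ _)).1 h3
    rw [← compl_Ioi, prob_compl_eq_one_sub measurableSet_Ioi,
      prob_compl_eq_one_sub measurableSet_Ioi, h4]

end TypeMix

/-! ### Equilibrium of the reputational war of attrition. -/

namespace Contest

variable {w w₁ w₂ : Contest} {ν : Measure ℝ≥0∞}

section Hazard

variable [IsFiniteMeasure ν]

lemma valueRight_eq_of_hazard {T : ℝ} (hν : ∀ x, x ≠ 0 → x ≠ ⊤ → ν {x} = 0)
    (hW : ∀ t ∈ Ioo 0 T, ContinuousAt (fun t => w.W (ENNReal.ofReal t)) t)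
    (hS : ∀ t ∈ Ioo 0 T, HasDerivAt (surv ν)
      (-(w.r * w.L / (w.W (ENNReal.ofReal t) - w.L)) * surv ν t) t)
    {t : ℝ} (ht : t ∈ Icc 0 T) : w.valueRight ν t = w.valueRight ν 0 :=
  eq_of_hasDerivAt_zero ((w.continuousOn_valueRight hν).mono Icc_subset_Ici_self)
    (fun t ht => w.hasDerivAt_valueRight ν ht.1 (hW t ht) (hS t ht)) ht

lemma value_zero_le : w.value ν 0 ≤ w.valueRight ν 0 := by
  rw [value_zero, valueRight_zero]
  have h1 := w.M_add_le 0
  have h2 := w.δ_pos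
  have h3 : 0 ≤ ν.real {0} := measureReal_nonneg
  nlinarith

lemma value_zero_eq (h : ν {0} = 0) : w.value ν 0 = w.valueRight ν 0 := by
  rw [value_zero, valueRight_zero, measureReal_def, h]; simp

/-- After T only an opponent who never concedes is left, so waiting longer merely delays or forfeits
`L`. -/
lemma value_le_valueRight {T : ℝ} (hT : 0 ≤ T) (hν : ν (Ioo (ENNReal.ofReal T) ⊤) = 0)
    {x : ℝ≥0∞} (hx : ENNReal.ofReal T < x) : w.value ν x ≤ w.valueRight ν T := by
  have h1 : ∀ᵐ y ∂ν, y ∉ Ioo (ENNReal.ofReal T) ⊤ := by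
    rw [← compl_mem_ae_iff] at hν; exact hν
  have h2 : w.valueRight ν T =
      ∫ y, ((Iic (ENNReal.ofReal T)).indicator (fun y => disc w.r y * w.W y) y
        + (Ioi (ENNReal.ofReal T)).indicator (fun _ => Real.exp (-w.r * T) * w.L) y) ∂ν := by
    rw [integral_add ((w.integrable_disc_mul_W ν).indicator measurableSet_Iic)
      ((integrable_const _).indicator measurableSet_Ioi),
      integral_indicator_const _ measurableSet_Ioi, valueRight, gain, smul_eq_mul, surv]
    ring
  rw [h2]
  refine integral_mono_ae (w.integrable_pay ν x)
    (((w.integrable_disc_mul_W ν).indicator measurableSet_Iic).add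
      ((integrable_const _).indicator measurableSet_Ioi)) ?_
  filter_upwards [h1] with y hy
  have hL := w.L_pos
  rcases le_or_gt y (ENNReal.ofReal T) with h | h
  · simp only [indicator_of_mem (show y ∈ Iic _ from h),
      indicator_of_notMem (show y ∉ Ioi _ from not_lt.2 h), w.pay_of_gt (h.trans_lt hx), add_zero,
      le_refl]
  · have hyt : y = ⊤ := by
      by_contra hne
      exact hy ⟨h, lt_top_iff_ne_top.2 hne⟩
    subst hyt
    simp only [indicator_of_notMem (show ⊤ ∉ Iic (ENNReal.ofReal T) from not_le.2 h),
      indicator_of_mem (show ⊤ ∈ Ioi (ENNReal.ofReal T) from h), zero_add, ← disc_ofReal hT]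
    rcases (le_top : x ≤ ⊤).eq_or_lt with rfl | h'
    · rw [pay_self, disc_top, zero_mul]
      exact mul_nonneg (disc_nonneg _ _) hL.le
    · rw [w.pay_of_lt h']
      have := disc_lt_disc w.r_pos hx
      gcongr

/-- If the opponent concedes at the indifference hazard rate up to `T` and never later, all times
in `(0, T]` are best replies. -/
lemma value_of_hazard {T : ℝ} (hT : 0 ≤ T) (hν : ∀ x, x ≠ 0 → x ≠ ⊤ → ν {x} = 0)
    (hν' : ν (Ioo (ENNReal.ofReal T) ⊤) = 0)
    (hW : ∀ t ∈ Ioo 0 T, ContinuousAt (fun t => w.W (ENNReal.ofReal t)) t)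
    (hS : ∀ t ∈ Ioo 0 T, HasDerivAt (surv ν)
      (-(w.r * w.L / (w.W (ENNReal.ofReal t) - w.L)) * surv ν t) t) :
    (∀ x, w.value ν x ≤ w.valueRight ν 0) ∧
      ∀ x ≤ ENNReal.ofReal T, (x = 0 → ν {0} = 0) → w.value ν x = w.valueRight ν 0 := by
  have h1 : ∀ x ≤ ENNReal.ofReal T, x ≠ 0 → w.value ν x = w.valueRight ν 0 := by
    intro x hx h0
    have hxt := ne_top_of_le_ne_top ENNReal.ofReal_ne_top hx
    rw [← valueRight_eq_of_hazard hν hW hS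
      (⟨ENNReal.toReal_nonneg, ENNReal.toReal_le_of_le_ofReal hT hx⟩ : x.toReal ∈ Icc 0 T),
      ← w.value_ofReal ENNReal.toReal_nonneg, ENNReal.ofReal_toReal hxt]
    rw [ENNReal.ofReal_toReal hxt]; exact hν x h0 hxt
  constructor
  · intro x
    rcases eq_or_ne x 0 with rfl | h0
    · exact value_zero_le
    rcases le_or_gt x (ENNReal.ofReal T) with h | h
    · exact (h1 x h h0).le
    · rw [← valueRight_eq_of_hazard hν hW hS (⟨hT, le_rfl⟩ : T ∈ Icc 0 T)]
      exact value_le_valueRight hT hν' h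
  · intro x hx h0
    rcases eq_or_ne x 0 with rfl | hne
    · exact value_zero_eq (h0 rfl)
    · exact h1 x hx hne

/-- The survival function is determined up to scale by the hazard rate. -/
lemma surv_mul_eq {T : ℝ} {h R : ℝ → ℝ} (hν : ∀ x, x ≠ 0 → x ≠ ⊤ → ν {x} = 0)
    (hS : ∀ t ∈ Ioo 0 T, HasDerivAt (surv ν) (-h t * surv ν t) t)
    (hRc : ContinuousOn R (Icc 0 T)) (hR0 : ∀ t ∈ Icc 0 T, R t ≠ 0)
    (hR : ∀ t ∈ Ioo 0 T, HasDerivAt R (-h t * R t) t) {t : ℝ} (ht : t ∈ Icc 0 T) :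
    surv ν t / R t = surv ν 0 / R 0 := by
  refine eq_of_hasDerivAt_zero (f := fun t => surv ν t / R t)
    (((continuousOn_surv hν).mono Icc_subset_Ici_self).div hRc hR0) (fun t ht => ?_) ht
  refine ((hS t ht).div (hR t ht) (hR0 t (Ioo_subset_Icc_self ht))).congr_deriv ?_
  have := hR0 t (Ioo_subset_Icc_self ht)
  field_simp
  ring

end Hazard

/-- The plan `μ` uses only best replies to `ν`. -/
def Optimal (w : Contest) (μ ν : Measure ℝ≥0∞) : Prop := ∀ᵐ x ∂μ, x ∈ w.best ν

/-- `RepliesTo` exempts ⊤, the only point at which the behavioral type adds mass. -/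
lemma Optimal.repliesTo {z : ℝ} {μ : Measure ℝ≥0∞} (h : w.Optimal μ ν) :
    w.RepliesTo (typeMix z μ) ν := by
  have h1 : μ {x | ¬ (x ≠ ⊤ → x ∈ w.best ν)} = 0 :=
    measure_mono_null (fun x hx h' => hx fun _ => h') (ae_iff.1 h)
  rw [RepliesTo, ae_iff, typeMix_of_notMem (by simp), h1, mul_zero]

/-- Equilibria of a reputational war of attrition between two possibly behavioral players. -/
theorem Optimal.equilibrium {z₁ z₂ : ℝ} {μ₁ μ₂ : Measure ℝ≥0∞} [IsProbabilityMeasure μ₁]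
    [IsProbabilityMeasure μ₂] (hz₁ : z₁ ∈ Ioo (0 : ℝ) 1) (hz₂ : z₂ ∈ Ioo (0 : ℝ) 1)
    (h₁ : w₁.Optimal μ₁ (typeMix z₂ μ₂)) (h₂ : w₂.Optimal μ₂ (typeMix z₁ μ₁)) :
    (∀ x, x ≠ 0 → x ≠ ⊤ → typeMix z₁ μ₁ {x} = 0) ∧
    (∀ x, x ≠ 0 → x ≠ ⊤ → typeMix z₂ μ₂ {x} = 0) ∧
    (surv (typeMix z₁ μ₁) 0 = 1 ∨ surv (typeMix z₂ μ₂) 0 = 1) ∧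
    (∀ᵐ x ∂μ₁, w₁.value (typeMix z₂ μ₂) x = w₁.valueRight (typeMix z₂ μ₂) 0) ∧
    ∃ T : ℝ, 0 < T ∧
      (∀ t, T ≤ t → surv (typeMix z₁ μ₁) t = z₁) ∧
      (∀ t, T ≤ t → surv (typeMix z₂ μ₂) t = z₂) ∧
      (∀ t ∈ Ioo 0 T, ContinuousAt (fun t => w₂.W (ENNReal.ofReal t)) t →
        HasDerivAt (surv (typeMix z₁ μ₁)) (-(w₂.r * w₂.L / (w₂.W (ENNReal.ofReal t) - w₂.L)) *
          surv (typeMix z₁ μ₁) t) t) ∧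
      (∀ t ∈ Ioo 0 T, ContinuousAt (fun t => w₁.W (ENNReal.ofReal t)) t →
        HasDerivAt (surv (typeMix z₂ μ₂)) (-(w₁.r * w₁.L / (w₁.W (ENNReal.ofReal t) - w₁.L)) *
          surv (typeMix z₂ μ₂) t) t) := by
  have hp₁ := isProbabilityMeasure_typeMix (μ := μ₁) hz₁.1.le hz₁.2.le
  have hp₂ := isProbabilityMeasure_typeMix (μ := μ₂) hz₂.1.le hz₂.2.le
  have ht₁ := typeMix_top_ne_zero (μ := μ₁) hz₁.1
  have ht₂ := typeMix_top_ne_zero (μ := μ₂) hz₂.1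
  have hr₁ := h₁.repliesTo (z := z₁)
  have hr₂ := h₂.repliesTo (z := z₂)
  have ha₁ : ∀ x, x ≠ 0 → x ≠ ⊤ → typeMix z₁ μ₁ {x} = 0 :=
    fun x h0 ht => hr₁.measure_singleton hr₂ ht₂ h0 ht
  have ha₂ : ∀ x, x ≠ 0 → x ≠ ⊤ → typeMix z₂ μ₂ {x} = 0 :=
    fun x h0 ht => hr₂.measure_singleton hr₁ ht₁ h0 ht
  have hm₁ : μ₁ {⊤} = 0 := measure_mono_null
    (singleton_subset_iff.2 (show ⊤ ∈ {x | ¬ x ∈ w₁.best (typeMix z₂ μ₂)} from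
      top_notMem_best ht₂)) (ae_iff.1 h₁)
  have hm₂ : μ₂ {⊤} = 0 := measure_mono_null
    (singleton_subset_iff.2 (show ⊤ ∈ {x | ¬ x ∈ w₂.best (typeMix z₁ μ₁)} from
      top_notMem_best ht₁)) (ae_iff.1 h₂)
  obtain ⟨T, hT, hb₁, hb₂⟩ := hr₁.exists_terminal hr₂ ht₁ ht₂
    (typeMix_compl_top_ne_zero hz₁.2 hm₁) (typeMix_compl_top_ne_zero hz₂.2 hm₂)
  have hTpos : 0 < ENNReal.ofReal T := ENNReal.ofReal_pos.2 hT
  -- Past T no time is a best reply, so every rational type has conceded and only the behavioral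
  -- probability survives.
  have tail : ∀ {w : Contest} {μ ν : Measure ℝ≥0∞} {z : ℝ}, IsProbabilityMeasure μ →
      z ∈ Ioo (0 : ℝ) 1 → w.Optimal μ ν →
      (∀ x, x ≠ 0 → (x ∈ w.best ν ↔ x ≤ ENNReal.ofReal T)) →
      ∀ t, T ≤ t → surv (typeMix z μ) t = z := by
    intro w μ ν z _ hz h hb t ht
    have h0 : μ (Ioi (ENNReal.ofReal t)) = 0 := by
      refine measure_mono_null (t := {x | ¬ x ∈ w.best ν}) (fun x hx hx' => ?_) (ae_iff.1 h)
      have h3 : ENNReal.ofReal T < x := lt_of_le_of_lt (ENNReal.ofReal_le_ofReal ht) hx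
      exact absurd ((hb x (hTpos.trans h3).ne').1 hx') (not_le.2 h3)
    rw [surv_typeMix hz.1.le hz.2.le, measureReal_def, h0]; simp
  have val : ∀ {w : Contest} {ν : Measure ℝ≥0∞} [IsProbabilityMeasure ν],
      (∀ x, x ≠ 0 → x ≠ ⊤ → ν {x} = 0) →
      (∀ x, x ≠ 0 → (x ∈ w.best ν ↔ x ≤ ENNReal.ofReal T)) → ∀ t ∈ Ioc 0 T,
      w.valueRight ν t = w.value ν (ENNReal.ofReal T) := by
    intro w ν _ ha hb t ht
    have h0 : ENNReal.ofReal t ≠ 0 := (ENNReal.ofReal_pos.2 ht.1).ne'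
    rw [← w.value_ofReal ht.1.le (ha _ h0 ENNReal.ofReal_ne_top)]
    have h1 := (hb _ h0).2 (ENNReal.ofReal_le_ofReal ht.2)
    have h2 := (hb _ hTpos.ne').2 le_rfl
    exact le_antisymm (h2 _) (h1 _)
  have der : ∀ {w : Contest} {ν : Measure ℝ≥0∞} [IsProbabilityMeasure ν],
      (∀ x, x ≠ 0 → x ≠ ⊤ → ν {x} = 0) →
      (∀ x, x ≠ 0 → (x ∈ w.best ν ↔ x ≤ ENNReal.ofReal T)) → ∀ t ∈ Ioo 0 T,
      ContinuousAt (fun t => w.W (ENNReal.ofReal t)) t → HasDerivAt (surv ν)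
        (-(w.r * w.L / (w.W (ENNReal.ofReal t) - w.L)) * surv ν t) t := by
    intro w ν _ ha hb t ht hW
    refine w.hasDerivAt_surv ν ht.1 hW (v := w.value ν (ENNReal.ofReal T)) ?_
    filter_upwards [Ioo_mem_nhds ht.1 ht.2] with s hs using val ha hb s ⟨hs.1, hs.2.le⟩
  refine ⟨ha₁, ha₂, ?_, ?_, T, hT, tail ‹_› hz₁ h₁ hb₁, tail ‹_› hz₂ h₂ hb₂, der ha₁ hb₂, der ha₂ hb₁⟩
  -- An atom of player 1 at 0 makes 0 a best reply, which rules out an atom of player 2 there.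
  · have e₁ := real_singleton_zero_add_surv (typeMix z₁ μ₁)
    have e₂ := real_singleton_zero_add_surv (typeMix z₂ μ₂)
    by_cases h0 : typeMix z₁ μ₁ {0} = 0
    · left; rw [measureReal_def, h0] at e₁; simpa using e₁
    · right
      obtain ⟨x, hx, hb⟩ := hr₁.exists_mem h0 (by simp)
      rw [mem_singleton_iff] at hx
      subst hx
      have h0' := measure_singleton_of_mem_best hb (by simp)
      rw [measureReal_def, h0'] at e₂; simpa using e₂
  · have hc := (w₁.continuousOn_valueRight ha₂) 0 self_mem_Ici
    have hlim : Tendsto (w₁.valueRight (typeMix z₂ μ₂)) (𝓝[>] 0)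
        (𝓝 (w₁.valueRight (typeMix z₂ μ₂) 0)) :=
      hc.tendsto.mono_left (nhdsWithin_mono _ Ioi_subset_Ici_self)
    -- `valueRight` is continuous at 0 from the right and constant on (0, T], so the equilibrium
    -- value is that of conceding just after 0.
    have hconst : w₁.valueRight (typeMix z₂ μ₂) 0 = w₁.value (typeMix z₂ μ₂) (ENNReal.ofReal T) := by
      refine tendsto_nhds_unique hlim ((tendsto_const_nhds).congr' ?_)
      filter_upwards [Ioc_mem_nhdsGT hT] with s hs using (val ha₂ hb₁ s hs).symm
    filter_upwards [h₁] with x hx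
    rw [hconst]
    exact le_antisymm ((hb₁ _ hTpos.ne').2 le_rfl x) (hx _)

end Contest

/-! ### Bayes' rule and optimality at later histories. -/

section Conditioning

variable {z : ℝ} {μ ν : Measure ℝ≥0∞}

lemma bayes_one (p : ℝ) : bayes p 1 = p := by simp [bayes]

lemma bayes_mem {p q : ℝ} (hp : p ∈ Ioo (0 : ℝ) 1) (hq : 0 ≤ q) : bayes p q ∈ Ioc (0 : ℝ) 1 := by
  have h1 : 0 ≤ (1 - p) * q := mul_nonneg (sub_nonneg.2 hp.2.le) hq
  have h2 : 0 < p + (1 - p) * q := by linarith [hp.1]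
  exact ⟨div_pos hp.1 h2, (div_le_one h2).2 (by linarith)⟩

lemma bayes_lt_one {p q : ℝ} (hp : p ∈ Ioo (0 : ℝ) 1) (hq : 0 < q) : bayes p q < 1 := by
  have h1 : 0 < (1 - p) * q := mul_pos (sub_pos.2 hp.2) hq
  have h2 : 0 < p + (1 - p) * q := by linarith [hp.1]
  exact (div_lt_one h2).2 (by linarith)

lemma bayes_zero {p : ℝ} (hp : p ≠ 0) : bayes p 0 = 1 := by simp [bayes, hp]

lemma bayes_one_left (q : ℝ) : bayes 1 q = 1 := by simp [bayes]

lemma cond_Ici_zero [IsProbabilityMeasure μ] :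
    ProbabilityTheory.cond μ (Ici ((0 : ℝ≥0) : ℝ≥0∞)) = μ := by
  have : (Ici ((0 : ℝ≥0) : ℝ≥0∞)) = univ := by ext; simp
  rw [this, cond_univ]

lemma contLaw_zero [IsProbabilityMeasure ν] : contLaw z ν 0 = typeMix z ν := by
  rw [contLaw, cond_Ici_zero]

lemma measure_Ici_zero [IsProbabilityMeasure μ] : μ (Ici ((0 : ℝ≥0) : ℝ≥0∞)) = 1 := by
  have : (Ici ((0 : ℝ≥0) : ℝ≥0∞)) = univ := by ext; simp
  rw [this, measure_univ]

lemma real_Ici_zero [IsProbabilityMeasure μ] : μ.real (Ici ((0 : ℝ≥0) : ℝ≥0∞)) = 1 := by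
  rw [measureReal_def, measure_Ici_zero]; rfl

/-- The continuation law is the conditional law of the opponent's concession time. -/
lemma contLaw_bayes [IsProbabilityMeasure ν] {p : ℝ} (h0 : 0 < p) (h1 : p ≤ 1) (t : ℝ≥0) :
    contLaw (bayes p (ν.real (Ici (t : ℝ≥0∞)))) ν t =
      ProbabilityTheory.cond (typeMix p ν) (Ici (t : ℝ≥0∞)) := by
  set q := ν.real (Ici (t : ℝ≥0∞)) with hq
  have hq0 : 0 ≤ q := measureReal_nonneg
  have h1p : 0 ≤ 1 - p := sub_nonneg.2 h1
  have hd : 0 < p + (1 - p) * q := by positivity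
  have hm : (typeMix p ν) (Ici (t : ℝ≥0∞)) = ENNReal.ofReal (p + (1 - p) * q) := by
    have := isProbabilityMeasure_typeMix (μ := ν) h0.le h1
    rw [← typeMix_real_of_mem h0.le h1 (μ := ν) (s := Ici (t : ℝ≥0∞)) (mem_Ici.2 le_top)]
    simp
  have hνq : ν (Ici (t : ℝ≥0∞)) = ENNReal.ofReal q := by simp [hq]
  ext s hs
  rw [contLaw, typeMix_apply, cond_apply measurableSet_Ici, cond_apply measurableSet_Ici, hm,
    typeMix_apply, mul_add]
  congr 1
  · have : (Measure.dirac (⊤ : ℝ≥0∞)) (Ici (t : ℝ≥0∞) ∩ s) = Measure.dirac ⊤ s := by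
      rw [Measure.dirac_apply' _ (measurableSet_Ici.inter hs), Measure.dirac_apply' _ hs]
      by_cases h : ⊤ ∈ s <;> simp [h]
    rw [this, ← mul_assoc, ← ENNReal.ofReal_inv_of_pos hd,
      ← ENNReal.ofReal_mul (inv_nonneg.2 hd.le), bayes, div_eq_inv_mul]
  · rcases hq0.eq_or_lt with h | h
    -- If the rational type has surely conceded before t, her conditional plan is the zero measure
    -- by convention and contributes nothing on either side.
    · have h2 : ν (Ici (t : ℝ≥0∞) ∩ s) = 0 :=
        measure_mono_null inter_subset_left (by rw [hνq, ← h]; simp)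
      rw [h2]; simp
    · rw [hνq, ← mul_assoc, ← mul_assoc, ← ENNReal.ofReal_inv_of_pos hd,
        ← ENNReal.ofReal_inv_of_pos h, ← ENNReal.ofReal_mul (inv_nonneg.2 hd.le),
        ← ENNReal.ofReal_mul]
      · congr 2
        rw [bayes]; field_simp; ring
      · rw [bayes, sub_nonneg, div_le_one hd]; nlinarith

namespace Contest

variable {w : Contest}

lemma expPayoff_pay : expPayoff w.pay μ ν = ∫ x, w.value ν x ∂μ := rfl

lemma expPayoff_dirac (x : ℝ≥0∞) : expPayoff w.pay (Measure.dirac x) ν = w.value ν x := by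
  rw [expPayoff_pay, integral_dirac]

/-- An average that is at least the supremum can only be attained by values equal to it almost
surely. -/
lemma optimal_of_forall_le [IsProbabilityMeasure μ] [IsProbabilityMeasure ν]
    (h : ∀ x, w.value ν x ≤ ∫ x, w.value ν x ∂μ) : w.Optimal μ ν := by
  set v := ∫ x, w.value ν x ∂μ with hv
  have hi := w.integrable_value ν μ
  have h1 : ∫ x, (v - w.value ν x) ∂μ = 0 := by
    rw [integral_sub (integrable_const _) hi, integral_const, ← hv]; simp
  have h2 := (integral_eq_zero_iff_of_nonneg (fun x => sub_nonneg.2 (h x))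
    ((integrable_const _).sub hi)).1 h1
  filter_upwards [h2] with x hx y
  have : v - w.value ν x = 0 := hx
  linarith [h y]

/-- For x ≥ t, what happens before t does not depend on x. The ex ante value is thus an increasing
affine function of the conditional one, which makes optimal plans time consistent. -/
lemma value_split [IsFiniteMeasure ν] {t x : ℝ≥0∞} (htx : t ≤ x) (hν : ν (Ici t) ≠ 0) :
    w.value ν x = (∫ y in Iio t, disc w.r y * w.W y ∂ν) +
      ν.real (Ici t) * w.value (ProbabilityTheory.cond ν (Ici t)) x := by
  have h1 := integral_add_compl (μ := ν) (measurableSet_Iio (a := t)) (w.integrable_pay ν x)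
  rw [compl_Iio] at h1
  rw [value, ← h1]
  congr 1
  · refine setIntegral_congr_fun measurableSet_Iio fun y hy => ?_
    exact w.pay_of_gt (lt_of_lt_of_le hy htx)
  · rw [value, ProbabilityTheory.cond, integral_smul_measure, smul_eq_mul, ENNReal.toReal_inv,
      ← mul_assoc]
    have : ν.real (Ici t) ≠ 0 := (real_pos_of_ne_zero hν).ne'
    rw [← measureReal_def, mul_inv_cancel₀ this, one_mul]

/-- A plan that is optimal at the outset is optimal at every later history. -/
lemma value_cond {v : ℝ} [IsProbabilityMeasure ν] {t : ℝ≥0∞} (hν : ν (Ici t) ≠ 0)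
    (hle : ∀ x, w.value ν x ≤ v) (heq : ∀ᵐ x ∂μ, w.value ν x = v) :
    ∃ v', (∀ x, t ≤ x → w.value (ProbabilityTheory.cond ν (Ici t)) x ≤ v') ∧
      ∀ᵐ x ∂(ProbabilityTheory.cond μ (Ici t)),
        w.value (ProbabilityTheory.cond ν (Ici t)) x = v' := by
  have hc := real_pos_of_ne_zero hν
  refine ⟨(v - ∫ y in Iio t, disc w.r y * w.W y ∂ν) / ν.real (Ici t), fun x hx => ?_, ?_⟩
  · rw [le_div_iff₀ hc]
    linarith [hle x, w.value_split hx hν]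
  · have h1 : ∀ᵐ x ∂(ProbabilityTheory.cond μ (Ici t)), x ∈ Ici t :=
      ae_cond_mem measurableSet_Ici
    filter_upwards [h1, cond_absolutelyContinuous.ae_le heq] with x hx hx'
    rw [eq_div_iff hc.ne']
    linarith [w.value_split hx hν]

/-- The deviation is evaluated with any nonnegative payoff `u` below `pay`, without measurability.
This accommodates deviations of C that also change her stage-2 plans. -/
lemma expPayoff_le_of_value_cond {v : ℝ} [IsProbabilityMeasure μ] [IsProbabilityMeasure ν]
    {t : ℝ≥0∞} (hν : ν (Ici t) ≠ 0) (hμ : μ (Ici t) ≠ 0)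
    (hle : ∀ x, w.value ν x ≤ v) (heq : ∀ᵐ x ∂μ, w.value ν x = v)
    {μ' : Measure ℝ≥0∞} (hp : IsProbabilityMeasure μ') (ht : μ' (Iio t) = 0)
    {u : ℝ≥0∞ → ℝ≥0∞ → ℝ} (hu0 : ∀ x y, 0 ≤ u x y) (hu : ∀ x y, u x y ≤ w.pay x y) :
    expPayoff u μ' (ProbabilityTheory.cond ν (Ici t)) ≤
      expPayoff w.pay (ProbabilityTheory.cond μ (Ici t)) (ProbabilityTheory.cond ν (Ici t)) := by
  have h1 := cond_isProbabilityMeasure hν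
  have h2 := cond_isProbabilityMeasure hμ
  obtain ⟨v', hv', hv''⟩ := w.value_cond hν hle heq
  rw [expPayoff_pay, integral_congr_ae hv'', integral_const, probReal_univ, one_smul]
  have h3 : ∀ᵐ x ∂μ', t ≤ x := by
    rw [← compl_mem_ae_iff, compl_Iio] at ht; exact ht
  refine (integral_mono_of_nonneg (Eventually.of_forall fun x => integral_nonneg (hu0 x))
    (integrable_const v') ?_).trans (by simp)
  filter_upwards [h3] with x hx
  refine le_trans ?_ (hv' x hx)
  exact integral_mono_of_nonneg (Eventually.of_forall (hu0 x)) (w.integrable_pay _ x)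
    (Eventually.of_forall (hu x))

end Contest

end Conditioning

/-! ### The war of attrition over a fixed surplus and its unique equilibrium. -/

namespace SeqGame

variable (m : SeqGame)

/-- The war of attrition over a surplus `p`. -/
@[simps] def war (p : ℝ) (hp : 0 < p) : Contest where
  r := m.r
  L := (1 - m.α) * p
  M := p / 2
  δ := (m.α - 1 / 2) * p
  K := m.α * p
  W := fun _ => m.α * p
  r_pos := m.r_pos
  L_pos := mul_pos (sub_pos.2 m.α_lt_one) hp
  δ_pos := mul_pos (sub_pos.2 m.half_lt_α) hp
  L_add_le := by linarith
  M_add_le := fun _ => by linarith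
  W_le := fun _ => le_rfl
  measurable_W := measurable_const

lemma warPayoff_eq {p : ℝ} (hp : 0 < p) : warPayoff m.r m.α p = (m.war p hp).pay := by
  ext x y
  rw [warPayoff, Contest.pay]
  rcases lt_trichotomy x y with h | rfl | h
  · simp [h, min_eq_left h.le]; ring
  · simp; ring
  · simp [h, h.not_gt, min_eq_right h.le]; ring

lemma lam_pos : 0 < m.lam :=
  div_pos (mul_pos m.r_pos (sub_pos.2 m.α_lt_one)) (by linarith [m.half_lt_α])

lemma war_hazard {p : ℝ} (hp : 0 < p) (y : ℝ≥0∞) : (m.war p hp).r * (m.war p hp).L /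
    ((m.war p hp).W y - (m.war p hp).L) = m.lam := by
  have h := m.half_lt_α
  have h2 : m.α * p - (1 - m.α) * p ≠ 0 := by
    have : 0 < (2 * m.α - 1) * p := mul_pos (by linarith) hp
    intro h0; linarith
  have h3 : 2 * m.α - 1 ≠ 0 := by linarith
  simp only [war_r, war_L, war_W, lam]
  field_simp
  ring

lemma optimal_of_isOptimalFrom {p : ℝ} (hp : 0 < p) {μ ν : Measure ℝ≥0∞} {z : ℝ}
    [IsProbabilityMeasure μ] [IsProbabilityMeasure ν] (h0 : 0 ≤ z) (h1 : z ≤ 1)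
    (h : IsOptimalFrom (warPayoff m.r m.α p) μ ν z 0) :
    (m.war p hp).Optimal μ (typeMix z ν) := by
  have := isProbabilityMeasure_typeMix (μ := ν) h0 h1
  refine Contest.optimal_of_forall_le fun x => ?_
  have h2 := h (Measure.dirac x) inferInstance (by simp)
  rwa [contLaw_zero, cond_Ici_zero, m.warPayoff_eq hp, Contest.expPayoff_dirac,
    Contest.expPayoff_pay] at h2

lemma isOptimalFrom_of_value {p : ℝ} (hp : 0 < p) {μ ν : Measure ℝ≥0∞} {z v : ℝ}
    [IsProbabilityMeasure μ] [IsProbabilityMeasure ν] (h0 : 0 < z) (h1 : z ≤ 1)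
    (hle : ∀ x, (m.war p hp).value (typeMix z ν) x ≤ v)
    (heq : ∀ᵐ x ∂μ, (m.war p hp).value (typeMix z ν) x = v) {t : ℝ≥0}
    (ht : μ (Ici (t : ℝ≥0∞)) ≠ 0) :
    IsOptimalFrom (warPayoff m.r m.α p) μ ν (bayes z (ν.real (Ici (t : ℝ≥0∞)))) t := by
  intro μ' hμ' ht'
  have := isProbabilityMeasure_typeMix (μ := ν) h0.le h1
  rw [contLaw_bayes h0 h1, m.warPayoff_eq hp]
  refine Contest.expPayoff_le_of_value_cond ?_ ht hle heq hμ' ht' (Contest.pay_nonneg _)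
    fun _ _ => le_rfl
  intro h2
  exact typeMix_top_ne_zero (μ := ν) h0 (measure_mono_null (singleton_subset_iff.2 le_top) h2)

end SeqGame

section Bilateral

/-- Both players reach probability one of being behavioral at T. The player without an atom is the
one with the larger prior, and that prior fixes T; the other player's atom makes up the difference.
-/
lemma ag_solve_aux {l T z₁ z₂ s₂ : ℝ} (hl : 0 < l) (hz₁ : 0 < z₁) (hz₂ : 0 < z₂)
    (e₁ : Real.exp (-l * T) = z₁) (e₂ : s₂ * Real.exp (-l * T) = z₂) (h₂ : s₂ ≤ 1) :
    T = min (-(1 / l) * Real.log z₁) (-(1 / l) * Real.log z₂) ∧ 1 = 1 - gAG z₂ z₁ ∧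
      s₂ = 1 - gAG z₁ z₂ := by
  have h12 : z₂ ≤ z₁ := by rw [← e₂, ← e₁]; nlinarith [Real.exp_pos (-l * T)]
  have hT : T = -(1 / l) * Real.log z₁ := by
    rw [← e₁, Real.log_exp]; field_simp
  have hlog := Real.log_le_log hz₂ h12
  have hl' : 0 < 1 / l := by positivity
  refine ⟨?_, ?_, ?_⟩
  · rw [min_eq_left, hT]
    nlinarith
  · have : 1 ≤ z₁ / z₂ := (one_le_div hz₂).2 h12
    rw [gAG, max_eq_right (by linarith)]; ring
  · have : z₂ / z₁ ≤ 1 := (div_le_one hz₁).2 h12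
    rw [gAG, max_eq_left (by linarith), ← e₂, ← e₁]
    field_simp
    ring

lemma ag_solve {l T z₁ z₂ s₁ s₂ : ℝ} (hl : 0 < l) (hz₁ : 0 < z₁) (hz₂ : 0 < z₂)
    (e₁ : s₁ * Real.exp (-l * T) = z₁) (e₂ : s₂ * Real.exp (-l * T) = z₂) (h₁ : s₁ ≤ 1)
    (h₂ : s₂ ≤ 1) (h : s₁ = 1 ∨ s₂ = 1) :
    T = min (-(1 / l) * Real.log z₁) (-(1 / l) * Real.log z₂) ∧ s₁ = 1 - gAG z₂ z₁ ∧
      s₂ = 1 - gAG z₁ z₂ := by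
  rcases h with rfl | rfl
  · exact ag_solve_aux hl hz₁ hz₂ (by simpa using e₁) e₂ h₂
  · obtain ⟨a, b, c⟩ := ag_solve_aux hl hz₂ hz₁ (by simpa using e₂) e₁ h₁
    exact ⟨by rw [min_comm]; exact a, c, b⟩

lemma exp_lam_hasDerivAt (l t : ℝ) :
    HasDerivAt (fun t => Real.exp (-l * t)) (-l * Real.exp (-l * t)) t := by
  have := ((hasDerivAt_id t).const_mul (-l)).exp
  simpa [mul_comm] using this

lemma surv_le_one (ν : Measure ℝ≥0∞) [IsProbabilityMeasure ν] (t : ℝ) : surv ν t ≤ 1 :=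
  measureReal_le_one

/-- A survival function with constant hazard rate `l` up to `T`. -/
lemma surv_eq_exp {ν : Measure ℝ≥0∞} [IsProbabilityMeasure ν] {l T z : ℝ} (hT : 0 < T)
    (hν : ∀ x, x ≠ 0 → x ≠ ⊤ → ν {x} = 0) (hz : ∀ t, T ≤ t → surv ν t = z)
    (hS : ∀ t ∈ Ioo 0 T, HasDerivAt (surv ν) (-l * surv ν t) t) {t : ℝ} (ht : 0 ≤ t) :
    surv ν t = surv ν 0 * Real.exp (-l * min t T) := by
  have key : ∀ t ∈ Icc 0 T, surv ν t = surv ν 0 * Real.exp (-l * t) := by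
    intro t ht
    have := Contest.surv_mul_eq (h := fun _ => l) (R := fun t => Real.exp (-l * t)) hν hS
      (by fun_prop) (fun _ _ => Real.exp_ne_zero _) (fun t _ => exp_lam_hasDerivAt l t) ht
    simp only [mul_zero, Real.exp_zero, div_one] at this
    rwa [div_eq_iff (Real.exp_ne_zero _)] at this
  rcases le_total t T with h | h
  · rw [min_eq_left h]; exact key t ⟨ht, h⟩
  · rw [min_eq_right h, ← key T ⟨hT.le, le_rfl⟩, hz t h, hz T le_rfl]

end Bilateral

namespace SeqGame

variable (m : SeqGame)

/-- Uniqueness of the equilibrium of the bilateral war of attrition. -/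
theorem bilateral_unique {p : ℝ} (hp : 0 < p) {z₁ z₂ : ℝ} {μ₁ μ₂ : Measure ℝ≥0∞}
    [IsProbabilityMeasure μ₁]
    [IsProbabilityMeasure μ₂] (hz₁ : z₁ ∈ Ioo (0 : ℝ) 1) (hz₂ : z₂ ∈ Ioo (0 : ℝ) 1)
    (h₁ : (m.war p hp).Optimal μ₁ (typeMix z₂ μ₂))
    (h₂ : (m.war p hp).Optimal μ₂ (typeMix z₁ μ₁)) :
    (∀ t, concessionCdf z₁ μ₁ t = agCdf m.lam z₁ z₂ t) ∧
    (∀ t, concessionCdf z₂ μ₂ t = agCdf m.lam z₂ z₁ t) ∧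
    (∀ᵐ x ∂μ₁, (m.war p hp).value (typeMix z₂ μ₂) x =
      (m.war p hp).valueRight (typeMix z₂ μ₂) 0) := by
  have hp₁ := isProbabilityMeasure_typeMix (μ := μ₁) hz₁.1.le hz₁.2.le
  have hp₂ := isProbabilityMeasure_typeMix (μ := μ₂) hz₂.1.le hz₂.2.le
  obtain ⟨ha₁, ha₂, hor, hval, T, hT, hT₁, hT₂, hd₁, hd₂⟩ := Contest.Optimal.equilibrium hz₁ hz₂ h₁ h₂
  have hs₁ : ∀ t : ℝ, 0 ≤ t → _ := fun t ht => surv_eq_exp (l := m.lam) hT ha₁ hT₁ (fun t ht => by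
    have := hd₁ t ht continuousAt_const
    rwa [m.war_hazard] at this) (t := t) ht
  have hs₂ : ∀ t : ℝ, 0 ≤ t → _ := fun t ht => surv_eq_exp (l := m.lam) hT ha₂ hT₂ (fun t ht => by
    have := hd₂ t ht continuousAt_const
    rwa [m.war_hazard] at this) (t := t) ht
  have e₁ := hs₁ T hT.le
  have e₂ := hs₂ T hT.le
  rw [hT₁ T le_rfl, min_self] at e₁
  rw [hT₂ T le_rfl, min_self] at e₂
  obtain ⟨e, f₁, f₂⟩ := ag_solve m.lam_pos hz₁.1 hz₂.1 e₁.symm e₂.symm (surv_le_one _ _)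
    (surv_le_one _ _) hor
  refine ⟨fun t => ?_, fun t => ?_, hval⟩
  · rcases lt_or_ge t 0 with ht | ht
    · rw [concessionCdf_of_neg ht, agCdf, if_pos ht]
    · rw [concessionCdf_eq hz₁.1.le hz₁.2.le ht, agCdf, if_neg ht.not_gt, hs₁ t ht, f₁, ← e]
  · rcases lt_or_ge t 0 with ht | ht
    · rw [concessionCdf_of_neg ht, agCdf, if_pos ht]
    · rw [concessionCdf_eq hz₂.1.le hz₂.2.le ht, agCdf, if_neg ht.not_gt, hs₂ t ht, f₂,
        min_comm (-(1 / m.lam) * Real.log z₂), ← e]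

end SeqGame

attribute [instance] Assessment.prob_planA Assessment.prob_planC Assessment.markov_planB₂
  Assessment.markov_planC₂

lemma integral_typeMix {z : ℝ} {μ : Measure ℝ≥0∞} (h0 : 0 ≤ z) (h1 : z ≤ 1) {f : ℝ≥0∞ → ℝ}
    (hμ : Integrable f μ) :
    ∫ y, f y ∂(typeMix z μ) = z * f ⊤ + (1 - z) * ∫ y, f y ∂μ := by
  rw [typeMix, integral_add_measure, integral_smul_measure, integral_smul_measure, integral_dirac,
    ENNReal.toReal_ofReal h0, ENNReal.toReal_ofReal (sub_nonneg.2 h1)]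
  · rfl
  · exact (integrable_dirac (by simp)).smul_measure ENNReal.ofReal_ne_top
  · exact hμ.smul_measure ENNReal.ofReal_ne_top

/-! ### Stage 1 for C with stage-2 values substituted. -/

namespace Contest

variable {w : Contest} {ν : Measure ℝ≥0∞}

/-- Any positive waiting time x beats an opponent's atom at 0 and otherwise yields at least `L`
discounted to x. For small x this nearly secures the value of conceding just after 0. -/
lemma disc_mul_valueRight_zero_le [IsFiniteMeasure ν] {x : ℝ≥0∞} (hx : x ≠ 0) :
    disc w.r x * w.valueRight ν 0 ≤ w.value ν x := by
  have h2 : disc w.r x * w.valueRight ν 0 = ∫ y, disc w.r x *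
      (({0} : Set ℝ≥0∞).indicator (fun _ => w.W 0) y + (Ioi (0 : ℝ≥0∞)).indicator
        (fun _ => w.L) y) ∂ν := by
    rw [integral_const_mul, integral_add ((integrable_const _).indicator (measurableSet_singleton _))
      ((integrable_const _).indicator measurableSet_Ioi),
      integral_indicator_const _ measurableSet_Ioi,
      integral_indicator_const _ (measurableSet_singleton _), valueRight_zero, surv]
    simp [mul_comm]
  rw [h2]
  refine integral_mono (((((integrable_const _).indicator (measurableSet_singleton _)).add
    ((integrable_const _).indicator measurableSet_Ioi))).const_mul _) (w.integrable_pay ν x)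
    fun y => ?_
  have hL := w.L_pos
  have hd := disc_nonneg w.r x
  rcases eq_or_ne y 0 with rfl | h
  · have h1 := disc_le_one w.r_pos x
    have h3 := w.W_pos 0
    simp only [mem_singleton_iff, indicator_of_mem, mem_Ioi, lt_self_iff_false, not_false_eq_true,
      indicator_of_notMem, add_zero, w.pay_of_gt (pos_iff_ne_zero.2 hx), disc_zero, one_mul]
    nlinarith
  · have h' := pos_iff_ne_zero.2 h
    simp only [mem_singleton_iff, h, not_false_eq_true, indicator_of_notMem, mem_Ioi, h',
      indicator_of_mem, zero_add]
    rcases lt_trichotomy x y with hxy | rfl | hxy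
    · rw [w.pay_of_lt hxy]
    · rw [pay_self]; have := w.L_add_le; have := w.δ_pos; nlinarith
    · rw [w.pay_of_gt hxy]
      have := disc_lt_disc w.r_pos hxy
      have := w.L_lt_W y
      have := w.W_pos y
      nlinarith

lemma value_zero_of_singleton [IsProbabilityMeasure ν] (h : ν {0} = 0) : w.value ν 0 = w.L := by
  have e := real_singleton_zero_add_surv ν
  rw [measureReal_def, h] at e
  rw [value_zero, measureReal_def, h]
  simp at e
  simp [e]

end Contest

namespace SeqGame

variable (m : SeqGame) (σ : Assessment)

/-- Probability that `B` concedes at once after `A` has conceded at `τ`. -/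
def atomB (τ : ℝ≥0∞) : ℝ := (typeMix m.zB (σ.planB₂ Ending.byA τ.toNNReal)).real {0}

lemma atomB_eq (τ : ℝ≥0∞) :
    m.atomB σ τ = (1 - m.zB) * (σ.planB₂ Ending.byA τ.toNNReal).real {0} :=
  typeMix_real_of_notMem m.zB_mem.1.le m.zB_mem.2.le (by simp)

lemma measurable_atomB : Measurable (m.atomB σ) := by
  have h : m.atomB σ = fun τ => (1 - m.zB) * (σ.planB₂ Ending.byA τ.toNNReal).real {0} :=
    funext (m.atomB_eq σ)
  rw [h]
  have h1 : Measurable fun τ : ℝ≥0 => (σ.planB₂ Ending.byA τ).real {0} :=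
    ((σ.planB₂ Ending.byA).measurable_coe (measurableSet_singleton _)).ennreal_toReal
  exact (h1.comp ENNReal.measurable_toNNReal).const_mul _

lemma atomB_nonneg (τ : ℝ≥0∞) : 0 ≤ m.atomB σ τ := measureReal_nonneg

lemma atomB_le_one (τ : ℝ≥0∞) : m.atomB σ τ ≤ 1 := by
  have := isProbabilityMeasure_typeMix (μ := σ.planB₂ Ending.byA τ.toNNReal)
    m.zB_mem.1.le m.zB_mem.2.le
  exact measureReal_le_one

/-- Value of stage 2 for a rational `C` after a concession of `A` at `τ`. -/
def contValue (τ : ℝ≥0∞) : ℝ := (1 - m.α) + (2 * m.α - 1) * m.atomB σ τ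

lemma valueRight_eq_contValue (τ : ℝ≥0) :
    (m.war 1 one_pos).valueRight (typeMix m.zB (σ.planB₂ Ending.byA τ)) 0 = m.contValue σ τ := by
  have := isProbabilityMeasure_typeMix (μ := σ.planB₂ Ending.byA τ) m.zB_mem.1.le m.zB_mem.2.le
  have e := real_singleton_zero_add_surv (typeMix m.zB (σ.planB₂ Ending.byA τ))
  rw [Contest.valueRight_zero, contValue, atomB, ENNReal.toNNReal_coe]
  simp only [war_W, war_L]
  linear_combination (1 - m.α) * e

/-- Stage 1 from the point of view of `C`: besides the stage-1 share she receives `1 - α` in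
stage 2 if she has conceded and the continuation value if `A` has. -/
@[simps] def contestC : Contest where
  r := m.r
  L := (1 - m.α) * (m.πAC + 1)
  M := m.πAC / 2 + (1 - m.α)
  δ := (m.α - 1 / 2) * m.πAC
  K := m.α * m.πAC + m.α
  W := fun τ => m.α * m.πAC + m.contValue σ τ
  r_pos := m.r_pos
  L_pos := mul_pos (sub_pos.2 m.α_lt_one) (by linarith [m.πAC_pos])
  δ_pos := mul_pos (sub_pos.2 m.half_lt_α) m.πAC_pos
  L_add_le := by linarith
  M_add_le := fun τ => by
    have h1 := mul_nonneg (by linarith [m.half_lt_α] : 0 ≤ 2 * m.α - 1) (m.atomB_nonneg σ τ)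
    rw [contValue]; linarith
  W_le := fun τ => by
    have h1 := m.atomB_le_one σ τ
    have h2 := m.half_lt_α
    rw [contValue]; nlinarith
  measurable_W := (((m.measurable_atomB σ).const_mul _).const_add _).const_add _

/-- Expected stage-2 payoff of a rational `C`. -/
def payoffC₂ (β κ : Ending → Kernel ℝ≥0 ℝ≥0∞) (e : Ending) (τ : ℝ≥0∞) : ℝ :=
  expPayoff (m.war 1 one_pos).pay (κ e τ.toNNReal) (typeMix m.zB (β e τ.toNNReal))

variable (β κ : Ending → Kernel ℝ≥0 ℝ≥0∞) {c a : ℝ≥0∞}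

lemma payoffC_of_lt (h : c < a) : m.payoffC β κ c a =
    disc m.r c * ((1 - m.α) * m.πAC + m.payoffC₂ β κ Ending.byC c) := by
  rw [payoffC, warPayoff, m.warPayoff_eq one_pos, endingOf, if_pos h, if_pos h, min_eq_left h.le,
    payoffC₂]
  ring

lemma payoffC_of_gt (h : a < c) : m.payoffC β κ c a =
    disc m.r a * (m.α * m.πAC + m.payoffC₂ β κ Ending.byA a) := by
  rw [payoffC, warPayoff, m.warPayoff_eq one_pos, endingOf, if_neg h.not_gt, if_pos h,
    if_neg h.not_gt, if_pos h, min_eq_right h.le, payoffC₂]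
  ring

lemma payoffC_self : m.payoffC β κ c c =
    disc m.r c * (m.πAC / 2 + m.payoffC₂ β κ Ending.both c) := by
  rw [payoffC, warPayoff, m.warPayoff_eq one_pos, endingOf, if_neg (lt_irrefl _),
    if_neg (lt_irrefl _), if_neg (lt_irrefl _), if_neg (lt_irrefl _), min_self, payoffC₂]
  ring

variable {m σ}

lemma reputation_FC (t : ℝ) (ht : 0 ≤ t) :
    reputation m.zC (m.FC σ) t = m.zC / surv (typeMix m.zC σ.planC) t := by
  rw [reputation, FC, concessionCdf_eq m.zC_mem.1.le m.zC_mem.2.le ht, sub_sub_cancel]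

lemma reputation_FA (t : ℝ) (ht : 0 ≤ t) :
    reputation m.zA (m.FA σ) t = m.zA / surv (typeMix m.zA σ.planA) t := by
  rw [reputation, FA, concessionCdf_eq m.zA_mem.1.le m.zA_mem.2.le ht, sub_sub_cancel]

lemma reputation_eq_bayes (τ : ℝ≥0) :
    reputation m.zC (m.FC σ) τ = bayes m.zC (σ.planC.real (Ioi (τ : ℝ≥0∞))) := by
  rw [reputation_FC (τ : ℝ) τ.coe_nonneg, surv_typeMix m.zC_mem.1.le m.zC_mem.2.le, bayes, ENNReal.ofReal_coe_nnreal]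

lemma gAG_nonneg (x y : ℝ) : 0 ≤ gAG x y := le_max_right _ _

lemma min_log_nonneg {l z₁ z₂ : ℝ} (hl : 0 < l) (h₁ : z₁ ∈ Ioc (0 : ℝ) 1)
    (h₂ : z₂ ∈ Ioc (0 : ℝ) 1) :
    0 ≤ min (-(1 / l) * Real.log z₁) (-(1 / l) * Real.log z₂) := by
  have hl' : 0 < 1 / l := by positivity
  have := Real.log_nonpos h₁.1.le h₁.2
  have := Real.log_nonpos h₂.1.le h₂.2
  exact le_min (by nlinarith) (by nlinarith)

lemma agCdf_zero {l z₁ z₂ : ℝ} (hl : 0 < l) (h₁ : z₁ ∈ Ioc (0 : ℝ) 1)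
    (h₂ : z₂ ∈ Ioc (0 : ℝ) 1) : agCdf l z₁ z₂ 0 = gAG z₂ z₁ := by
  rw [agCdf, if_neg (lt_irrefl _), min_eq_left (min_log_nonneg hl h₁ h₂)]; simp

/-- Against an opponent known to be behavioral, rational players concede at once. -/
lemma agCdf_one_right {l z : ℝ} (hl : 0 < l) (hz : z ∈ Ioo (0 : ℝ) 1) (t : ℝ) :
    concessionCdf z (Measure.dirac 0) t = agCdf l z 1 t := by
  rcases lt_or_ge t 0 with ht | ht
  · rw [concessionCdf_of_neg ht, agCdf, if_pos ht]
  · rw [concessionCdf_eq hz.1.le hz.2.le ht, surv_typeMix hz.1.le hz.2.le, agCdf, if_neg ht.not_gt]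
    have h1 : -(1 / l) * Real.log 1 = 0 := by simp
    have h2 : 0 ≤ -(1 / l) * Real.log z := by
      have := Real.log_nonpos hz.1.le hz.2.le
      have : 0 < 1 / l := by positivity
      nlinarith
    rw [h1, min_eq_right h2, min_eq_right ht, gAG, max_eq_left (by linarith [hz.2, div_one z])]
    simp [measureReal_def]

/-- A prior of 1 gives the rational plan weight zero, so `μ` is arbitrary. This is the case of C's
stage-2 plan after times by which she would surely have conceded. -/
lemma agCdf_one_left {l z : ℝ} (hl : 0 < l) (hz : z ∈ Ioo (0 : ℝ) 1) (μ : Measure ℝ≥0∞) (t : ℝ) :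
    concessionCdf 1 μ t = agCdf l 1 z t := by
  rw [concessionCdf, agCdf]
  split_ifs with ht
  · simp
  · have h1 : -(1 / l) * Real.log 1 = 0 := by simp
    have h2 : 0 ≤ -(1 / l) * Real.log z := by
      have := Real.log_nonpos hz.1.le hz.2.le
      have : 0 < 1 / l := by positivity
      nlinarith
    rw [h1, min_eq_left h2, min_eq_right (not_lt.1 ht), gAG,
      max_eq_right (by linarith [(one_le_div hz.1).2 hz.2.le])]
    simp

lemma eq_dirac_of_measure_Ioi {μ : Measure ℝ≥0∞} [IsProbabilityMeasure μ] (h : μ (Ioi 0) = 0) :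
    μ = Measure.dirac 0 := by
  refine plan_ext (z := 0) le_rfl one_pos fun t _ => ?_
  have h1 : μ.real (Ioi (ENNReal.ofReal t)) = 0 := by
    rw [measureReal_def, measure_mono_null (Ioi_subset_Ioi (zero_le (a := ENNReal.ofReal t))) h]
    rfl
  rw [surv_typeMix le_rfl zero_le_one, surv_typeMix le_rfl zero_le_one, h1]
  simp [measureReal_def]

variable (m σ) in
/-- Stage-2 behavior of a rational `C` at the histories that she can reach, as described by the
bilateral equilibrium values. -/
structure Stage2Play : Prop where
  planC₂ : ∀ e, e ≠ Ending.byA → ∀ τ, σ.planC₂ e τ = Measure.dirac 0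
  planB₂ : ∀ e, e ≠ Ending.byA → ∀ τ, σ.planB₂ e τ {0} = 0
  value_byA : ∀ τ : ℝ≥0, reputation m.zC (m.FC σ) τ < 1 → ∀ᵐ x ∂(σ.planC₂ Ending.byA τ),
    (m.war 1 one_pos).value (typeMix m.zB (σ.planB₂ Ending.byA τ)) x = m.contValue σ τ

namespace Stage2Play

variable (h : m.Stage2Play σ)
include h

lemma payoffC₂_of_ne_byA {κ' : Ending → Kernel ℝ≥0 ℝ≥0∞} {e : Ending} (he : e ≠ Ending.byA)
    {τ : ℝ≥0∞} (hκ : κ' e τ.toNNReal = Measure.dirac 0) :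
    m.payoffC₂ σ.planB₂ κ' e τ = 1 - m.α := by
  have hp := isProbabilityMeasure_typeMix (μ := σ.planB₂ e τ.toNNReal) m.zB_mem.1.le m.zB_mem.2.le
  rw [payoffC₂, hκ, Contest.expPayoff_dirac, Contest.value_zero_of_singleton, war_L, mul_one]
  rw [typeMix_of_notMem (by simp), h.planB₂ e he, mul_zero]

/-- The condition on c keeps C's reputation below 1 at every τ < c, where a concession of A leads to
a stage 2 in which her plan earns `contValue`. -/
lemma payoffC_eq_pay {c : ℝ≥0∞} (hc : ∀ τ < c, σ.planC (Ioi τ) ≠ 0) (a : ℝ≥0∞) :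
    m.payoffC σ.planB₂ σ.planC₂ c a = (m.contestC σ).pay c a := by
  rcases lt_trichotomy c a with hca | rfl | hca
  · rw [payoffC_of_lt _ _ _ hca, Contest.pay_of_lt _ hca,
      h.payoffC₂_of_ne_byA (by simp) (h.planC₂ _ (by simp) _)]
    simp only [contestC_r, contestC_L]; ring
  · rw [payoffC_self, Contest.pay_self,
      h.payoffC₂_of_ne_byA (by simp) (h.planC₂ _ (by simp) _)]
    simp only [contestC_r, contestC_M]
  · rw [payoffC_of_gt _ _ _ hca, Contest.pay_of_gt _ hca, payoffC₂, Contest.expPayoff_pay]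
    have hat : a ≠ ⊤ := ne_top_of_lt hca
    lift a to ℝ≥0 using hat with τ
    rw [ENNReal.toNNReal_coe]
    have hlt : reputation m.zC (m.FC σ) τ < 1 := by
      rw [reputation_eq_bayes]
      exact bayes_lt_one m.zC_mem (real_pos_of_ne_zero (hc _ hca))
    rw [integral_congr_ae (h.value_byA τ hlt)]
    simp

/-- Almost every time used by `planC` satisfies the condition of `payoffC_eq_pay`, because no mass
lies above the upper end of its support. -/
lemma expPayoff_payoffC {μ ν : Measure ℝ≥0∞} (hμ : μ ≪ σ.planC) :
    expPayoff (m.payoffC σ.planB₂ σ.planC₂) μ ν = expPayoff (m.contestC σ).pay μ ν := by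
  refine integral_congr_ae (hμ.ae_le ?_)
  have hae : ∀ᵐ c ∂σ.planC, ∀ τ < c, σ.planC (Ioi τ) ≠ 0 := by
    rw [ae_iff]
    set S := {τ : ℝ≥0∞ | σ.planC (Ioi τ) = 0} with hS
    have hsub : {c | ¬ ∀ τ < c, σ.planC (Ioi τ) ≠ 0} ⊆ Ioi (sInf S) := by
      intro c hc
      simp only [mem_ofPred_eq] at hc
      push Not at hc
      obtain ⟨τ, hτ, hτ0⟩ := hc
      exact (sInf_le (show τ ∈ S from hτ0)).trans_lt hτ
    refine measure_mono_null hsub (measure_Ioi_sInf_eq_zero _)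
  filter_upwards [hae] with c hc
  exact integral_congr_ae (Eventually.of_forall (h.payoffC_eq_pay hc))

end Stage2Play

/-! ### Consequences of equilibrium: stage 2, and stage-1 optimality. -/

namespace IsPBE

variable (h : m.IsPBE σ)
include h

lemma beliefB₂_zero (e : Ending) (τ : ℝ≥0) : σ.beliefB₂ e τ 0 = m.zB := by
  rw [h.bayesConsistent.stage2B, real_Ici_zero, bayes_one]

lemma beliefC₂_byA_zero (τ : ℝ≥0) :
    σ.beliefC₂ Ending.byA τ 0 = reputation m.zC (m.FC σ) τ := by
  rw [h.bayesConsistent.stage2C_byA, real_Ici_zero, bayes_one, reputation_eq_bayes]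

lemma beliefC₂_eq_zero {e : Ending} (he : e ≠ Ending.byA) (τ t : ℝ≥0) : σ.beliefC₂ e τ t = 0 := by
  cases e
  · exact absurd rfl he
  · exact h.bayesConsistent.stage2C_byC τ t
  · exact h.bayesConsistent.stage2C_both τ t

lemma optimalB₂ {e : Ending} {τ : ℝ≥0} {z : ℝ} (hz : σ.beliefC₂ e τ 0 = z) (h0 : 0 ≤ z)
    (h1 : z ≤ 1) : (m.war 1 one_pos).Optimal (σ.planB₂ e τ) (typeMix z (σ.planC₂ e τ)) := by
  have hp := isProbabilityMeasure_typeMix (μ := σ.planC₂ e τ) h0 h1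
  refine m.optimal_of_isOptimalFrom one_pos h0 h1 ?_
  rw [← hz]
  refine h.rationalB₂ e τ 0 (by rw [h.beliefB₂_zero]; exact m.zB_mem.2)
    (by rw [measure_Ici_zero]; exact one_ne_zero) ?_
  rw [contLaw_zero, hz]
  exact IsProbabilityMeasure.ne_zero _

lemma optimalC₂ {e : Ending} {τ : ℝ≥0} (hz : σ.beliefC₂ e τ 0 < 1) :
    (m.war 1 one_pos).Optimal (σ.planC₂ e τ) (typeMix m.zB (σ.planB₂ e τ)) := by
  have hp := isProbabilityMeasure_typeMix (μ := σ.planB₂ e τ) m.zB_mem.1.le m.zB_mem.2.le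
  refine m.optimal_of_isOptimalFrom one_pos m.zB_mem.1.le m.zB_mem.2.le ?_
  rw [← h.beliefB₂_zero e τ]
  refine h.rationalC₂ e τ 0 hz (by rw [measure_Ici_zero]; exact one_ne_zero) ?_
  rw [contLaw_zero, h.beliefB₂_zero]
  exact IsProbabilityMeasure.ne_zero _

omit h in
lemma reputation_mem (τ : ℝ≥0) : reputation m.zC (m.FC σ) τ ∈ Ioc (0 : ℝ) 1 := by
  rw [reputation_eq_bayes]
  exact bayes_mem m.zC_mem measureReal_nonneg

/-- Stage 2 after a concession of `A`. -/
theorem stage2_byA (τ : ℝ≥0) :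
    (∀ t : ℝ, concessionCdf m.zB (σ.planB₂ Ending.byA τ) t =
      agCdf m.lam m.zB (reputation m.zC (m.FC σ) τ) t) ∧
    (∀ t : ℝ, concessionCdf (reputation m.zC (m.FC σ) τ) (σ.planC₂ Ending.byA τ) t =
      agCdf m.lam (reputation m.zC (m.FC σ) τ) m.zB t) ∧
    (reputation m.zC (m.FC σ) τ < 1 → ∀ᵐ x ∂(σ.planC₂ Ending.byA τ), (m.war 1 one_pos).value
      (typeMix m.zB (σ.planB₂ Ending.byA τ)) x = m.contValue σ τ) := by
  set z := reputation m.zC (m.FC σ) τ with hz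
  have hzm : z ∈ Ioc (0 : ℝ) 1 := reputation_mem τ
  have hb := h.beliefC₂_byA_zero τ
  -- At reputation one, B faces an opponent who never concedes and only loses by waiting. Below one,
  -- both sides are possibly rational and bilateral uniqueness applies.
  rcases hzm.2.eq_or_lt with h1 | h1
  · rw [h1]
    refine ⟨?_, agCdf_one_left m.lam_pos m.zB_mem _, fun hlt => absurd hlt (lt_irrefl _)⟩
    have hB := h.optimalB₂ (hb.trans h1) zero_le_one le_rfl
    have : σ.planB₂ Ending.byA τ = Measure.dirac 0 := by
      refine eq_dirac_of_measure_Ioi (measure_mono_null (t := {x | ¬ x ∈ (m.war 1 one_pos).best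
        (typeMix 1 (σ.planC₂ Ending.byA τ))}) (fun x hx hxb => ?_) (ae_iff.1 hB))
      have hp := isProbabilityMeasure_typeMix (μ := σ.planC₂ Ending.byA τ) zero_le_one (le_refl (1 : ℝ))
      have h2 := Contest.le_real_Icc_of_mem_best hxb hx
      rw [typeMix_real_of_notMem (s := Icc 0 x \ {⊤}) zero_le_one le_rfl (by simp),
        typeMix_real_of_mem (s := Ioi x ∪ {⊤}) zero_le_one le_rfl (by simp)] at h2
      have h3 := mul_pos (sub_pos.2 (disc_lt_disc (m.war 1 one_pos).r_pos hx))
        (m.war 1 one_pos).L_pos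
      simp at h2
      simp at h3
      linarith
    rw [this]
    exact agCdf_one_right m.lam_pos m.zB_mem
  · have hB := h.optimalB₂ hb hzm.1.le hzm.2
    have hC := h.optimalC₂ (hb.trans_lt h1)
    obtain ⟨a, b, -⟩ := m.bilateral_unique one_pos m.zB_mem ⟨hzm.1, h1⟩ hB hC
    -- The roles are exchanged because the value statement concerns the first player.
    obtain ⟨-, -, d⟩ := m.bilateral_unique one_pos ⟨hzm.1, h1⟩ m.zB_mem hC hB
    refine ⟨a, b, fun _ => ?_⟩
    rwa [m.valueRight_eq_contValue] at d

lemma atomB_eq_gAG (τ : ℝ≥0) : m.atomB σ τ = gAG (reputation m.zC (m.FC σ) τ) m.zB := by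
  have hp := isProbabilityMeasure_typeMix (μ := σ.planB₂ Ending.byA τ) m.zB_mem.1.le m.zB_mem.2.le
  have e := real_singleton_zero_add_surv (typeMix m.zB (σ.planB₂ Ending.byA τ))
  have h1 := (h.stage2_byA τ).1 0
  rw [concessionCdf_eq m.zB_mem.1.le m.zB_mem.2.le le_rfl,
    agCdf_zero m.lam_pos (Ioo_subset_Ioc_self m.zB_mem) (reputation_mem τ)] at h1
  rw [atomB, ENNReal.toNNReal_coe, ← h1]
  linarith

/-- Stage 2 after a concession of `C`. -/
theorem stage2_of_ne_byA {e : Ending} (he : e ≠ Ending.byA) (τ : ℝ≥0) :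
    σ.planC₂ e τ = Measure.dirac 0 ∧ σ.planB₂ e τ {0} = 0 := by
  have hp := isProbabilityMeasure_typeMix (μ := σ.planB₂ e τ) m.zB_mem.1.le m.zB_mem.2.le
  have hb := h.beliefC₂_eq_zero he τ 0
  have hB := h.optimalB₂ hb le_rfl zero_le_one
  have hC := h.optimalC₂ (hb.trans_lt one_pos)
  have hm : typeMix 0 (σ.planC₂ e τ) = σ.planC₂ e τ := by simp [typeMix]
  rw [hm] at hB
  have h0 : σ.planC₂ e τ = Measure.dirac 0 := eq_dirac_of_measure_Ioi
    (hB.repliesTo.measure_Ioi_zero (typeMix_top_ne_zero m.zB_mem.1) hC)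
  refine ⟨h0, ?_⟩
  rw [h0, Contest.Optimal, ae_dirac_eq, eventually_pure] at hC
  have h1 := Contest.measure_singleton_of_mem_best hC (by simp)
  rw [typeMix_of_notMem (by simp)] at h1
  have h2 := m.zB_mem.2
  simpa [h2.not_ge] using h1

lemma stage2Play : m.Stage2Play σ :=
  ⟨fun _ he τ => (h.stage2_of_ne_byA he τ).1, fun _ he τ => (h.stage2_of_ne_byA he τ).2,
    fun τ => (h.stage2_byA τ).2.2⟩

/-- Deviation of `C` that waits `ε` before conceding in stage 2 after a concession of `A`. -/
lemma exp_mul_value_le {ε : ℝ} (hε : 0 < ε) (x : ℝ≥0∞) :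
    Real.exp (-m.r * ε) * (m.contestC σ).value (typeMix m.zA σ.planA) x ≤
      ∫ x, (m.contestC σ).value (typeMix m.zA σ.planA) x ∂σ.planC := by
  have hpA := isProbabilityMeasure_typeMix (μ := σ.planA) m.zA_mem.1.le m.zA_mem.2.le
  -- Where C's reputation is one, her own stage-2 plan need not be optimal, so a later stage-1
  -- concession must be combined with a new stage-2 plan. Waiting ε collects B's atom at a relative
  -- loss of at most 1 - exp(-rε), and being constant it is a kernel.
  set κ' : Ending → Kernel ℝ≥0 ℝ≥0∞ := fun e => Kernel.const ℝ≥0 (Measure.dirac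
    (match e with
      | Ending.byA => ENNReal.ofReal ε
      | _ => 0)) with hκ'
  have hmk : ∀ e, IsMarkovKernel (κ' e) := fun e => by simp only [hκ']; infer_instance
  have h1 := h.rationalC₁ 0 (by rw [measure_Ici_zero]; exact one_ne_zero) (Measure.dirac x)
    inferInstance (by simp) κ' hmk
  rw [contLaw_zero, cond_Ici_zero, h.bayesConsistent.stage1A, real_Ici_zero, bayes_one] at h1
  rw [h.stage2Play.expPayoff_payoffC Measure.AbsolutelyContinuous.rfl, Contest.expPayoff_pay] at h1
  refine le_trans ?_ h1
  rw [expPayoff, integral_dirac, Contest.value, ← integral_const_mul]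
  have hbyA : ∀ a : ℝ≥0∞, m.payoffC₂ σ.planB₂ κ' Ending.byA a = (m.war 1 one_pos).value
      (typeMix m.zB (σ.planB₂ Ending.byA a.toNNReal)) (ENNReal.ofReal ε) := fun a => by
    rw [payoffC₂]; simp only [hκ', Kernel.const_apply]; rw [Contest.expPayoff_dirac]
  -- The deviation payoff is the larger side of the comparison, so its integrability must be shown.
  -- Measurability in A's concession time comes from B's plan being a kernel.
  have hX : Measurable fun a => m.payoffC₂ σ.planB₂ κ' Ending.byA a := by
    have : (fun a => m.payoffC₂ σ.planB₂ κ' Ending.byA a) = fun a : ℝ≥0∞ =>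
        m.zB * (m.war 1 one_pos).pay (ENNReal.ofReal ε) ⊤ + (1 - m.zB) *
          ∫ y, (m.war 1 one_pos).pay (ENNReal.ofReal ε) y ∂(σ.planB₂ Ending.byA a.toNNReal) := by
      ext a
      rw [hbyA, Contest.value, integral_typeMix m.zB_mem.1.le m.zB_mem.2.le
        (Contest.integrable_pay _ _ _)]
    rw [this]
    have h3 : Measurable fun τ : ℝ≥0 =>
        ∫ y, (m.war 1 one_pos).pay (ENNReal.ofReal ε) y ∂(σ.planB₂ Ending.byA τ) :=
      (StronglyMeasurable.integral_kernel (κ := σ.planB₂ Ending.byA)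
        ((m.war 1 one_pos).measurable_pay_right _).stronglyMeasurable).measurable
    exact ((h3.comp ENNReal.measurable_toNNReal).const_mul _).const_add _
  have hX0 : ∀ a, 0 ≤ m.payoffC₂ σ.planB₂ κ' Ending.byA a := fun a => by
    rw [hbyA]; exact Contest.value_nonneg _ _ _
  have hX1 : ∀ a, m.payoffC₂ σ.planB₂ κ' Ending.byA a ≤ m.α := fun a => by
    have hp := isProbabilityMeasure_typeMix (μ := σ.planB₂ Ending.byA a.toNNReal)
      m.zB_mem.1.le m.zB_mem.2.le
    rw [hbyA]; simpa using Contest.value_le (m.war 1 one_pos) _ (ENNReal.ofReal ε)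
  have hα := m.half_lt_α
  have hα1 := m.α_lt_one
  have hπ := m.πAC_pos
  have hbyC : m.payoffC₂ σ.planB₂ κ' Ending.byC x = 1 - m.α :=
    h.stage2Play.payoffC₂_of_ne_byA (by simp) (by simp [hκ'])
  have hboth : m.payoffC₂ σ.planB₂ κ' Ending.both x = 1 - m.α :=
    h.stage2Play.payoffC₂_of_ne_byA (by simp) (by simp [hκ'])
  have hform : ∀ a, m.payoffC σ.planB₂ κ' x a = if x < a then
      disc m.r x * ((1 - m.α) * m.πAC + (1 - m.α)) else if a < x then
      disc m.r a * (m.α * m.πAC + m.payoffC₂ σ.planB₂ κ' Ending.byA a) else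
      disc m.r x * (m.πAC / 2 + (1 - m.α)) := by
    intro a
    rcases lt_trichotomy x a with hxa | rfl | hxa
    · rw [payoffC_of_lt _ _ _ hxa, if_pos hxa, hbyC]
    · rw [payoffC_self, if_neg (lt_irrefl _), if_neg (lt_irrefl _), hboth]
    · rw [payoffC_of_gt _ _ _ hxa, if_neg hxa.not_gt, if_pos hxa]
  have hmeas : Measurable fun a => m.payoffC σ.planB₂ κ' x a := by
    rw [funext hform]
    exact Measurable.ite measurableSet_Ioi measurable_const (Measurable.ite measurableSet_Iio
      ((measurable_disc _).mul (hX.const_add _)) measurable_const)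
  have he1 : Real.exp (-m.r * ε) ≤ 1 := by
    rw [Real.exp_le_one_iff]; nlinarith [m.r_pos]
  have he0 := Real.exp_pos (-m.r * ε)
  have hint : Integrable (fun a => m.payoffC σ.planB₂ κ' x a) (typeMix m.zA σ.planA) := by
    refine Integrable.of_bound hmeas.aestronglyMeasurable (m.πAC + 1)
      (Eventually.of_forall fun a => ?_)
    have d1 := disc_nonneg m.r x; have d2 := disc_nonneg m.r a
    have d3 := disc_le_one m.r_pos x; have d4 := disc_le_one m.r_pos a
    have x0 := hX0 a; have x1 := hX1 a
    rw [hform, Real.norm_eq_abs, abs_le]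
    split_ifs
    · have : 0 ≤ (1 - m.α) * m.πAC + (1 - m.α) := by nlinarith
      have : (1 - m.α) * m.πAC + (1 - m.α) ≤ m.πAC + 1 := by nlinarith
      constructor <;> nlinarith
    · have : 0 ≤ m.α * m.πAC + m.payoffC₂ σ.planB₂ κ' Ending.byA a := by nlinarith
      have : m.α * m.πAC + m.payoffC₂ σ.planB₂ κ' Ending.byA a ≤ m.πAC + 1 := by nlinarith
      constructor <;> nlinarith
    · have : 0 ≤ m.πAC / 2 + (1 - m.α) := by linarith
      have : m.πAC / 2 + (1 - m.α) ≤ m.πAC + 1 := by linarith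
      constructor <;> nlinarith
  refine integral_mono ((Contest.integrable_pay _ _ _).const_mul _) hint fun a => ?_
  have d1 := disc_nonneg m.r x; have d2 := disc_nonneg m.r a
  simp only [hform]
  rcases lt_trichotomy x a with hxa | rfl | hxa
  · rw [if_pos hxa, Contest.pay_of_lt _ hxa]
    simp only [contestC_r, contestC_L]
    have : 0 ≤ disc m.r x * ((1 - m.α) * (m.πAC + 1)) :=
      mul_nonneg d1 (mul_nonneg (by linarith) (by linarith))
    nlinarith
  · rw [if_neg (lt_irrefl _), if_neg (lt_irrefl _), Contest.pay_self]
    simp only [contestC_r, contestC_M]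
    have : 0 ≤ disc m.r x * (m.πAC / 2 + (1 - m.α)) := mul_nonneg d1 (by linarith)
    nlinarith
  · rw [if_neg hxa.not_gt, if_pos hxa, Contest.pay_of_gt _ hxa, hbyA]
    lift a to ℝ≥0 using ne_top_of_lt hxa with τ
    have hp := isProbabilityMeasure_typeMix (μ := σ.planB₂ Ending.byA τ) m.zB_mem.1.le m.zB_mem.2.le
    have h4 := Contest.disc_mul_valueRight_zero_le (w := m.war 1 one_pos)
      (ν := typeMix m.zB (σ.planB₂ Ending.byA τ)) (ENNReal.ofReal_pos.2 hε).ne'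
    rw [m.valueRight_eq_contValue, war_r, disc_ofReal hε.le] at h4
    simp only [contestC_r, contestC_W, ENNReal.toNNReal_coe]
    have h5 : Real.exp (-m.r * ε) * (m.α * m.πAC) ≤ m.α * m.πAC := by
      have : 0 < m.α * m.πAC := by positivity
      nlinarith
    nlinarith

/-- Stage-1 optimality of `C`, once the stage-2 payoffs are substituted. -/
lemma optimalC : (m.contestC σ).Optimal σ.planC (typeMix m.zA σ.planA) := by
  have hpA := isProbabilityMeasure_typeMix (μ := σ.planA) m.zA_mem.1.le m.zA_mem.2.le
  refine Contest.optimal_of_forall_le fun x => ?_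
  have hc : Continuous fun ε => Real.exp (-m.r * ε) *
      (m.contestC σ).value (typeMix m.zA σ.planA) x := by fun_prop
  have hlim : Tendsto (fun ε => Real.exp (-m.r * ε) *
      (m.contestC σ).value (typeMix m.zA σ.planA) x) (𝓝[>] 0)
      (𝓝 ((m.contestC σ).value (typeMix m.zA σ.planA) x)) := by
    have := (hc.tendsto 0).mono_left (nhdsWithin_le_nhds (s := Ioi 0))
    simpa using this
  refine le_of_tendsto hlim ?_
  filter_upwards [self_mem_nhdsWithin] with ε hε using h.exp_mul_value_le hε x

/-- Stage-1 optimality of `A`. -/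
lemma optimalA : (m.war m.πAC m.πAC_pos).Optimal σ.planA (typeMix m.zC σ.planC) := by
  refine m.optimal_of_isOptimalFrom m.πAC_pos m.zC_mem.1.le m.zC_mem.2.le ?_
  have h1 := h.rationalA 0 (by rw [measure_Ici_zero]; exact one_ne_zero)
  rwa [h.bayesConsistent.stage1C, real_Ici_zero, bayes_one] at h1

end IsPBE

end SeqGame

/-! ### The curve along which the stage-1 reputations move. -/

namespace SeqGame

variable (m : SeqGame)

/-- Reputation of `A` at the stage-1 histories at which `C` has reputation `x`. -/
def zeta (x : ℝ) : ℝ :=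
  if m.zB ≤ x then ((m.πAC + 1) * x - m.zB) / (m.πAC + 1 - m.zB)
  else m.πAC * m.zB / (m.πAC + 1 - m.zB) * (x / m.zB) ^ ((m.πAC + 1) / m.πAC)

lemma zBarA_eq : m.zBarA = m.zeta m.zC := rfl

lemma zTildeA_eq : m.zTildeA = m.zeta m.zB := by
  rw [zeta, if_pos le_rfl, zTildeA]; ring

lemma denom_pos : 0 < m.πAC + 1 - m.zB := by linarith [m.zB_mem.2, m.πAC_pos]

lemma zeta_pos {x : ℝ} (hx : 0 < x) : 0 < m.zeta x := by
  have h1 := m.denom_pos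
  have h2 := m.πAC_pos
  have h3 := m.zB_mem.1
  rw [zeta]
  split_ifs with h
  · refine div_pos ?_ h1
    nlinarith
  · positivity

lemma zeta_one : m.zeta 1 = 1 := by
  have h1 := m.denom_pos
  rw [zeta, if_pos m.zB_mem.2.le]
  field_simp

lemma gAG_of_le {x y : ℝ} (hx : 0 < x) (h : y ≤ x) : gAG x y = 1 - y / x :=
  max_eq_left (sub_nonneg.2 ((div_le_one hx).2 h))

lemma gAG_of_ge {x y : ℝ} (hx : 0 < x) (h : x ≤ y) : gAG x y = 0 :=
  max_eq_right (sub_nonpos.2 ((one_le_div hx).2 h))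

lemma hasDerivAt_linear (x : ℝ) :
    HasDerivAt (fun x => ((m.πAC + 1) * x - m.zB) / (m.πAC + 1 - m.zB))
      ((m.πAC + 1) / (m.πAC + 1 - m.zB)) x := by
  have := (((hasDerivAt_id x).const_mul (m.πAC + 1)).sub_const m.zB).div_const (m.πAC + 1 - m.zB)
  simpa using this

lemma hasDerivAt_power {x : ℝ} (hx : 0 < x) :
    HasDerivAt (fun x => m.πAC * m.zB / (m.πAC + 1 - m.zB) *
        (x / m.zB) ^ ((m.πAC + 1) / m.πAC))
      ((m.πAC + 1) / (x * m.πAC) * (m.πAC * m.zB / (m.πAC + 1 - m.zB) *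
        (x / m.zB) ^ ((m.πAC + 1) / m.πAC))) x := by
  have h1 := m.denom_pos
  have h2 := m.πAC_pos
  have h3 := m.zB_mem.1
  have hxz : 0 < x / m.zB := div_pos hx h3
  have := (((hasDerivAt_id x).div_const m.zB).rpow_const (p := (m.πAC + 1) / m.πAC)
    (Or.inl hxz.ne')).const_mul (m.πAC * m.zB / (m.πAC + 1 - m.zB))
  refine this.congr_deriv ?_
  simp only [id]
  rw [Real.rpow_sub_one hxz.ne']
  field_simp

/-- With z_A' = λ_A z_A and z_C' = λ_C z_C, this is dz_A/dz_C = (λ_A/λ_C) z_A/z_C. The power branch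
(no immediate concession by B) and the linear branch agree at `zB` in value and in derivative. -/
lemma hasDerivAt_zeta {x : ℝ} (hx : 0 < x) :
    HasDerivAt m.zeta ((m.πAC + 1) / (x * (m.πAC + gAG x m.zB)) * m.zeta x) x := by
  have h1 := m.denom_pos
  have h2 := m.πAC_pos
  have h3 := m.zB_mem.1
  have hlin : ∀ y, m.zB ≤ y → m.zeta y = ((m.πAC + 1) * y - m.zB) / (m.πAC + 1 - m.zB) :=
    fun y hy => if_pos hy
  have hpow : ∀ y, y < m.zB → m.zeta y = m.πAC * m.zB / (m.πAC + 1 - m.zB) *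
      (y / m.zB) ^ ((m.πAC + 1) / m.πAC) := fun y hy => if_neg hy.not_ge
  have hpow' : ∀ y, y ≤ m.zB → m.zeta y = m.πAC * m.zB / (m.πAC + 1 - m.zB) *
      (y / m.zB) ^ ((m.πAC + 1) / m.πAC) := by
    intro y hy
    rcases hy.eq_or_lt with rfl | hy
    · rw [hlin _ le_rfl, div_self h3.ne', Real.one_rpow]; ring
    · exact hpow y hy
  have hd1 : m.zB ≤ x → (m.πAC + 1) / (m.πAC + 1 - m.zB) =
      (m.πAC + 1) / (x * (m.πAC + gAG x m.zB)) * m.zeta x := by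
    intro h
    rw [gAG_of_le hx h, hlin x h]
    have h4 : x * (m.πAC + (1 - m.zB / x)) = (m.πAC + 1) * x - m.zB := by field_simp; ring
    have h5 : 0 < (m.πAC + 1) * x - m.zB := by nlinarith
    rw [h4]
    field_simp
  have hd2 : x ≤ m.zB → (m.πAC + 1) / (x * m.πAC) * (m.πAC * m.zB / (m.πAC + 1 - m.zB) *
        (x / m.zB) ^ ((m.πAC + 1) / m.πAC)) =
      (m.πAC + 1) / (x * (m.πAC + gAG x m.zB)) * m.zeta x := by
    intro h
    rw [gAG_of_ge hx h, hpow' x h, add_zero]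
  rcases lt_trichotomy x m.zB with h | h | h
  · refine ((m.hasDerivAt_power hx).congr_deriv (hd2 h.le)).congr_of_eventuallyEq ?_
    filter_upwards [Iio_mem_nhds h] with y hy using hpow y hy
  · have hl := (((m.hasDerivAt_power hx).congr_deriv (hd2 h.le)).hasDerivWithinAt
      (s := Iic x)).congr_of_mem (f₁ := m.zeta) (fun y hy => hpow' y (le_trans hy h.le)) self_mem_Iic
    have hr := (((m.hasDerivAt_linear x).congr_deriv (hd1 h.ge)).hasDerivWithinAt
      (s := Ici x)).congr_of_mem (f₁ := m.zeta) (fun y hy => hlin y (le_trans h.ge hy)) self_mem_Ici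
    have := hl.union hr
    rwa [Iic_union_Ici, hasDerivWithinAt_univ] at this
  · refine ((m.hasDerivAt_linear x).congr_deriv (hd1 h.le)).congr_of_eventuallyEq ?_
    filter_upwards [Ioi_mem_nhds h] with y hy using hlin y (le_of_lt hy)

lemma continuousOn_zeta : ContinuousOn m.zeta (Ioi 0) :=
  fun _ hx => (m.hasDerivAt_zeta hx).continuousAt.continuousWithinAt

lemma zeta_strictMonoOn : StrictMonoOn m.zeta (Ioi 0) := by
  refine strictMonoOn_of_deriv_pos (convex_Ioi 0) m.continuousOn_zeta fun x hx => ?_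
  rw [interior_Ioi] at hx
  rw [(m.hasDerivAt_zeta hx).deriv]
  have h1 := m.zeta_pos hx
  have h2 := m.πAC_pos
  have h3 : 0 ≤ gAG x m.zB := gAG_nonneg _ _
  have hx' : 0 < x := hx
  positivity

/-- Indifference hazard rate of `A` when `C` has reputation `x`. -/
def hazardA (x : ℝ) : ℝ := m.lam * ((m.πAC + 1) / (m.πAC + gAG x m.zB))

lemma hazardA_pos (x : ℝ) : 0 < m.hazardA x := by
  have h1 := m.lam_pos
  have h2 := m.πAC_pos
  have h3 : 0 ≤ gAG x m.zB := gAG_nonneg _ _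
  rw [hazardA]; positivity

lemma hasDerivAt_exp_path (x₀ t : ℝ) :
    HasDerivAt (fun t => x₀ * Real.exp (m.lam * t)) (m.lam * (x₀ * Real.exp (m.lam * t))) t := by
  have := (((hasDerivAt_id t).const_mul m.lam).exp).const_mul x₀
  refine this.congr_deriv ?_
  simp only [id]; ring

/-- A's survival probability is her prior over her reputation, so the reciprocal of `zeta` along C's
path must solve the survival equation with rate `hazardA`. -/
lemma hasDerivAt_inv_zeta {x₀ : ℝ} (hx : 0 < x₀) (t : ℝ) :
    HasDerivAt (fun t => (m.zeta (x₀ * Real.exp (m.lam * t)))⁻¹)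
      (-m.hazardA (x₀ * Real.exp (m.lam * t)) * (m.zeta (x₀ * Real.exp (m.lam * t)))⁻¹) t := by
  have hu : 0 < x₀ * Real.exp (m.lam * t) := by positivity
  have h1 := (m.zeta_pos hu).ne'
  have h2 : HasDerivAt (fun t => m.zeta (x₀ * Real.exp (m.lam * t))) _ t :=
    HasDerivAt.comp (h₂ := m.zeta) t (m.hasDerivAt_zeta hu) (m.hasDerivAt_exp_path x₀ t)
  refine (h2.fun_inv h1).congr_deriv ?_
  have h3 : 0 < m.πAC + gAG (x₀ * Real.exp (m.lam * t)) m.zB :=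
    add_pos_of_pos_of_nonneg m.πAC_pos (gAG_nonneg _ _)
  rw [hazardA]
  field_simp

/-- Duration of stage 1 when `C` has reputation `x` right after time `0`. -/
def termTime (x : ℝ) : ℝ := -(1 / m.lam) * Real.log x

/-- Reputation of `C` at time `t`. -/
def repPath (x t : ℝ) : ℝ := x * Real.exp (m.lam * min t (m.termTime x))

lemma lam_mul_termTime (x : ℝ) : m.lam * m.termTime x = -Real.log x := by
  have := m.lam_pos.ne'
  rw [termTime]; field_simp

lemma mul_exp_termTime {x : ℝ} (hx : 0 < x) : x * Real.exp (m.lam * m.termTime x) = 1 := by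
  rw [m.lam_mul_termTime, Real.exp_neg, Real.exp_log hx, mul_inv_cancel₀ hx.ne']

lemma termTime_nonneg {x : ℝ} (hx : x ∈ Ioc (0 : ℝ) 1) : 0 ≤ m.termTime x := by
  have h1 := m.lam_mul_termTime x
  have h2 := Real.log_nonpos hx.1.le hx.2
  have h3 := m.lam_pos
  by_contra! h
  nlinarith

lemma termTime_pos {x : ℝ} (hx : x ∈ Ioo (0 : ℝ) 1) : 0 < m.termTime x := by
  have h1 := m.lam_mul_termTime x
  have h2 := Real.log_neg hx.1 hx.2
  have h3 := m.lam_pos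
  by_contra! h
  nlinarith

lemma repPath_of_le {x t : ℝ} (ht : t ≤ m.termTime x) :
    m.repPath x t = x * Real.exp (m.lam * t) := by
  rw [repPath, min_eq_left ht]

lemma repPath_of_ge {x t : ℝ} (hx : 0 < x) (ht : m.termTime x ≤ t) : m.repPath x t = 1 := by
  rw [repPath, min_eq_right ht, m.mul_exp_termTime hx]

lemma repPath_zero {x : ℝ} (hx : x ∈ Ioc (0 : ℝ) 1) : m.repPath x 0 = x := by
  rw [m.repPath_of_le (m.termTime_nonneg hx)]; simp

lemma repPath_pos {x : ℝ} (hx : 0 < x) (t : ℝ) : 0 < m.repPath x t := by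
  rw [repPath]; positivity

/-- `x` is the reputation of `C` right after the concessions at time `0`. -/
def IsStart (x : ℝ) : Prop :=
  m.zC ≤ x ∧ x < 1 ∧ m.zA ≤ m.zeta x ∧ (x = m.zC ∨ m.zeta x = m.zA)

variable {m}

lemma IsStart.pos {x : ℝ} (h : m.IsStart x) : 0 < x := m.zC_mem.1.trans_le h.1

lemma IsStart.mem {x : ℝ} (h : m.IsStart x) : x ∈ Ioo (0 : ℝ) 1 := ⟨h.pos, h.2.1⟩

/-- An atom can only raise a reputation, and only one player has one: if A's prior lies below the
curve she is lifted to it, otherwise C is moved up until the curve reaches A's prior. -/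
lemma IsStart.zeta_eq {x : ℝ} (h : m.IsStart x) : m.zeta x = max m.zA m.zBarA := by
  rw [zBarA_eq]
  obtain ⟨h1, h2, h3, rfl | h4⟩ := id h
  · rw [max_eq_right h3]
  · rw [max_eq_left, h4]
    rw [← h4]
    exact m.zeta_strictMonoOn.monotoneOn m.zC_mem.1 h.pos h1

lemma IsStart.unique {x y : ℝ} (hx : m.IsStart x) (hy : m.IsStart y) : x = y :=
  m.zeta_strictMonoOn.injOn hx.pos hy.pos (hx.zeta_eq.trans hy.zeta_eq.symm)

variable (m) in
lemma exists_isStart : ∃ x, m.IsStart x := by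
  rcases le_or_gt m.zA (m.zeta m.zC) with h | h
  · exact ⟨m.zC, le_rfl, m.zC_mem.2, h, Or.inl rfl⟩
  -- A's prior exceeds the curve at `zC` but is less than `zeta 1 = 1`, so the curve attains it in
  -- between.
  · have hc : ContinuousOn m.zeta (Icc m.zC 1) :=
      m.continuousOn_zeta.mono fun x hx => m.zC_mem.1.trans_le hx.1
    obtain ⟨x, hx, hxe⟩ := intermediate_value_Icc m.zC_mem.2.le hc
      (show m.zA ∈ Icc (m.zeta m.zC) (m.zeta 1) from ⟨h.le, by rw [m.zeta_one]; exact m.zA_mem.2.le⟩)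
    refine ⟨x, hx.1, lt_of_le_of_ne hx.2 ?_, hxe.ge, Or.inr hxe⟩
    rintro rfl
    rw [m.zeta_one] at hxe
    exact absurd hxe m.zA_mem.2.ne'

lemma continuousAt_gAG {x y : ℝ} (hx : 0 < x) : ContinuousAt (fun x => gAG x y) x := by
  have h : ContinuousAt (fun x => max (1 - y / x) 0) x :=
    (continuousAt_const.sub (continuousAt_const.div continuousAt_id hx.ne')).max continuousAt_const
  exact h

lemma contestC_hazard {σ : Assessment} {y : ℝ≥0∞} {x : ℝ} (hy : m.atomB σ y = gAG x m.zB) :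
    (m.contestC σ).r * (m.contestC σ).L / ((m.contestC σ).W y - (m.contestC σ).L) = m.hazardA x := by
  have h0 : 0 < 2 * m.α - 1 := by linarith [m.half_lt_α]
  have h3 : 0 < m.πAC + gAG x m.zB := add_pos_of_pos_of_nonneg m.πAC_pos (gAG_nonneg _ _)
  have h4 : (m.contestC σ).W y - (m.contestC σ).L = (2 * m.α - 1) * (m.πAC + gAG x m.zB) := by
    simp only [contestC_W, contestC_L, contValue, hy]; ring
  rw [h4, contestC_r, contestC_L, hazardA, lam]
  field_simp

lemma contestC_continuousAt {σ : Assessment} {x₀ t : ℝ} (hx : 0 < x₀)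
    (h : ∀ᶠ s in 𝓝 t, m.atomB σ (ENNReal.ofReal s) = gAG (x₀ * Real.exp (m.lam * s)) m.zB) :
    ContinuousAt (fun s => (m.contestC σ).W (ENNReal.ofReal s)) t := by
  have h1 : ContinuousAt (fun s => gAG (x₀ * Real.exp (m.lam * s)) m.zB) t :=
    ContinuousAt.comp (g := fun x => gAG x m.zB) (continuousAt_gAG (by positivity)) (by fun_prop)
  have h2 : ContinuousAt (fun s => m.atomB σ (ENNReal.ofReal s)) t := h1.congr (h.mono fun _ e => e.symm)
  simp only [contestC_W, contValue]
  fun_prop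

namespace IsPBE

variable {σ : Assessment} (h : m.IsPBE σ)
include h

/-- Stage-1 concessions in a PBE. -/
theorem stage1 : ∃ x, m.IsStart x ∧
    (∀ t, 0 ≤ t → surv (typeMix m.zC σ.planC) t = m.zC / m.repPath x t) ∧
    ∀ t, 0 ≤ t → surv (typeMix m.zA σ.planA) t = m.zA / m.zeta (m.repPath x t) := by
  have hpA := isProbabilityMeasure_typeMix (μ := σ.planA) m.zA_mem.1.le m.zA_mem.2.le
  have hpC := isProbabilityMeasure_typeMix (μ := σ.planC) m.zC_mem.1.le m.zC_mem.2.le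
  obtain ⟨haC, haA, hor, -, T, hT, hTC, hTA, hdC, hdA⟩ :=
    Contest.Optimal.equilibrium m.zC_mem m.zA_mem h.optimalC h.optimalA
  have hsC : ∀ t : ℝ, 0 ≤ t → _ := fun t ht => surv_eq_exp (l := m.lam) hT haC hTC (fun t ht => by
    have := hdC t ht continuousAt_const
    rwa [m.war_hazard] at this) (t := t) ht
  set s := surv (typeMix m.zC σ.planC) 0 with hs
  have hsT := hsC T hT.le
  rw [hTC T le_rfl, min_self] at hsT
  have hs0 : 0 < s := by
    have := m.zC_mem.1
    rw [hsT] at this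
    exact pos_of_mul_pos_left this (Real.exp_pos _).le
  -- C's reputation just after the concessions at time 0.
  set x := m.zC / s with hx
  have hx0 : 0 < x := div_pos m.zC_mem.1 hs0
  have hxs : s = m.zC / x := by have := m.zC_mem.1.ne'; rw [hx]; field_simp
  have hTx : T = m.termTime x := by
    rw [termTime, hx, hsT, mul_div_cancel_left₀ _ hs0.ne', Real.log_exp]
    have := m.lam_pos.ne'
    field_simp
  have hC : ∀ t, 0 ≤ t → surv (typeMix m.zC σ.planC) t = m.zC / m.repPath x t := by
    intro t ht
    rw [hsC t ht, repPath, hTx, hxs, neg_mul, Real.exp_neg]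
    field_simp
  -- A's prize is constant, so A's indifference has already fixed C's path. Only now is B's atom
  -- known to be continuous in time, as needed to derive A's hazard rate from C's indifference.
  have hrep : ∀ t ∈ Ioo 0 T, m.atomB σ (ENNReal.ofReal t) =
      gAG (x * Real.exp (m.lam * t)) m.zB := by
    intro t ht
    have h1 := h.atomB_eq_gAG t.toNNReal
    rw [Real.coe_toNNReal _ ht.1.le, reputation_FC _ ht.1.le, hC t ht.1.le,
      m.repPath_of_le (hTx ▸ ht.2.le), div_div_cancel₀ m.zC_mem.1.ne'] at h1
    exact h1
  have hA' : ∀ t ∈ Ioo 0 T, HasDerivAt (surv (typeMix m.zA σ.planA))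
      (-m.hazardA (x * Real.exp (m.lam * t)) * surv (typeMix m.zA σ.planA) t) t := by
    intro t ht
    have h1 := hdA t ht (contestC_continuousAt hx0 (by
      filter_upwards [Ioo_mem_nhds ht.1 ht.2] with s hs using hrep s hs))
    rwa [contestC_hazard (hrep t ht)] at h1
  have hzp : ∀ t, 0 < m.zeta (x * Real.exp (m.lam * t)) := fun t => m.zeta_pos (by positivity)
  have hA1 : ∀ t ∈ Icc 0 T, surv (typeMix m.zA σ.planA) t =
      surv (typeMix m.zA σ.planA) 0 * m.zeta x / m.zeta (x * Real.exp (m.lam * t)) := by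
    intro t ht
    have h1 := Contest.surv_mul_eq (R := fun t => (m.zeta (x * Real.exp (m.lam * t)))⁻¹) haA hA'
      (fun t _ => (m.hasDerivAt_inv_zeta hx0 t).continuousAt.continuousWithinAt)
      (fun t _ => inv_ne_zero (hzp t).ne') (fun t _ => m.hasDerivAt_inv_zeta hx0 t) ht
    simp only [div_inv_eq_mul, mul_zero, Real.exp_zero, mul_one] at h1
    rw [← h1, mul_div_cancel_right₀ _ (hzp t).ne']
  -- At T the path ends at (1, 1), so A's survival at 0 times `zeta x` equals `zA`: her reputation
  -- after time 0 lies on the curve.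
  have hAT := hA1 T ⟨hT.le, le_rfl⟩
  rw [hTA T le_rfl, hTx, m.mul_exp_termTime hx0, m.zeta_one, div_one] at hAT
  have hA : ∀ t, 0 ≤ t → surv (typeMix m.zA σ.planA) t = m.zA / m.zeta (m.repPath x t) := by
    intro t ht
    rcases le_total t T with h1 | h1
    · rw [hA1 t ⟨ht, h1⟩, m.repPath_of_le (hTx ▸ h1), ← hAT]
    · rw [hTA t h1, m.repPath_of_ge hx0 (hTx ▸ h1), m.zeta_one, div_one]
  have hx1 : x < 1 := by
    by_contra! h1
    have h2 := m.lam_mul_termTime x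
    rw [← hTx] at h2
    have := Real.log_nonneg h1
    nlinarith [m.lam_pos]
  refine ⟨x, ⟨?_, hx1, ?_, ?_⟩, hC, hA⟩
  · rw [hx, le_div_iff₀ hs0]
    have h1 : s ≤ 1 := surv_le_one _ _
    nlinarith [m.zC_mem.1]
  · have h1 := surv_le_one (typeMix m.zA σ.planA) 0
    have h2 := m.zeta_pos hx0
    nlinarith
  · rcases hor with h1 | h1
    · left; rw [hx, h1, div_one]
    · right; rw [h1, one_mul] at hAT; exact hAT.symm

end IsPBE

end SeqGame

/-! ### Sufficiency: indifference hazard rates make plans optimal. -/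

lemma measure_singleton_of_continuousOn_surv {ν : Measure ℝ≥0∞} [IsFiniteMeasure ν]
    (h : ContinuousOn (surv ν) (Ici 0)) {x : ℝ≥0∞} (h0 : x ≠ 0) (ht : x ≠ ⊤) : ν {x} = 0 := by
  set t := x.toReal with hxt
  have ht0 : 0 < t := ENNReal.toReal_pos h0 ht
  have hx : x = ENNReal.ofReal t := (ENNReal.ofReal_toReal ht).symm
  have hc : ContinuousAt (surv ν) t := h.continuousAt (Ici_mem_nhds ht0)
  have hlim : Tendsto (fun s => surv ν s - surv ν t) (𝓝[<] t) (𝓝 (surv ν t - surv ν t)) :=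
    (hc.tendsto.mono_left nhdsWithin_le_nhds).sub_const _
  rw [sub_self] at hlim
  have hle : ν.real {x} ≤ 0 := by
    refine ge_of_tendsto hlim ?_
    filter_upwards [self_mem_nhdsWithin] with s hs
    rw [surv_sub_surv ν (le_of_lt hs)]
    refine measureReal_mono (singleton_subset_iff.2 ?_)
    rw [hx]
    exact ⟨(ENNReal.ofReal_lt_ofReal_iff ht0).2 hs, le_rfl⟩
  exact (measureReal_eq_zero_iff).1 (le_antisymm hle measureReal_nonneg)

/-- If only times up to `T` are used and at most one player concedes at time `0`, the indifference
hazard rate of the opponent makes a plan optimal. -/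
lemma Contest.optimal_of_hazard {w : Contest} {z₁ z₂ T : ℝ} {μ₁ μ₂ : Measure ℝ≥0∞}
    [IsProbabilityMeasure μ₁] [IsProbabilityMeasure μ₂] (hz₁ : z₁ ∈ Ioc (0 : ℝ) 1)
    (hz₂ : z₂ ∈ Ioc (0 : ℝ) 1) (hT : 0 ≤ T) (hc : ContinuousOn (surv (typeMix z₂ μ₂)) (Ici 0))
    (hT₁ : surv (typeMix z₁ μ₁) T = z₁) (hT₂ : surv (typeMix z₂ μ₂) T = z₂)
    (hor : surv (typeMix z₁ μ₁) 0 = 1 ∨ surv (typeMix z₂ μ₂) 0 = 1)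
    (hW : ∀ t ∈ Ioo 0 T, ContinuousAt (fun t => w.W (ENNReal.ofReal t)) t)
    (hS : ∀ t ∈ Ioo 0 T, HasDerivAt (surv (typeMix z₂ μ₂))
      (-(w.r * w.L / (w.W (ENNReal.ofReal t) - w.L)) * surv (typeMix z₂ μ₂) t) t) :
    (∀ x, w.value (typeMix z₂ μ₂) x ≤ w.valueRight (typeMix z₂ μ₂) 0) ∧
      (z₁ < 1 → ∀ᵐ x ∂μ₁, w.value (typeMix z₂ μ₂) x = w.valueRight (typeMix z₂ μ₂) 0) := by
  have hp₁ := isProbabilityMeasure_typeMix (μ := μ₁) hz₁.1.le hz₁.2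
  have hp₂ := isProbabilityMeasure_typeMix (μ := μ₂) hz₂.1.le hz₂.2
  have htail : typeMix z₂ μ₂ (Ioo (ENNReal.ofReal T) ⊤) = 0 := by
    rw [surv_typeMix hz₂.1.le hz₂.2] at hT₂
    have h1 : (1 - z₂) * μ₂.real (Ioo (ENNReal.ofReal T) ⊤) ≤ 0 := by
      have h2 : μ₂.real (Ioo (ENNReal.ofReal T) ⊤) ≤ μ₂.real (Ioi (ENNReal.ofReal T)) :=
        measureReal_mono Ioo_subset_Ioi_self
      nlinarith [hz₂.2]
    rw [← typeMix_real_of_notMem hz₂.1.le hz₂.2 (by simp)] at h1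
    exact (measureReal_eq_zero_iff).1 (le_antisymm h1 measureReal_nonneg)
  obtain ⟨h1, h2⟩ := Contest.value_of_hazard hT
    (fun x h0 ht => measure_singleton_of_continuousOn_surv hc h0 ht) htail hW hS
  refine ⟨h1, fun hlt => ?_⟩
  have h3 : ∀ᵐ x ∂μ₁, x ≤ ENNReal.ofReal T := by
    rw [surv_typeMix hz₁.1.le hz₁.2] at hT₁
    have h4 : μ₁.real (Ioi (ENNReal.ofReal T)) = 0 := by
      have : (1 - z₁) * μ₁.real (Ioi (ENNReal.ofReal T)) = 0 := by linarith
      exact (mul_eq_zero.1 this).resolve_left (sub_pos.2 hlt).ne'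
    rw [ae_iff]
    simp only [not_le]
    exact (measureReal_eq_zero_iff).1 h4
  have zero_of : ∀ {ν : Measure ℝ≥0∞} [IsProbabilityMeasure ν], surv ν 0 = 1 → ν {0} = 0 := by
    intro ν _ h
    have e := real_singleton_zero_add_surv ν
    rw [h] at e
    exact (measureReal_eq_zero_iff).1 (by linarith)
  -- Time 0 attains the value if the opponent has no atom there. Otherwise the first alternative
  -- says that μ₁ does not use time 0.
  rcases hor with h | h
  · have h5 : μ₁ {0} = 0 := by
      have := zero_of h
      rw [typeMix_of_notMem (by simp)] at this
      exact (mul_eq_zero.1 this).resolve_left (by simp [hlt])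
    rw [← compl_mem_ae_iff] at h5
    filter_upwards [h3, h5] with x hx hx0
    exact h2 x hx fun e => absurd e hx0
  · filter_upwards [h3] with x hx
    exact h2 x hx fun _ => zero_of h

/-! ### Plans with prescribed survival functions. -/

section Plans

/-- A survival function on `[0, ∞)` that ends at the prior probability `z` of the behavioral
type. -/
structure IsSurvival (z : ℝ) (S : ℝ → ℝ) : Prop where
  lt_one : z < 1
  continuousOn : ContinuousOn S (Ici 0)
  antitoneOn : AntitoneOn S (Ici 0)
  zero_le_one : S 0 ≤ 1
  eventually_eq : ∀ᶠ t in atTop, S t = z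

/-- Distribution function of the concession time of the rational type. -/
def planFun (z : ℝ) (S : ℝ → ℝ) (t : ℝ) : ℝ := if t < 0 then 0 else (1 - S t) / (1 - z)

lemma IsSurvival.planFun_monotone {z : ℝ} {S : ℝ → ℝ} (h : IsSurvival z S) :
    Monotone (planFun z S) := by
  intro s t hst
  have h1 : 0 < 1 - z := sub_pos.2 h.lt_one
  unfold planFun
  split_ifs with hs ht ht
  · exact le_rfl
  · have h2 := h.antitoneOn self_mem_Ici (not_lt.1 ht) (not_lt.1 ht)
    exact div_nonneg (by linarith [h.zero_le_one]) h1.le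
  · exact absurd (hst.trans_lt ht) hs
  · have h2 := h.antitoneOn (not_lt.1 hs) (not_lt.1 ht) hst
    gcongr

lemma IsSurvival.planFun_rightCts {z : ℝ} {S : ℝ → ℝ} (h : IsSurvival z S) (t : ℝ) :
    ContinuousWithinAt (planFun z S) (Ici t) t := by
  rcases lt_or_ge t 0 with ht | ht
  · refine (continuousAt_const (y := (0 : ℝ))).congr ?_ |>.continuousWithinAt
    filter_upwards [Iio_mem_nhds ht] with s hs
    exact (if_pos hs).symm
  · have h1 : ContinuousWithinAt (fun s => (1 - S s) / (1 - z)) (Ici t) t :=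
      ((continuousWithinAt_const.sub ((h.continuousOn t ht).mono (Ici_subset_Ici.2 ht))).div_const _)
    exact h1.congr (fun s hs => if_neg (not_lt.2 (ht.trans hs))) (if_neg (not_lt.2 ht))

/-- Stieltjes function of the plan with a given survival function. -/
def IsSurvival.stieltjes {z : ℝ} {S : ℝ → ℝ} (h : IsSurvival z S) : StieltjesFunction ℝ where
  toFun := planFun z S
  mono' := h.planFun_monotone
  right_continuous' := h.planFun_rightCts

lemma IsSurvival.tendsto_atBot {z : ℝ} {S : ℝ → ℝ} (h : IsSurvival z S) :
    Tendsto h.stieltjes atBot (𝓝 0) := by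
  refine tendsto_const_nhds.congr' ?_
  filter_upwards [eventually_lt_atBot 0] with t ht
  exact (if_pos ht).symm

lemma IsSurvival.tendsto_atTop {z : ℝ} {S : ℝ → ℝ} (h : IsSurvival z S) :
    Tendsto h.stieltjes atTop (𝓝 1) := by
  refine tendsto_const_nhds.congr' ?_
  filter_upwards [eventually_ge_atTop 0, h.eventually_eq] with t ht hz
  have : planFun z S t = 1 := by
    rw [planFun, if_neg (not_lt.2 ht), hz, div_self (sub_pos.2 h.lt_one).ne']
  exact this.symm

/-- The plan with a given survival function. -/
def IsSurvival.plan {z : ℝ} {S : ℝ → ℝ} (h : IsSurvival z S) : Measure ℝ≥0∞ :=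
  h.stieltjes.measure.map ENNReal.ofReal

instance IsSurvival.isProbabilityMeasure_plan {z : ℝ} {S : ℝ → ℝ} (h : IsSurvival z S) :
    IsProbabilityMeasure h.plan := by
  have := h.stieltjes.isProbabilityMeasure h.tendsto_atBot h.tendsto_atTop
  exact Measure.isProbabilityMeasure_map ENNReal.measurable_ofReal.aemeasurable

lemma IsSurvival.plan_Ioi {z : ℝ} {S : ℝ → ℝ} (h : IsSurvival z S) {t : ℝ} (ht : 0 ≤ t) :
    h.plan (Ioi (ENNReal.ofReal t)) = ENNReal.ofReal ((S t - z) / (1 - z)) := by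
  have hpre : ENNReal.ofReal ⁻¹' Ioi (ENNReal.ofReal t) = Ioi t := by
    ext s
    simp only [mem_preimage, mem_Ioi]
    constructor
    · intro hs
      by_contra! hst
      exact absurd (ENNReal.ofReal_le_ofReal hst) (not_le.2 hs)
    · intro hs
      exact (ENNReal.ofReal_lt_ofReal_iff (ht.trans_lt hs)).2 hs
  rw [IsSurvival.plan, Measure.map_apply ENNReal.measurable_ofReal measurableSet_Ioi, hpre,
    h.stieltjes.measure_Ioi h.tendsto_atTop]
  congr 1
  have h1 : (1 - z) ≠ 0 := (sub_pos.2 h.lt_one).ne'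
  change 1 - planFun z S t = _
  rw [planFun, if_neg (not_lt.2 ht)]
  field_simp
  ring

lemma IsSurvival.le {z : ℝ} {S : ℝ → ℝ} (h : IsSurvival z S) {t : ℝ} (ht : 0 ≤ t) : z ≤ S t := by
  obtain ⟨s, hs, hts⟩ := (h.eventually_eq.and (eventually_ge_atTop t)).exists
  rw [← hs]
  exact h.antitoneOn ht (ht.trans hts) hts

lemma IsSurvival.surv_plan {z : ℝ} {S : ℝ → ℝ} (h : IsSurvival z S) (hz : 0 ≤ z) {t : ℝ}
    (ht : 0 ≤ t) : surv (typeMix z h.plan) t = S t := by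
  have h1 : (1 - z) ≠ 0 := (sub_pos.2 h.lt_one).ne'
  rw [surv_typeMix hz h.lt_one.le, measureReal_def, h.plan_Ioi ht, ENNReal.toReal_ofReal]
  · field_simp; ring
  · exact div_nonneg (sub_nonneg.2 (h.le ht)) (sub_pos.2 h.lt_one).le

end Plans

/-! ### Regularity of the constructed distributions. -/

section Regular

/-- A continuously differentiable function frozen from time `T` on is regular. -/
lemma isRegularCdf_of_hasDerivAt {F G G' : ℝ → ℝ} {T : ℝ} (hT : 0 < T)
    (hG : ∀ t, HasDerivAt G (G' t) t) (hG' : Continuous G')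
    (hF : ∀ t, 0 < t → F t = G (min t T)) : IsRegularCdf F := by
  have hlt : ∀ t, 0 < t → t < T → F =ᶠ[𝓝 t] G := by
    intro t h0 h1
    filter_upwards [Ioo_mem_nhds h0 h1] with s hs
    rw [hF s hs.1, min_eq_left hs.2.le]
  have hgt : ∀ t, T < t → F =ᶠ[𝓝 t] fun _ => G T := by
    intro t h1
    filter_upwards [Ioi_mem_nhds h1] with s hs
    rw [hF s (hT.trans hs), min_eq_right (le_of_lt hs)]
  have dlt : ∀ t, 0 < t → t < T → deriv F t = G' t := fun t h0 h1 => by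
    rw [(hlt t h0 h1).deriv_eq, (hG t).deriv]
  have dgt : ∀ t, T < t → deriv F t = 0 := fun t h1 => by
    rw [(hgt t h1).deriv_eq, deriv_const]
  refine ⟨fun a b ha hab => ?_, {T}, fun _ _ _ => (finite_singleton T).inter_of_left _, ?_, ?_⟩
  -- On [a, b] the function F is G composed with min(·, T). A derivative bounded on [0, T] makes it
  -- Lipschitz, hence absolutely continuous across the kink at T.
  · obtain ⟨K, hK⟩ := (isCompact_Icc (a := (0 : ℝ)) (b := T)).exists_bound_of_continuousOn
      hG'.continuousOn
    have hlip : LipschitzOnWith K.toNNReal G (Icc 0 T) :=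
      (convex_Icc 0 T).lipschitzOnWith_of_nnnorm_hasDerivWithin_le
        (fun t _ => (hG t).hasDerivWithinAt) fun t ht => by
          rw [← NNReal.coe_le_coe, coe_nnnorm]
          exact (hK t ht).trans (Real.le_coe_toNNReal K)
    have hmin : LipschitzOnWith 1 (fun t : ℝ => min t T) (uIcc a b) := by
      refine LipschitzWith.lipschitzOnWith ?_
      exact (LipschitzWith.id.min_const T)
    have hmaps : MapsTo (fun t : ℝ => min t T) (uIcc a b) (Icc 0 T) := by
      intro t ht
      rw [uIcc_of_le hab] at ht
      exact ⟨le_min (ha.le.trans ht.1) hT.le, min_le_right _ _⟩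
    have hcomp : LipschitzOnWith (K.toNNReal * 1) F (uIcc a b) := by
      intro s hs t ht
      have hs' := hs; have ht' := ht
      rw [uIcc_of_le hab] at hs' ht'
      have := hlip.comp hmin hmaps hs ht
      simp only [Function.comp] at this
      rwa [← hF s (ha.trans_le hs'.1), ← hF t (ha.trans_le ht'.1)] at this
    exact hcomp.absolutelyContinuousOnInterval
  · intro t h0 hD
    rcases lt_or_gt_of_ne (mem_singleton_iff.not.1 hD) with h1 | h1
    · refine ⟨((hG t).differentiableAt).congr_of_eventuallyEq (hlt t h0 h1), ?_⟩
      refine (hG'.continuousAt (x := t)).congr ?_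
      filter_upwards [Ioo_mem_nhds h0 h1] with s hs using (dlt s hs.1 hs.2).symm
    · refine ⟨(differentiableAt_const (G T)).congr_of_eventuallyEq (hgt t h1), ?_⟩
      refine (continuousAt_const (y := (0 : ℝ))).congr ?_
      filter_upwards [Ioi_mem_nhds h1] with s hs using (dgt s hs).symm
  · rintro t rfl -
    refine ⟨⟨G' t, ?_⟩, ⟨0, ?_⟩⟩
    · refine ((hG'.tendsto t).mono_left nhdsWithin_le_nhds).congr' ?_
      filter_upwards [Ioo_mem_nhdsLT hT] with s hs using (dlt s hs.1 hs.2).symm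
    · refine tendsto_const_nhds.congr' ?_
      filter_upwards [self_mem_nhdsWithin] with s hs using (dgt s hs).symm

end Regular

/-! ### Existence of the bilateral equilibrium. -/

section AG

variable {l z₁ z₂ : ℝ}

/-- Terminal time of the bilateral war of attrition. -/
def agTime (l z₁ z₂ : ℝ) : ℝ := min (-(1 / l) * Real.log z₁) (-(1 / l) * Real.log z₂)

lemma exp_agTime (hl : 0 < l) (h₁ : 0 < z₁) (h₂ : 0 < z₂) :
    (1 - gAG z₂ z₁) * Real.exp (-l * agTime l z₁ z₂) = z₁ := by
  have hl' : 0 < 1 / l := by positivity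
  have key : ∀ z : ℝ, 0 < z → Real.exp (-l * (-(1 / l) * Real.log z)) = z := by
    intro z hz
    rw [show -l * (-(1 / l) * Real.log z) = Real.log z by field_simp, Real.exp_log hz]
  rcases le_total z₁ z₂ with h | h
  · have := Real.log_le_log h₁ h
    rw [SeqGame.gAG_of_le h₂ h, agTime, min_eq_right (by nlinarith), key z₂ h₂]
    field_simp
    ring
  · have := Real.log_le_log h₂ h
    rw [SeqGame.gAG_of_ge h₂ h, agTime, min_eq_left (by nlinarith), key z₁ h₁]
    ring

lemma gAG_lt_one (h₁ : 0 < z₁) (h₂ : 0 < z₂) : gAG z₂ z₁ < 1 := by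
  rw [gAG, max_lt_iff]
  exact ⟨by linarith [div_pos h₁ h₂], one_pos⟩

lemma gAG_or (h₁ : 0 < z₁) (h₂ : 0 < z₂) : gAG z₂ z₁ = 0 ∨ gAG z₁ z₂ = 0 := by
  rcases le_total z₁ z₂ with h | h
  · exact Or.inr (SeqGame.gAG_of_ge h₁ h)
  · exact Or.inl (SeqGame.gAG_of_ge h₂ h)

lemma continuousOn_agSurvival (l z₁ z₂ : ℝ) : ContinuousOn
    (fun t => (1 - gAG z₂ z₁) * Real.exp (-l * min t (agTime l z₁ z₂))) (Ici 0) := by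
  fun_prop

lemma isSurvival_ag (hl : 0 < l) (h₁ : z₁ ∈ Ioo (0 : ℝ) 1) (h₂ : z₂ ∈ Ioc (0 : ℝ) 1) :
    IsSurvival z₁ (fun t => (1 - gAG z₂ z₁) * Real.exp (-l * min t (agTime l z₁ z₂))) where
  lt_one := h₁.2
  continuousOn := continuousOn_agSurvival l z₁ z₂
  antitoneOn := fun s _ t _ hst => by
    have : 0 ≤ 1 - gAG z₂ z₁ := sub_nonneg.2 (gAG_lt_one h₁.1 h₂.1).le
    have h3 : min s (agTime l z₁ z₂) ≤ min t (agTime l z₁ z₂) := min_le_min_right _ hst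
    have h4 : -l * min t (agTime l z₁ z₂) ≤ -l * min s (agTime l z₁ z₂) := by nlinarith
    have := Real.exp_le_exp.2 h4
    dsimp only
    gcongr
  zero_le_one := by
    have h3 : 0 ≤ agTime l z₁ z₂ := SeqGame.min_log_nonneg hl (Ioo_subset_Ioc_self h₁) h₂
    rw [min_eq_left h3]
    have := SeqGame.gAG_nonneg z₂ z₁
    simpa using this
  eventually_eq := by
    filter_upwards [eventually_ge_atTop (agTime l z₁ z₂)] with t ht
    rw [min_eq_right ht, exp_agTime hl h₁.1 h₂.1]

open Classical in
/-- Equilibrium plan of a player of reputation `z₁` against one of reputation `z₂`. -/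
def agPlan (l z₁ z₂ : ℝ) : Measure ℝ≥0∞ :=
  if h : IsSurvival z₁ (fun t => (1 - gAG z₂ z₁) * Real.exp (-l * min t (agTime l z₁ z₂))) then
    h.plan else Measure.dirac 0

instance : IsProbabilityMeasure (agPlan l z₁ z₂) := by
  unfold agPlan; split_ifs <;> infer_instance

lemma surv_agPlan (hl : 0 < l) (h₁ : z₁ ∈ Ioc (0 : ℝ) 1) (h₂ : z₂ ∈ Ioc (0 : ℝ) 1) {t : ℝ}
    (ht : 0 ≤ t) : surv (typeMix z₁ (agPlan l z₁ z₂)) t =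
      (1 - gAG z₂ z₁) * Real.exp (-l * min t (agTime l z₁ z₂)) := by
  rcases h₁.2.eq_or_lt with rfl | h
  · have h3 : agTime l 1 z₂ = 0 :=
      le_antisymm ((min_le_left _ _).trans (by simp)) (SeqGame.min_log_nonneg hl h₁ h₂)
    rw [surv_typeMix zero_le_one le_rfl, h3, min_eq_right ht, SeqGame.gAG_of_ge h₂.1 h₂.2]
    simp
  · have hs := isSurvival_ag hl ⟨h₁.1, h⟩ h₂
    rw [agPlan, dif_pos hs, hs.surv_plan h₁.1.le ht]

/-- One formula covers z₁ = 1 too: the default plan `Measure.dirac 0` has no mass above t, and the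
quotient by 1 - z₁ = 0 is 0. Measurability in the reputations rests on this. -/
lemma agPlan_Ioi (hl : 0 < l) (h₁ : z₁ ∈ Ioc (0 : ℝ) 1) (h₂ : z₂ ∈ Ioc (0 : ℝ) 1) {t : ℝ}
    (ht : 0 ≤ t) : agPlan l z₁ z₂ (Ioi (ENNReal.ofReal t)) = ENNReal.ofReal
      (((1 - gAG z₂ z₁) * Real.exp (-l * min t (agTime l z₁ z₂)) - z₁) / (1 - z₁)) := by
  rcases h₁.2.eq_or_lt with rfl | h
  · have hn : ¬ IsSurvival 1 (fun t => (1 - gAG z₂ 1) * Real.exp (-l * min t (agTime l 1 z₂))) :=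
      fun h => lt_irrefl _ h.lt_one
    rw [agPlan, dif_neg hn]
    simp
  · have hs := isSurvival_ag hl ⟨h₁.1, h⟩ h₂
    rw [agPlan, dif_pos hs, hs.plan_Ioi ht]

lemma measurable_agPlan {ι : Type*} [MeasurableSpace ι] (hl : 0 < l) {f g : ι → ℝ}
    (hf : Measurable f) (hg : Measurable g) (hf' : ∀ i, f i ∈ Ioc (0 : ℝ) 1)
    (hg' : ∀ i, g i ∈ Ioc (0 : ℝ) 1) : Measurable fun i => agPlan l (f i) (g i) := by
  refine .measure_of_isPiSystem_of_isProbabilityMeasure (borel_eq_generateFrom_Ioi ℝ≥0∞ ▸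
    BorelSpace.measurable_eq) isPiSystem_Ioi ?_
  rintro _ ⟨a, rfl⟩
  rcases eq_or_ne a ⊤ with rfl | ha
  · simp
  · rw [← ENNReal.ofReal_toReal ha]
    simp only [agPlan_Ioi hl (hf' _) (hg' _) ENNReal.toReal_nonneg]
    refine ENNReal.measurable_ofReal.comp ?_
    unfold gAG agTime
    fun_prop

/-- The rate `lam` is the indifference rate for both sides. Reputation 1 is admitted because C
reaches it at the end of stage 1; her default plan is then not claimed to be optimal. -/
lemma SeqGame.ag_optimal (m : SeqGame) (h₁ : z₁ ∈ Ioc (0 : ℝ) 1) (h₂ : z₂ ∈ Ioc (0 : ℝ) 1) :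
    (∀ x, (m.war 1 one_pos).value (typeMix z₂ (agPlan m.lam z₂ z₁)) x ≤
      (m.war 1 one_pos).valueRight (typeMix z₂ (agPlan m.lam z₂ z₁)) 0) ∧
    (z₁ < 1 → ∀ᵐ x ∂(agPlan m.lam z₁ z₂),
      (m.war 1 one_pos).value (typeMix z₂ (agPlan m.lam z₂ z₁)) x =
      (m.war 1 one_pos).valueRight (typeMix z₂ (agPlan m.lam z₂ z₁)) 0) := by
  have hT0 : 0 ≤ agTime m.lam z₁ z₂ := min_log_nonneg m.lam_pos h₁ h₂
  have hcomm : agTime m.lam z₂ z₁ = agTime m.lam z₁ z₂ := min_comm _ _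
  have hs₁ : ∀ t : ℝ, 0 ≤ t → _ := fun t ht => surv_agPlan m.lam_pos h₁ h₂ (t := t) ht
  have hs₂ : ∀ t : ℝ, 0 ≤ t → _ := fun t ht => surv_agPlan m.lam_pos h₂ h₁ (t := t) ht
  refine Contest.optimal_of_hazard h₁ h₂ hT0 ?_ ?_ ?_ ?_ (fun _ _ => continuousAt_const) ?_
  · exact ContinuousOn.congr (continuousOn_agSurvival m.lam z₂ z₁) fun t ht => hs₂ t ht
  · rw [hs₁ _ hT0, min_self, exp_agTime m.lam_pos h₁.1 h₂.1]
  · rw [hs₂ _ hT0, hcomm, min_self, ← hcomm, exp_agTime m.lam_pos h₂.1 h₁.1]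
  · rw [hs₁ 0 le_rfl, hs₂ 0 le_rfl, hcomm, min_eq_left hT0]
    rcases gAG_or h₁.1 h₂.1 with h | h
    · left; rw [h]; simp
    · right; rw [h]; simp
  · intro t ht
    have hev : surv (typeMix z₂ (agPlan m.lam z₂ z₁)) =ᶠ[𝓝 t]
        fun t => (1 - gAG z₁ z₂) * Real.exp (-m.lam * t) := by
      filter_upwards [Ioo_mem_nhds ht.1 ht.2] with s hs
      rw [hs₂ s hs.1.le, hcomm, min_eq_left hs.2.le]
    rw [m.war_hazard, hev.self_of_nhds]
    refine (((exp_lam_hasDerivAt m.lam t).const_mul (1 - gAG z₁ z₂)).congr_deriv ?_).congr_of_eventuallyEq hev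
    ring

end AG

/-! ### Construction and verification of the equilibrium. -/

namespace SeqGame

variable {m : SeqGame} {x : ℝ}

lemma continuous_repPath (x : ℝ) : Continuous (m.repPath x) := by
  unfold repPath; fun_prop

lemma repPath_monotone (hx : 0 < x) : Monotone (m.repPath x) := fun s t h => by
  have := m.lam_pos
  unfold repPath
  gcongr

lemma repPath_mem (hx : 0 < x) (t : ℝ) : m.repPath x t ∈ Ioc (0 : ℝ) 1 := by
  refine ⟨m.repPath_pos hx t, ?_⟩
  have h1 := repPath_monotone (m := m) hx (le_max_left t (m.termTime x))
  rwa [m.repPath_of_ge hx (le_max_right _ _)] at h1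

lemma IsStart.repPath_zero (hx : m.IsStart x) : m.repPath x 0 = x :=
  m.repPath_zero (Ioo_subset_Ioc_self hx.mem)

lemma IsStart.isSurvivalC (hx : m.IsStart x) :
    IsSurvival m.zC (fun t => m.zC / m.repPath x t) where
  lt_one := m.zC_mem.2
  continuousOn := (continuous_const.div (continuous_repPath x)
    fun t => (m.repPath_pos hx.pos t).ne').continuousOn
  antitoneOn := fun s _ t _ h => by
    have h1 := repPath_monotone (m := m) hx.pos h
    have h2 := m.repPath_pos hx.pos s
    have h3 := m.zC_mem.1
    dsimp only
    gcongr
  zero_le_one := by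
    rw [hx.repPath_zero, div_le_one hx.pos]; exact hx.1
  eventually_eq := by
    filter_upwards [eventually_ge_atTop (m.termTime x)] with t ht
    rw [m.repPath_of_ge hx.pos ht, div_one]

lemma IsStart.isSurvivalA (hx : m.IsStart x) :
    IsSurvival m.zA (fun t => m.zA / m.zeta (m.repPath x t)) where
  lt_one := m.zA_mem.2
  continuousOn := (continuous_const.div
    (m.continuousOn_zeta.comp_continuous (continuous_repPath x) (m.repPath_pos hx.pos))
    fun t => (m.zeta_pos (m.repPath_pos hx.pos t)).ne').continuousOn
  antitoneOn := fun s _ t _ h => by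
    have h1 := m.zeta_strictMonoOn.monotoneOn (m.repPath_pos hx.pos s) (m.repPath_pos hx.pos t)
      (repPath_monotone (m := m) hx.pos h)
    have h2 := m.zeta_pos (m.repPath_pos hx.pos s)
    have h3 := m.zA_mem.1
    dsimp only
    gcongr
  zero_le_one := by
    rw [hx.repPath_zero, div_le_one (m.zeta_pos hx.pos)]; exact hx.2.2.1
  eventually_eq := by
    filter_upwards [eventually_ge_atTop (m.termTime x)] with t ht
    rw [m.repPath_of_ge hx.pos ht, m.zeta_one, div_one]

lemma measurable_repPath_coe (x : ℝ) : Measurable fun τ : ℝ≥0 => m.repPath x τ :=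
  (continuous_repPath x).measurable.comp NNReal.continuous_coe.measurable

/-- Stage-2 plans of `B`: the bilateral equilibrium after a concession of `A`, no concession
after one of `C`. -/
def IsStart.planB₂ (hx : m.IsStart x) : Ending → Kernel ℝ≥0 ℝ≥0∞
  | Ending.byA => ⟨fun τ => agPlan m.lam m.zB (m.repPath x τ),
      measurable_agPlan m.lam_pos measurable_const (measurable_repPath_coe x)
        (fun _ => Ioo_subset_Ioc_self m.zB_mem) (fun τ => repPath_mem hx.pos τ)⟩
  | Ending.byC => Kernel.const ℝ≥0 (Measure.dirac ⊤)
  | Ending.both => Kernel.const ℝ≥0 (Measure.dirac ⊤)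

/-- Stage-2 plans of `C`: the bilateral equilibrium after a concession of `A`, an immediate
concession after one of her own. -/
def IsStart.planC₂ (hx : m.IsStart x) : Ending → Kernel ℝ≥0 ℝ≥0∞
  | Ending.byA => ⟨fun τ => agPlan m.lam (m.repPath x τ) m.zB,
      measurable_agPlan m.lam_pos (measurable_repPath_coe x) measurable_const
        (fun τ => repPath_mem hx.pos τ) (fun _ => Ioo_subset_Ioc_self m.zB_mem)⟩
  | Ending.byC => Kernel.const ℝ≥0 (Measure.dirac 0)
  | Ending.both => Kernel.const ℝ≥0 (Measure.dirac 0)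

lemma IsStart.planB₂_byA (hx : m.IsStart x) (τ : ℝ≥0) :
    hx.planB₂ Ending.byA τ = agPlan m.lam m.zB (m.repPath x τ) := rfl

lemma IsStart.planC₂_byA (hx : m.IsStart x) (τ : ℝ≥0) :
    hx.planC₂ Ending.byA τ = agPlan m.lam (m.repPath x τ) m.zB := rfl

lemma IsStart.planB₂_of_ne (hx : m.IsStart x) {e : Ending} (he : e ≠ Ending.byA) (τ : ℝ≥0) :
    hx.planB₂ e τ = Measure.dirac ⊤ := by
  cases e
  · exact absurd rfl he
  · rfl
  · rfl

lemma IsStart.planC₂_of_ne (hx : m.IsStart x) {e : Ending} (he : e ≠ Ending.byA) (τ : ℝ≥0) :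
    hx.planC₂ e τ = Measure.dirac 0 := by
  cases e
  · exact absurd rfl he
  · rfl
  · rfl

/-- The equilibrium in which `C` has reputation `x` right after time `0`. -/
def IsStart.assessment (hx : m.IsStart x) : Assessment where
  planA := hx.isSurvivalA.plan
  planC := hx.isSurvivalC.plan
  planB₂ := hx.planB₂
  planC₂ := hx.planC₂
  prob_planA := inferInstance
  prob_planC := inferInstance
  markov_planB₂ := fun e => ⟨fun τ => by
    by_cases he : e = Ending.byA
    · subst he; rw [hx.planB₂_byA]; infer_instance
    · rw [hx.planB₂_of_ne he]; infer_instance⟩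
  markov_planC₂ := fun e => ⟨fun τ => by
    by_cases he : e = Ending.byA
    · subst he; rw [hx.planC₂_byA]; infer_instance
    · rw [hx.planC₂_of_ne he]; infer_instance⟩
  beliefA := fun t => bayes m.zA (hx.isSurvivalA.plan.real (Ici (t : ℝ≥0∞)))
  beliefC := fun t => bayes m.zC (hx.isSurvivalC.plan.real (Ici (t : ℝ≥0∞)))
  beliefB₂ := fun e τ t => bayes m.zB ((hx.planB₂ e τ).real (Ici (t : ℝ≥0∞)))
  beliefC₂ := fun e τ t => match e with
    | Ending.byA => bayes (bayes m.zC (hx.isSurvivalC.plan.real (Ioi (τ : ℝ≥0∞))))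
        ((hx.planC₂ Ending.byA τ).real (Ici (t : ℝ≥0∞)))
    | _ => 0

namespace IsStart

variable (hx : m.IsStart x)

lemma bayesConsistent : m.BayesConsistent hx.assessment where
  stage1A := fun _ => rfl
  stage1C := fun _ => rfl
  stage2B := fun _ _ _ => rfl
  stage2C_byA := fun _ _ => rfl
  stage2C_byC := fun _ _ => rfl
  stage2C_both := fun _ _ => rfl

lemma survC {t : ℝ} (ht : 0 ≤ t) :
    surv (typeMix m.zC hx.assessment.planC) t = m.zC / m.repPath x t :=
  hx.isSurvivalC.surv_plan m.zC_mem.1.le ht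

lemma survA {t : ℝ} (ht : 0 ≤ t) :
    surv (typeMix m.zA hx.assessment.planA) t = m.zA / m.zeta (m.repPath x t) :=
  hx.isSurvivalA.surv_plan m.zA_mem.1.le ht

lemma reputation_FC {t : ℝ} (ht : 0 ≤ t) :
    reputation m.zC (m.FC hx.assessment) t = m.repPath x t := by
  rw [SeqGame.reputation_FC t ht, hx.survC ht, div_div_cancel₀ m.zC_mem.1.ne']

lemma bayes_eq (τ : ℝ≥0) :
    bayes m.zC (hx.isSurvivalC.plan.real (Ioi (τ : ℝ≥0∞))) = m.repPath x τ := by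
  rw [← hx.reputation_FC τ.coe_nonneg, reputation_eq_bayes]; rfl

lemma atomB (τ : ℝ≥0∞) :
    m.atomB hx.assessment τ = gAG (m.repPath x τ.toNNReal) m.zB := by
  have hz := repPath_mem (m := m) hx.pos τ.toNNReal
  have hb := Ioo_subset_Ioc_self m.zB_mem
  have hp := isProbabilityMeasure_typeMix (μ := agPlan m.lam m.zB (m.repPath x τ.toNNReal))
    m.zB_mem.1.le m.zB_mem.2.le
  have e := real_singleton_zero_add_surv (typeMix m.zB (agPlan m.lam m.zB (m.repPath x τ.toNNReal)))
  have h0 : 0 ≤ agTime m.lam m.zB (m.repPath x τ.toNNReal) := min_log_nonneg m.lam_pos hb hz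
  rw [surv_agPlan m.lam_pos hb hz le_rfl, min_eq_left h0] at e
  simp only [mul_zero, Real.exp_zero, mul_one] at e
  have h1 : m.atomB hx.assessment τ =
    (typeMix m.zB (agPlan m.lam m.zB (m.repPath x τ.toNNReal))).real {0} := rfl
  rw [h1]; linarith

lemma valueB (τ : ℝ≥0) : (∀ y, (m.war 1 one_pos).value
      (typeMix (m.repPath x τ) (hx.assessment.planC₂ Ending.byA τ)) y ≤
      (m.war 1 one_pos).valueRight
        (typeMix (m.repPath x τ) (hx.assessment.planC₂ Ending.byA τ)) 0) ∧
    ∀ᵐ y ∂(hx.assessment.planB₂ Ending.byA τ), (m.war 1 one_pos).value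
      (typeMix (m.repPath x τ) (hx.assessment.planC₂ Ending.byA τ)) y =
      (m.war 1 one_pos).valueRight
        (typeMix (m.repPath x τ) (hx.assessment.planC₂ Ending.byA τ)) 0 := by
  have := m.ag_optimal (Ioo_subset_Ioc_self m.zB_mem) (repPath_mem (m := m) hx.pos τ)
  exact ⟨this.1, this.2 m.zB_mem.2⟩

lemma valueC (τ : ℝ≥0) : (∀ y, (m.war 1 one_pos).value
      (typeMix m.zB (hx.assessment.planB₂ Ending.byA τ)) y ≤ m.contValue hx.assessment τ) ∧
    (m.repPath x τ < 1 → ∀ᵐ y ∂(hx.assessment.planC₂ Ending.byA τ), (m.war 1 one_pos).value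
      (typeMix m.zB (hx.assessment.planB₂ Ending.byA τ)) y = m.contValue hx.assessment τ) := by
  rw [← m.valueRight_eq_contValue]
  exact m.ag_optimal (repPath_mem (m := m) hx.pos τ) (Ioo_subset_Ioc_self m.zB_mem)

lemma stage2Play : m.Stage2Play hx.assessment where
  planC₂ := fun _ he τ => hx.planC₂_of_ne he τ
  planB₂ := fun e he τ => by
    change hx.planB₂ e τ {0} = 0
    rw [hx.planB₂_of_ne he]; simp
  value_byA := fun τ hτ => (hx.valueC τ).2 (by rwa [hx.reputation_FC τ.coe_nonneg] at hτ)

lemma surv_zero_or : surv (typeMix m.zC hx.assessment.planC) 0 = 1 ∨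
    surv (typeMix m.zA hx.assessment.planA) 0 = 1 := by
  rw [hx.survC le_rfl, hx.survA le_rfl, hx.repPath_zero]
  rcases hx.2.2.2 with h | h
  · left; rw [h, div_self m.zC_mem.1.ne']
  · right; rw [h, div_self m.zA_mem.1.ne']

lemma termTime_pos (hx : m.IsStart x) : 0 < m.termTime x := SeqGame.termTime_pos m hx.mem

lemma hasDerivAt_survC {t : ℝ} (ht : t ∈ Ioo 0 (m.termTime x)) :
    HasDerivAt (surv (typeMix m.zC hx.assessment.planC))
      (-m.lam * surv (typeMix m.zC hx.assessment.planC) t) t := by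
  have hev : surv (typeMix m.zC hx.assessment.planC) =ᶠ[𝓝 t]
      fun t => m.zC / x * Real.exp (-m.lam * t) := by
    filter_upwards [Ioo_mem_nhds ht.1 ht.2] with s hs
    rw [hx.survC hs.1.le, m.repPath_of_le hs.2.le, neg_mul, Real.exp_neg]
    field_simp
  rw [hev.self_of_nhds]
  refine (((exp_lam_hasDerivAt m.lam t).const_mul (m.zC / x)).congr_deriv
    ?_).congr_of_eventuallyEq hev
  ring

lemma hasDerivAt_survA {t : ℝ} (ht : t ∈ Ioo 0 (m.termTime x)) :
    HasDerivAt (surv (typeMix m.zA hx.assessment.planA))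
      (-m.hazardA (x * Real.exp (m.lam * t)) * surv (typeMix m.zA hx.assessment.planA) t) t := by
  have hev : surv (typeMix m.zA hx.assessment.planA) =ᶠ[𝓝 t]
      fun t => m.zA * (m.zeta (x * Real.exp (m.lam * t)))⁻¹ := by
    filter_upwards [Ioo_mem_nhds ht.1 ht.2] with s hs
    rw [hx.survA hs.1.le, m.repPath_of_le hs.2.le, div_eq_mul_inv]
  rw [hev.self_of_nhds]
  refine (((m.hasDerivAt_inv_zeta hx.pos t).const_mul m.zA).congr_deriv
    ?_).congr_of_eventuallyEq hev
  ring

lemma continuousOn_survC : ContinuousOn (surv (typeMix m.zC hx.assessment.planC)) (Ici 0) :=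
  hx.isSurvivalC.continuousOn.congr fun _ ht => hx.survC ht

lemma continuousOn_survA : ContinuousOn (surv (typeMix m.zA hx.assessment.planA)) (Ici 0) :=
  hx.isSurvivalA.continuousOn.congr fun _ ht => hx.survA ht

lemma survC_termTime : surv (typeMix m.zC hx.assessment.planC) (m.termTime x) = m.zC := by
  rw [hx.survC hx.termTime_pos.le, m.repPath_of_ge hx.pos le_rfl, div_one]

lemma survA_termTime : surv (typeMix m.zA hx.assessment.planA) (m.termTime x) = m.zA := by
  rw [hx.survA hx.termTime_pos.le, m.repPath_of_ge hx.pos le_rfl, m.zeta_one, div_one]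

lemma rationalA : m.RationalA hx.assessment := by
  obtain ⟨h1, h2⟩ := Contest.optimal_of_hazard (w := m.war m.πAC m.πAC_pos)
    (μ₁ := hx.assessment.planA) (μ₂ := hx.assessment.planC) (Ioo_subset_Ioc_self m.zA_mem)
    (Ioo_subset_Ioc_self m.zC_mem) hx.termTime_pos.le hx.continuousOn_survC hx.survA_termTime
    hx.survC_termTime hx.surv_zero_or.symm (fun _ _ => continuousAt_const) (fun t ht => by
      rw [m.war_hazard]; exact hx.hasDerivAt_survC ht)
  intro t ht
  exact m.isOptimalFrom_of_value m.πAC_pos m.zC_mem.1 m.zC_mem.2.le h1 (h2 m.zA_mem.2) ht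

lemma atomB_eventually {t : ℝ} (ht : t ∈ Ioo 0 (m.termTime x)) :
    ∀ᶠ s in 𝓝 t, m.atomB hx.assessment (ENNReal.ofReal s) =
      gAG (x * Real.exp (m.lam * s)) m.zB := by
  filter_upwards [Ioo_mem_nhds ht.1 ht.2] with s hs
  have h1 : ((ENNReal.ofReal s).toNNReal : ℝ) = s := ENNReal.toReal_ofReal hs.1.le
  rw [hx.atomB, h1, m.repPath_of_le hs.2.le]

/-- Whatever she plans, C gets at most 1 - α from a B who never concedes and at most `contValue`
after a concession of A. The reduced contest therefore bounds every joint deviation. -/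
lemma payoffC_le (κ' : Ending → Kernel ℝ≥0 ℝ≥0∞) (hκ' : ∀ e, IsMarkovKernel (κ' e))
    (c a : ℝ≥0∞) :
    m.payoffC hx.assessment.planB₂ κ' c a ≤ (m.contestC hx.assessment).pay c a := by
  have hne : ∀ e, e ≠ Ending.byA → ∀ τ, m.payoffC₂ hx.assessment.planB₂ κ' e τ ≤ 1 - m.α := by
    intro e he τ
    have hB : hx.assessment.planB₂ e τ.toNNReal = Measure.dirac ⊤ := hx.planB₂_of_ne he _
    rw [payoffC₂, Contest.expPayoff_pay, hB]
    refine (integral_mono_of_nonneg (Eventually.of_forall fun _ => Contest.value_nonneg _ _ _)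
      (integrable_const (1 - m.α)) (Eventually.of_forall fun y => ?_)).trans (by simp)
    dsimp only
    rw [Contest.value, integral_typeMix m.zB_mem.1.le m.zB_mem.2.le (Contest.integrable_pay _ _ _),
      integral_dirac]
    have h1 : (m.war 1 one_pos).pay y ⊤ ≤ 1 - m.α := by
      have hα := m.α_lt_one
      rcases (le_top : y ≤ ⊤).eq_or_lt with rfl | hy
      · rw [Contest.pay_self, disc_top]; linarith
      · rw [Contest.pay_of_lt _ hy, war_L]
        have := disc_le_one m.r_pos y
        simp only [war_r]; nlinarith
    linarith
  have hA : ∀ τ : ℝ≥0∞, m.payoffC₂ hx.assessment.planB₂ κ' Ending.byA τ ≤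
      m.contValue hx.assessment τ := by
    intro τ
    rw [payoffC₂, Contest.expPayoff_pay]
    have h1 := (hx.valueC τ.toNNReal).1
    have h2 : m.contValue hx.assessment (τ.toNNReal : ℝ≥0∞) = m.contValue hx.assessment τ := by
      rw [contValue, contValue, hx.atomB, hx.atomB, ENNReal.toNNReal_coe]
    rw [h2] at h1
    exact (integral_mono_of_nonneg (Eventually.of_forall fun _ => Contest.value_nonneg _ _ _)
      (integrable_const _) (Eventually.of_forall h1)).trans (by simp)
  rcases lt_trichotomy c a with h | rfl | h
  · rw [payoffC_of_lt _ _ _ h, Contest.pay_of_lt _ h]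
    refine mul_le_mul_of_nonneg_left ?_ (disc_nonneg _ _)
    have := hne Ending.byC (by simp) c
    simp only [contestC_L]; linarith
  · rw [payoffC_self, Contest.pay_self]
    refine mul_le_mul_of_nonneg_left ?_ (disc_nonneg _ _)
    have := hne Ending.both (by simp) c
    simp only [contestC_M]; linarith
  · rw [payoffC_of_gt _ _ _ h, Contest.pay_of_gt _ h]
    refine mul_le_mul_of_nonneg_left ?_ (disc_nonneg _ _)
    have := hA a
    simp only [contestC_W]; linarith

lemma payoffC_nonneg (β κ' : Ending → Kernel ℝ≥0 ℝ≥0∞) (c a : ℝ≥0∞) :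
    0 ≤ m.payoffC β κ' c a := by
  have h2 : ∀ e τ, 0 ≤ m.payoffC₂ β κ' e τ := fun e τ => by
    rw [payoffC₂, Contest.expPayoff_pay]
    exact integral_nonneg fun _ => Contest.value_nonneg _ _ _
  have hα := m.α_lt_one
  have hα' := m.half_lt_α
  have hπ := m.πAC_pos
  rcases lt_trichotomy c a with h | rfl | h
  · rw [payoffC_of_lt _ _ _ h]
    exact mul_nonneg (disc_nonneg _ _) (add_nonneg (mul_nonneg (by linarith) hπ.le) (h2 _ _))
  · rw [payoffC_self]
    exact mul_nonneg (disc_nonneg _ _) (add_nonneg (by linarith) (h2 _ _))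
  · rw [payoffC_of_gt _ _ _ h]
    exact mul_nonneg (disc_nonneg _ _) (add_nonneg (mul_nonneg (by linarith) hπ.le) (h2 _ _))

lemma rationalC₁ : m.RationalC₁ hx.assessment := by
  obtain ⟨h1, h2⟩ := Contest.optimal_of_hazard (w := m.contestC hx.assessment)
    (μ₁ := hx.assessment.planC) (μ₂ := hx.assessment.planA) (Ioo_subset_Ioc_self m.zC_mem)
    (Ioo_subset_Ioc_self m.zA_mem) hx.termTime_pos.le hx.continuousOn_survA hx.survC_termTime
    hx.survA_termTime hx.surv_zero_or
    (fun t ht => contestC_continuousAt hx.pos (hx.atomB_eventually ht)) (fun t ht => by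
      rw [contestC_hazard (hx.atomB_eventually ht).self_of_nhds]; exact hx.hasDerivAt_survA ht)
  intro t ht μ' hμ' ht' κ' hκ'
  have hp := isProbabilityMeasure_typeMix (μ := hx.assessment.planA) m.zA_mem.1.le m.zA_mem.2.le
  rw [hx.bayesConsistent.stage1A, contLaw_bayes m.zA_mem.1 m.zA_mem.2.le,
    hx.stage2Play.expPayoff_payoffC cond_absolutelyContinuous]
  refine Contest.expPayoff_le_of_value_cond ?_ ht h1 (h2 m.zC_mem.2) hμ' ht'
    (payoffC_nonneg _ _) (hx.payoffC_le κ' hκ')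
  intro h3
  exact typeMix_top_ne_zero (μ := hx.assessment.planA) m.zA_mem.1
    (measure_mono_null (singleton_subset_iff.2 le_top) h3)

lemma dirac_zero_Ici {t : ℝ≥0} (ht : t ≠ 0) :
    (Measure.dirac (0 : ℝ≥0∞)) (Ici (t : ℝ≥0∞)) = 0 := by
  simp [ht]

lemma rationalB₂ : m.RationalB₂ hx.assessment := by
  intro e τ t _ h2 h3
  by_cases he : e = Ending.byA
  · subst he
    obtain ⟨h4, h5⟩ := hx.valueB τ
    have h6 := repPath_mem (m := m) hx.pos τ
    have h7 := m.isOptimalFrom_of_value one_pos h6.1 h6.2 h4 h5 h2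
    rw [hx.bayesConsistent.stage2C_byA]
    rwa [← hx.bayes_eq] at h7
  · have hC : hx.assessment.planC₂ e τ = Measure.dirac 0 := hx.planC₂_of_ne he τ
    have hB : hx.assessment.planB₂ e τ = Measure.dirac ⊤ := hx.planB₂_of_ne he τ
    have hb : hx.assessment.beliefC₂ e τ t = 0 := by
      cases e
      · exact absurd rfl he
      · rfl
      · rfl
    rw [hC, hb] at h3
    -- For t > 0 the believed continuation of C is the zero measure, as she is known to be rational
    -- and planned to concede at 0; such histories are exempt.
    have ht : t = 0 := by
      by_contra ht
      refine h3 ?_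
      rw [contLaw, ProbabilityTheory.cond, dirac_zero_Ici ht,
        Measure.restrict_eq_zero.2 (dirac_zero_Ici ht)]
      simp [typeMix]
    subst ht
    intro μ' hμ' _
    rw [hC, hB, hb, contLaw_zero, cond_Ici_zero, m.warPayoff_eq one_pos, Contest.expPayoff_dirac]
    have hm : typeMix 0 (Measure.dirac (0 : ℝ≥0∞)) = Measure.dirac 0 := by simp [typeMix]
    rw [hm, Contest.expPayoff_pay]
    -- Never conceding wins undiscounted at time 0, which is the largest payoff possible.
    refine (integral_mono_of_nonneg (Eventually.of_forall fun _ => Contest.value_nonneg _ _ _)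
      (integrable_const ((m.war 1 one_pos).value (Measure.dirac 0) ⊤))
      (Eventually.of_forall fun y => ?_)).trans (by simp)
    dsimp only
    rw [Contest.value, Contest.value, integral_dirac, integral_dirac,
      Contest.pay_of_gt _ ENNReal.zero_lt_top, disc_zero, one_mul]
    exact Contest.pay_le _ _ _

lemma rationalC₂ : m.RationalC₂ hx.assessment := by
  intro e τ t h1 h2 h3
  by_cases he : e = Ending.byA
  · subst he
    rw [hx.bayesConsistent.stage2C_byA] at h1
    have h6 := repPath_mem (m := m) hx.pos τ
    -- Reputation 1 at the start of stage 2 would persist under Bayes' rule, contradicting the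
    -- belief below 1.
    have hlt : m.repPath x τ < 1 := by
      refine lt_of_le_of_ne h6.2 fun h => ?_
      have h7 := hx.bayes_eq τ
      rw [h] at h7
      change bayes (bayes m.zC (hx.isSurvivalC.plan.real _)) _ < 1 at h1
      rw [h7, bayes_one_left] at h1
      exact lt_irrefl _ h1
    obtain ⟨h4, h5⟩ := hx.valueC τ
    exact m.isOptimalFrom_of_value one_pos m.zB_mem.1 m.zB_mem.2.le h4 (h5 hlt) h2
  · have hC : hx.assessment.planC₂ e τ = Measure.dirac 0 := hx.planC₂_of_ne he τ
    have hB : hx.assessment.planB₂ e τ = Measure.dirac ⊤ := hx.planB₂_of_ne he τ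
    rw [hC] at h2
    have ht : t = 0 := by
      by_contra ht
      exact h2 (dirac_zero_Ici ht)
    subst ht
    refine fun μ' hμ' ht' => ?_
    have h7 := m.isOptimalFrom_of_value (μ := Measure.dirac 0) (ν := Measure.dirac ⊤) one_pos
      m.zB_mem.1 m.zB_mem.2.le (v := 1 - m.α) (fun y => ?_) ?_ (t := 0) (by simp)
    · rw [hC, hB, hx.bayesConsistent.stage2B, hB]
      exact h7 μ' hμ' ht'
    · rw [Contest.value, integral_typeMix m.zB_mem.1.le m.zB_mem.2.le
        (Contest.integrable_pay _ _ _), integral_dirac]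
      have h8 : (m.war 1 one_pos).pay y ⊤ ≤ 1 - m.α := by
        have hα := m.α_lt_one
        rcases (le_top : y ≤ ⊤).eq_or_lt with rfl | hy
        · rw [Contest.pay_self, disc_top]; linarith
        · rw [Contest.pay_of_lt _ hy, war_L]
          have := disc_le_one m.r_pos y
          simp only [war_r]; nlinarith
      linarith
    · rw [ae_dirac_eq, eventually_pure, Contest.value, integral_typeMix m.zB_mem.1.le
        m.zB_mem.2.le (Contest.integrable_pay _ _ _), integral_dirac,
        Contest.pay_of_lt _ ENNReal.zero_lt_top]
      simp
      ring

lemma regularC : IsRegularCdf (m.FC hx.assessment) := by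
  refine isRegularCdf_of_hasDerivAt (T := m.termTime x)
    (G := fun t => 1 - m.zC / x * Real.exp (-m.lam * t)) hx.termTime_pos
    (fun t => ((exp_lam_hasDerivAt m.lam t).const_mul (m.zC / x)).const_sub 1) (by fun_prop) ?_
  intro t ht
  rw [FC, concessionCdf_eq m.zC_mem.1.le m.zC_mem.2.le ht.le, hx.survC ht.le, repPath, neg_mul,
    Real.exp_neg]
  field_simp

lemma regularA : IsRegularCdf (m.FA hx.assessment) := by
  refine isRegularCdf_of_hasDerivAt (T := m.termTime x)
    (G := fun t => 1 - m.zA * (m.zeta (x * Real.exp (m.lam * t)))⁻¹) hx.termTime_pos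
    (fun t => ((m.hasDerivAt_inv_zeta hx.pos t).const_mul m.zA).const_sub 1) ?_ ?_
  · have hpos : ∀ t, 0 < x * Real.exp (m.lam * t) := fun t => mul_pos hx.pos (Real.exp_pos _)
    have h1 : Continuous fun t => (m.zeta (x * Real.exp (m.lam * t)))⁻¹ :=
      continuous_iff_continuousAt.2 fun t => (m.hasDerivAt_inv_zeta hx.pos t).continuousAt
    have h2 : Continuous fun t => m.hazardA (x * Real.exp (m.lam * t)) := by
      have h3 : Continuous fun t => gAG (x * Real.exp (m.lam * t)) m.zB :=
        continuous_iff_continuousAt.2 fun t => ContinuousAt.comp (g := fun x => gAG x m.zB)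
          (continuousAt_gAG (hpos t)) (by fun_prop)
      exact continuous_const.mul (continuous_const.div (continuous_const.add h3) fun t =>
        (add_pos_of_pos_of_nonneg m.πAC_pos (gAG_nonneg _ _)).ne')
    exact (continuous_const.mul (h2.neg.mul h1)).neg
  · intro t ht
    rw [FA, concessionCdf_eq m.zA_mem.1.le m.zA_mem.2.le ht.le, hx.survA ht.le, repPath,
      div_eq_mul_inv]

theorem isPBE : m.IsPBE hx.assessment where
  rationalA := hx.rationalA
  rationalC₁ := hx.rationalC₁
  rationalB₂ := hx.rationalB₂
  rationalC₂ := hx.rationalC₂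
  bayesConsistent := hx.bayesConsistent
  regularA := hx.regularA
  regularC := hx.regularC

end IsStart

end SeqGame

/-! ### Uniqueness of play and closed forms. -/

lemma eq_of_concessionCdf {z : ℝ} {μ μ' : Measure ℝ≥0∞} [IsProbabilityMeasure μ]
    [IsProbabilityMeasure μ'] (h0 : 0 ≤ z) (h1 : z < 1)
    (h : ∀ t, concessionCdf z μ t = concessionCdf z μ' t) : μ = μ' := by
  refine plan_ext h0 h1 fun t ht => ?_
  have := h t
  rw [concessionCdf_eq h0 h1.le ht, concessionCdf_eq h0 h1.le ht] at this
  linarith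

namespace SeqGame

variable {m : SeqGame} {σ ρ : Assessment}

namespace IsPBE

/-- Uniqueness of the equilibrium play. -/
theorem samePlay (h : m.IsPBE σ) (h' : m.IsPBE ρ) : SamePlay σ ρ := by
  obtain ⟨x, hx, hxC, hxA⟩ := h.stage1
  obtain ⟨y, hy, hyC, hyA⟩ := h'.stage1
  obtain rfl := hx.unique hy
  have hA : σ.planA = ρ.planA := plan_ext m.zA_mem.1.le m.zA_mem.2 fun t ht => by
    rw [hxA t ht, hyA t ht]
  have hC : σ.planC = ρ.planC := plan_ext m.zC_mem.1.le m.zC_mem.2 fun t ht => by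
    rw [hxC t ht, hyC t ht]
  have hF : m.FC σ = m.FC ρ := by rw [FC, FC, hC]
  have hB₂ : σ.planB₂ Ending.byA = ρ.planB₂ Ending.byA := by
    ext1 τ
    refine eq_of_concessionCdf m.zB_mem.1.le m.zB_mem.2 fun t => ?_
    rw [(h.stage2_byA τ).1 t, (h'.stage2_byA τ).1 t, hF]
  have hC₂ : ∀ τ : ℝ≥0, σ.planC (Ioi (τ : ℝ≥0∞)) ≠ 0 →
      σ.planC₂ Ending.byA τ = ρ.planC₂ Ending.byA τ := by
    intro τ hτ
    have hlt : reputation m.zC (m.FC σ) τ < 1 := by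
      rw [reputation_eq_bayes]
      exact bayes_lt_one m.zC_mem (real_pos_of_ne_zero hτ)
    refine eq_of_concessionCdf (reputation_mem τ).1.le hlt fun t => ?_
    rw [(h.stage2_byA τ).2.1 t, hF, (h'.stage2_byA τ).2.1 t]
  have hC₂' : ∀ e ≠ Ending.byA, σ.planC₂ e = ρ.planC₂ e := by
    intro e he
    ext1 τ
    rw [(h.stage2_of_ne_byA he τ).1, (h'.stage2_of_ne_byA he τ).1]
  refine ⟨hA, hC, hB₂, hC₂, hC₂' _ (by simp), hC₂' _ (by simp), ?_, ?_, ?_, ?_⟩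
  · funext t
    rw [h.bayesConsistent.stage1A, h'.bayesConsistent.stage1A, hA]
  · funext t
    rw [h.bayesConsistent.stage1C, h'.bayesConsistent.stage1C, hC]
  · funext τ t
    rw [h.bayesConsistent.stage2B, h'.bayesConsistent.stage2B, hB₂]
  · funext e τ t
    by_cases he : e = Ending.byA
    · subst he
      rw [h.bayesConsistent.stage2C_byA, h'.bayesConsistent.stage2C_byA, ← hC]
      -- After a time by which rational C has surely conceded, the belief is 1 at every later date
      -- whatever her stage-2 plan, so beliefs agree even where plans may differ.
      by_cases hτ : σ.planC (Ioi (τ : ℝ≥0∞)) = 0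
      · rw [measureReal_def, hτ, ENNReal.toReal_zero, bayes_zero m.zC_mem.1.ne',
          bayes_one_left, bayes_one_left]
      · rw [hC₂ τ hτ]
    · rw [h.beliefC₂_eq_zero he, h'.beliefC₂_eq_zero he]

end IsPBE

section Start

variable {x : ℝ} (hx : m.IsStart x)
include hx

lemma IsStart.eq_zC_of_le (h : m.zA ≤ m.zBarA) : x = m.zC := by
  have h1 := hx.zeta_eq
  rw [max_eq_right h, zBarA_eq] at h1
  exact m.zeta_strictMonoOn.injOn hx.pos m.zC_mem.1 h1

lemma IsStart.zeta_eq_zA (h : m.zBarA ≤ m.zA) : m.zeta x = m.zA := by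
  rw [hx.zeta_eq, max_eq_left h]

lemma IsStart.zC_lt (h : m.zBarA < m.zA) : m.zC < x := by
  rw [← m.zeta_strictMonoOn.lt_iff_lt m.zC_mem.1 hx.pos, hx.zeta_eq_zA h.le]
  exact h

omit hx in
lemma eq_of_zeta_eq_of_ge {z : ℝ} (h : m.zeta x = z) (hB : m.zB ≤ x) :
    x = (m.zB + z * (m.πAC + 1 - m.zB)) / (m.πAC + 1) := by
  have h1 := m.denom_pos
  have h2 := m.πAC_pos
  rw [zeta, if_pos hB, div_eq_iff h1.ne'] at h
  rw [eq_div_iff (by positivity)]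
  linarith

omit hx in
lemma eq_of_zeta_eq_of_lt {z : ℝ} (h : m.zeta x = z) (h0 : 0 < x) (hB : x < m.zB) :
    x = m.zB * (z * (m.πAC + 1 - m.zB) / (m.πAC * m.zB)) ^ (m.πAC / (m.πAC + 1)) := by
  have h1 := m.denom_pos
  have h2 := m.πAC_pos
  have h3 := m.zB_mem.1
  rw [zeta, if_neg hB.not_ge] at h
  have h4 : z * (m.πAC + 1 - m.zB) / (m.πAC * m.zB) =
      (x / m.zB) ^ ((m.πAC + 1) / m.πAC) := by
    rw [← h]; field_simp
  rw [h4, ← Real.rpow_mul (by positivity), show (m.πAC + 1) / m.πAC * (m.πAC / (m.πAC + 1)) = 1 by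
    field_simp, Real.rpow_one]
  field_simp

end Start

namespace IsPBE

variable {x : ℝ} (hx : m.IsStart x)

lemma reputation_eq_repPath (hC : ∀ t, 0 ≤ t → surv (typeMix m.zC σ.planC) t = m.zC / m.repPath x t)
    {t : ℝ} (ht : 0 ≤ t) : reputation m.zC (m.FC σ) t = m.repPath x t := by
  rw [reputation_FC t ht, hC t ht, div_div_cancel₀ m.zC_mem.1.ne']

lemma reputation_eq_zeta
    (hA : ∀ t, 0 ≤ t → surv (typeMix m.zA σ.planA) t = m.zA / m.zeta (m.repPath x t))
    {t : ℝ} (ht : 0 ≤ t) : reputation m.zA (m.FA σ) t = m.zeta (m.repPath x t) := by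
  rw [reputation_FA t ht, hA t ht, div_div_cancel₀ m.zA_mem.1.ne']

lemma hasDerivAt_FC
    (hC : ∀ t, 0 ≤ t → surv (typeMix m.zC σ.planC) t = m.zC / m.repPath x t)
    {t : ℝ} (ht : t ∈ Ioo 0 (m.termTime x)) :
    HasDerivAt (m.FC σ) (m.lam * (1 - m.FC σ t)) t := by
  have hev : m.FC σ =ᶠ[𝓝 t] fun t => 1 - m.zC / x * Real.exp (-m.lam * t) := by
    filter_upwards [Ioo_mem_nhds ht.1 ht.2] with s hs
    rw [FC, concessionCdf_eq m.zC_mem.1.le m.zC_mem.2.le hs.1.le, hC s hs.1.le,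
      m.repPath_of_le hs.2.le, neg_mul, Real.exp_neg]
    field_simp
  rw [hev.self_of_nhds]
  refine ((((exp_lam_hasDerivAt m.lam t).const_mul (m.zC / x)).const_sub 1).congr_deriv
    ?_).congr_of_eventuallyEq hev
  ring

include hx

lemma hasDerivAt_FA
    (hA : ∀ t, 0 ≤ t → surv (typeMix m.zA σ.planA) t = m.zA / m.zeta (m.repPath x t))
    {t : ℝ} (ht : t ∈ Ioo 0 (m.termTime x)) :
    HasDerivAt (m.FA σ) (m.hazardA (m.repPath x t) * (1 - m.FA σ t)) t := by
  have hev : m.FA σ =ᶠ[𝓝 t] fun t => 1 - m.zA * (m.zeta (x * Real.exp (m.lam * t)))⁻¹ := by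
    filter_upwards [Ioo_mem_nhds ht.1 ht.2] with s hs
    rw [FA, concessionCdf_eq m.zA_mem.1.le m.zA_mem.2.le hs.1.le, hA s hs.1.le,
      m.repPath_of_le hs.2.le, div_eq_mul_inv]
  rw [hev.self_of_nhds, m.repPath_of_le ht.2.le]
  refine ((((m.hasDerivAt_inv_zeta hx.pos t).const_mul m.zA).const_sub 1).congr_deriv
    ?_).congr_of_eventuallyEq hev
  ring

/-- Concession rates in stage 1. -/
lemma hazards
    (hC : ∀ t, 0 ≤ t → surv (typeMix m.zC σ.planC) t = m.zC / m.repPath x t)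
    (hA : ∀ t, 0 ≤ t → surv (typeMix m.zA σ.planA) t = m.zA / m.zeta (m.repPath x t))
    {t : ℝ} (ht : t ∈ Ioo 0 (m.termTime x)) :
    DifferentiableAt ℝ (m.FA σ) t ∧ DifferentiableAt ℝ (m.FC σ) t ∧
      0 < deriv (m.FA σ) t ∧ 0 < deriv (m.FC σ) t ∧
      hazard (m.FC σ) t = m.lam ∧ hazard (m.FA σ) t = m.hazardA (m.repPath x t) := by
  have h1 := hasDerivAt_FC hC ht
  have h2 := hasDerivAt_FA hx hA ht
  have h3 : 0 < 1 - m.FC σ t := by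
    rw [FC, concessionCdf_eq m.zC_mem.1.le m.zC_mem.2.le ht.1.le, hC t ht.1.le, sub_sub_cancel]
    exact div_pos m.zC_mem.1 (m.repPath_pos hx.pos t)
  have h4 : 0 < 1 - m.FA σ t := by
    rw [FA, concessionCdf_eq m.zA_mem.1.le m.zA_mem.2.le ht.1.le, hA t ht.1.le, sub_sub_cancel]
    exact div_pos m.zA_mem.1 (m.zeta_pos (m.repPath_pos hx.pos t))
  refine ⟨h2.differentiableAt, h1.differentiableAt, ?_, ?_, ?_, ?_⟩
  · rw [h2.deriv]; exact mul_pos (m.hazardA_pos _) h4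
  · rw [h1.deriv]; exact mul_pos m.lam_pos h3
  · rw [hazard, h1.deriv, mul_div_cancel_right₀ _ h3.ne']
  · rw [hazard, h2.deriv, mul_div_cancel_right₀ _ h4.ne']

end IsPBE

end SeqGame

end

theorem propositionB1 (m : SeqGame) :
    -- existence
    (∃ σ : Assessment, m.IsPBE σ) ∧
    -- uniqueness
    (∀ σ ρ : Assessment, m.IsPBE σ → m.IsPBE ρ → SamePlay σ ρ) ∧
    -- description
    ∀ σ : Assessment, m.IsPBE σ →
      -- stage 2 after a concession by A at τ
      (∀ τ : ℝ≥0,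
        σ.beliefB₂ Ending.byA τ 0 = m.zB ∧
        σ.beliefC₂ Ending.byA τ 0 = reputation m.zC (m.FC σ) τ ∧
        (∀ t : ℝ, concessionCdf m.zB (σ.planB₂ Ending.byA τ) t =
          agCdf m.lam m.zB (reputation m.zC (m.FC σ) τ) t) ∧
        (∀ t : ℝ,
          concessionCdf (reputation m.zC (m.FC σ) τ) (σ.planC₂ Ending.byA τ) t =
            agCdf m.lam (reputation m.zC (m.FC σ) τ) m.zB t)) ∧
      -- stage 2 after a concession by C at τ (whether or not A concedes at the same instant)
      (∀ e : Ending, e ≠ Ending.byA → ∀ τ : ℝ≥0,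
        σ.beliefC₂ e τ 0 = 0 ∧
        σ.planC₂ e τ = Measure.dirac 0 ∧
        σ.planB₂ e τ {0} = 0) ∧
      -- stage 1: common terminal time and hazard rates
      (∃ T : ℝ, 0 < T ∧
        T = -(1 / m.lam) * Real.log (reputation m.zC (m.FC σ) 0) ∧
        reputation m.zA (m.FA σ) T = 1 ∧
        reputation m.zC (m.FC σ) T = 1 ∧
        ∀ᵐ t : ℝ, t ∈ Ioo 0 T →
          DifferentiableAt ℝ (m.FA σ) t ∧ DifferentiableAt ℝ (m.FC σ) t ∧
          0 < deriv (m.FA σ) t ∧ 0 < deriv (m.FC σ) t ∧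
          hazard (m.FC σ) t = m.lam ∧
          hazard (m.FA σ) t =
            m.lam * ((m.πAC + 1) / (m.πAC + gAG (reputation m.zC (m.FC σ) t) m.zB)) ∧
          (reputation m.zC (m.FC σ) t ≤ m.zB →
            hazard (m.FA σ) t = m.lam * ((m.πAC + 1) / m.πAC)) ∧
          (m.zB < reputation m.zC (m.FC σ) t →
            hazard (m.FA σ) t =
              m.lam * ((m.πAC + 1) / (m.πAC + 1 - m.zB / reputation m.zC (m.FC σ) t)))) ∧
      -- stage 1: atoms at time 0
      (m.FA σ 0 = 0 ∨ m.FC σ 0 = 0) ∧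
      (m.zA < m.zBarA →
        0 < m.FA σ 0 ∧
        m.FA σ 0 = 1 - m.zA / m.zBarA ∧ m.FC σ 0 = 0 ∧
        reputation m.zC (m.FC σ) 0 = m.zC ∧ reputation m.zA (m.FA σ) 0 = m.zBarA) ∧
      (m.zA = m.zBarA →
        m.FA σ 0 = 0 ∧ m.FC σ 0 = 0 ∧
        reputation m.zA (m.FA σ) 0 = m.zA ∧ reputation m.zC (m.FC σ) 0 = m.zC) ∧
      (m.zBarA < m.zA →
        0 < m.FC σ 0 ∧
        m.FA σ 0 = 0 ∧ m.FC σ 0 = 1 - m.zC / reputation m.zC (m.FC σ) 0 ∧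
        reputation m.zA (m.FA σ) 0 = m.zA ∧
        (m.zTildeA ≤ m.zA →
          m.zB ≤ reputation m.zC (m.FC σ) 0 ∧
          reputation m.zC (m.FC σ) 0 =
            (m.zB + m.zA * (m.πAC + 1 - m.zB)) / (m.πAC + 1)) ∧
        (m.zA < m.zTildeA →
          reputation m.zC (m.FC σ) 0 < m.zB ∧
          reputation m.zC (m.FC σ) 0 =
            m.zB * (m.zA * (m.πAC + 1 - m.zB) / (m.πAC * m.zB)) ^
              (m.πAC / (m.πAC + 1)))) := by
  refine ⟨?_, fun σ ρ => SeqGame.IsPBE.samePlay, fun σ h => ?_⟩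
  · obtain ⟨x, hx⟩ := m.exists_isStart
    exact ⟨hx.assessment, hx.isPBE⟩
  obtain ⟨x, hx, hC, hA⟩ := h.stage1
  have hrC : ∀ t, 0 ≤ t → reputation m.zC (m.FC σ) t = m.repPath x t :=
    fun t => SeqGame.IsPBE.reputation_eq_repPath hC
  have hrA : ∀ t, 0 ≤ t → reputation m.zA (m.FA σ) t = m.zeta (m.repPath x t) :=
    fun t => SeqGame.IsPBE.reputation_eq_zeta hA
  have hC0 : reputation m.zC (m.FC σ) 0 = x := by rw [hrC 0 le_rfl, hx.repPath_zero]
  have hA0 : reputation m.zA (m.FA σ) 0 = m.zeta x := by rw [hrA 0 le_rfl, hx.repPath_zero]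
  have hFC : m.FC σ 0 = 1 - m.zC / x := by
    rw [SeqGame.FC, concessionCdf_eq m.zC_mem.1.le m.zC_mem.2.le le_rfl, hC 0 le_rfl,
      hx.repPath_zero]
  have hFA : m.FA σ 0 = 1 - m.zA / m.zeta x := by
    rw [SeqGame.FA, concessionCdf_eq m.zA_mem.1.le m.zA_mem.2.le le_rfl, hA 0 le_rfl,
      hx.repPath_zero]
  have hFC0 : x = m.zC → m.FC σ 0 = 0 := fun e => by
    rw [hFC, e, div_self m.zC_mem.1.ne', sub_self]
  have hFA0 : m.zeta x = m.zA → m.FA σ 0 = 0 := fun e => by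
    rw [hFA, e, div_self m.zA_mem.1.ne', sub_self]
  refine ⟨fun τ => ⟨h.beliefB₂_zero _ τ, h.beliefC₂_byA_zero τ, (h.stage2_byA τ).1,
    (h.stage2_byA τ).2.1⟩, fun e he τ => ⟨h.beliefC₂_eq_zero he τ 0, h.stage2_of_ne_byA he τ⟩,
    ⟨m.termTime x, hx.termTime_pos, ?_, ?_, ?_, ?_⟩, ?_, fun hz => ?_, fun hz => ?_, fun hz => ?_⟩
  · rw [hC0, SeqGame.termTime]
  · rw [hrA _ hx.termTime_pos.le, m.repPath_of_ge hx.pos le_rfl, m.zeta_one]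
  · rw [hrC _ hx.termTime_pos.le, m.repPath_of_ge hx.pos le_rfl]
  · refine Filter.Eventually.of_forall fun t ht => ?_
    obtain ⟨h1, h2, h3, h4, h5, h6⟩ := SeqGame.IsPBE.hazards hx hC hA ht
    have hp := m.repPath_pos hx.pos t
    rw [hrC t ht.1.le, h6, SeqGame.hazardA]
    refine ⟨h1, h2, h3, h4, h5, rfl, fun hle => ?_, fun hlt => ?_⟩
    · rw [SeqGame.gAG_of_ge hp hle, add_zero]
    · rw [SeqGame.gAG_of_le hp hlt.le, add_sub_assoc]
  · rcases hx.2.2.2 with e | e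
    · exact Or.inr (hFC0 e)
    · exact Or.inl (hFA0 e)
  · have e := hx.eq_zC_of_le hz.le
    have e' : m.zeta x = m.zBarA := by rw [e, SeqGame.zBarA_eq]
    have h0 : 0 < m.zBarA := m.zA_mem.1.trans hz
    refine ⟨?_, by rw [hFA, e'], hFC0 e, hC0.trans e, hA0.trans e'⟩
    rw [hFA, e', sub_pos, div_lt_one h0]
    exact hz
  · have e := hx.eq_zC_of_le hz.le
    have e' := hx.zeta_eq_zA hz.ge
    exact ⟨hFA0 e', hFC0 e, hA0.trans e', hC0.trans e⟩
  · have e' := hx.zeta_eq_zA hz.le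
    rw [hC0]
    refine ⟨?_, hFA0 e', hFC, hA0.trans e', fun hz' => ?_, fun hz' => ?_⟩
    · rw [hFC, sub_pos, div_lt_one hx.pos]
      exact hx.zC_lt hz
    -- Since z̃_A = `zeta zB` and z_A = `zeta x`, comparing them amounts to comparing `zB` with x,
    -- which selects the branch of `zeta` to invert.
    · rw [SeqGame.zTildeA_eq, ← e', m.zeta_strictMonoOn.le_iff_le m.zB_mem.1 hx.pos] at hz'
      exact ⟨hz', SeqGame.eq_of_zeta_eq_of_ge e' hz'⟩
    · rw [SeqGame.zTildeA_eq, ← e', m.zeta_strictMonoOn.lt_iff_lt hx.pos m.zB_mem.1] at hz'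
      exact ⟨hz', SeqGame.eq_of_zeta_eq_of_lt e' hx.pos hz'⟩
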